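/- Let $\Omega\subset\mathbb{R}^N$ be a non-empty open set and $p\in(1,\infty)$, $1/p+1/p'=1$. Let $W^{1,p}(\Omega)$ be the space of $u\in L^p(\Omega)$ with weak partial derivatives $\partial_i u\in L^p(\Omega)$, normed by $\|u\|^p=\|u\|_{L^p(\Omega)}^p+\sum_{i=1}^N\|\partial_i u\|_{L^p(\Omega)}^p$, and let $\tilde W^{1,p}(\Omega)$ be the closure in $W^{1,p}(\Omega)$ of $W^{1,p}(\Omega)\cap C_c(\overline\Omega)=\{v|_\Omega : v\in C_c(\overline\Omega),\ v|_\Omega\in W^{1,p}(\Omega)\}$. For $A\subset\overline\Omega$ the relative capacity is $$\mathrm{Cap}_{p,\Omega}(A)=\inf\{\|u\|^p : u\in\tilde W^{1,p}(\Omega),\ u\ge 1 \text{ a.e. on } O\cap\Omega \text{ for some } O\supset A \text{ open in } \overline\Omega\}\in[0,\infty].$$ A property holds quasi everywhere (q.e.) if it holds outside a set $P\subset\overline\Omega$ with $\mathrm{Cap}_{p,\Omega}(P)=0$. A function $f:\overline\Omega\to\mathbb{R}$ is quasi continuous if for every $\varepsilon>0$ there is a set $V$ open in $\overline\Omega$ with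 $\mathrm{Cap}_{p,\Omega}(V)<\varepsilon$ such that $f|_{\overline\Omega\setminus V}$ is continuous. The refined Sobolev space $\mathcal{W}^{1,p}(\Omega)$ consists of the classes, modulo equality q.e., of the quasi continuous functions on $\overline\Omega$ that coincide a.e. on $\Omega$ with an element of $\tilde W^{1,p}(\Omega)$; it carries the linear structure and norm of $\tilde W^{1,p}(\Omega)$ (each class being identified with the element of $\tilde W^{1,p}(\Omega)$ given by its representatives), and $\mathcal{W}^{1,p}(\Omega)'$ is its topological dual with the operator norm. A capacitary extremal for $A$ is a $u\in\mathcal{W}^{1,p}(\Omega)$ with $u\ge1$ q.e. on $A$ and $\|u\|^p=\mathrm{Cap}_{p,\Omega}(A)$. A potential of $\Phi\in\mathcal{W}^{1,p}(\Omega)'$ is a minimizer of $v\mapsto\frac1p\|v\|^p-\Phi(v)$ on $\mathcal{W}^{1,p}(\Omega)$. A Radon measure on $\overline\Omega$ is an inner regular, locally finite Borel measure; such a measure $\mu$ belongs to $\mathcal{W}^{1,p}(\Omega)'$ if $\sup\{\int v\,d\mu : v\in \mathcal{W}^{1,p}(\Omega)\cap C_c(\overline\Omega),\ \|v\|\le1\}<\infty$,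 and then $v\mapsto\int v\,d\mu$ has a unique extension to a continuous linear functional on $\mathcal{W}^{1,p}(\Omega)$, again denoted by $\mu$. Its energy is $E_p(\mu,\Omega)=\|\mu\|_{\mathcal{W}^{1,p}(\Omega)'}^{p'}$. A $\mathrm{Cap}_{p,\Omega}$-measure for $A$ is a Radon measure on $\overline\Omega$ that belongs to $\mathcal{W}^{1,p}(\Omega)'$ and has a potential which is a capacitary extremal for $A$. Theorem. Let $A\subset\overline\Omega$ satisfy $\mathrm{Cap}_{p,\Omega}(A)<\infty$. Then there exists a unique $\mathrm{Cap}_{p,\Omega}$-measure $\mu$ for $A$. Moreover, if $u\in\mathcal{W}^{1,p}(\Omega)$ is a capacitary extremal for $A$, then $$\mathrm{Cap}_{p,\Omega}(A)=\|u\|^p=\mu(u)=E_p(\mu,\Omega).$$ -/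

import Mathlib

open MeasureTheory Filter Topology
open scoped ENNReal ContDiff

noncomputable section

namespace RelCap

/-- `g` is the weak `i`-th partial derivative of `u` on `Ω`: integration by parts holds against
every test function, i.e. every smooth function with compact support contained in `Ω`. -/
def IsWeakPartial {N : ℕ} (Ω : Set (EuclideanSpace ℝ (Fin N))) (i : Fin N)
    (u g : EuclideanSpace ℝ (Fin N) → ℝ) : Prop :=
  ∀ φ : EuclideanSpace ℝ (Fin N) → ℝ, ContDiff ℝ ∞ φ → HasCompactSupport φ → tsupport φ ⊆ Ω →
    ∫ x in Ω, u x * fderiv ℝ φ x (EuclideanSpace.single i 1) = - ∫ x in Ω, g x * φ x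

theorem integrable_Lp_mul {N : ℕ} {p : ℝ≥0∞} [Fact (1 ≤ p)]
    {μ : Measure (EuclideanSpace ℝ (Fin N))} [IsFiniteMeasureOnCompacts μ] (u : Lp ℝ p μ)
    {ψ : EuclideanSpace ℝ (Fin N) → ℝ}
    (hψ : Continuous ψ) (hc : HasCompactSupport ψ) :
    Integrable (fun x => u x * ψ x) μ := by
  have h := ((Lp.memLp u).locallyIntegrable Fact.out).integrable_smul_left_of_hasCompactSupport
    hψ hc
  simpa [mul_comm] using h

theorem continuous_partial {N : ℕ} {φ : EuclideanSpace ℝ (Fin N) → ℝ} (hφ : ContDiff ℝ ∞ φ)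
    (v : EuclideanSpace ℝ (Fin N)) : Continuous (fun x => fderiv ℝ φ x v) :=
  (hφ.continuous_fderiv (by simp)).clm_apply continuous_const

/-- The Sobolev space `W^{1,p}(Ω)`. A function `u ∈ L^p(Ω)` with weak derivatives in `L^p(Ω)` is
recorded together with its (unique) weak partial derivatives: `w none` is the function and
`w (some i)` its `i`-th weak partial derivative. The norm of the `ℓ^p`-product `PiLp p` is
`‖w‖ ^ p = ‖u‖_p ^ p + ∑ i, ‖∂ᵢ u‖_p ^ p`. -/
def Sobolev {N : ℕ} (p : ℝ≥0∞) [Fact (1 ≤ p)] (Ω : Set (EuclideanSpace ℝ (Fin N))) :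
    Submodule ℝ (PiLp p fun _ : Option (Fin N) => Lp ℝ p (volume.restrict Ω)) where
  carrier := {w | ∀ i : Fin N, IsWeakPartial Ω i (w none) (w (some i))}
  zero_mem' := by
    intro i φ _ _ _
    have h0 : ∀ ψ : EuclideanSpace ℝ (Fin N) → ℝ,
        ∫ x in Ω, ((0 : Lp ℝ p (volume.restrict Ω)) x) * ψ x = 0 := by
      intro ψ
      rw [← integral_zero (EuclideanSpace ℝ (Fin N)) ℝ (μ := volume.restrict Ω)]
      apply integral_congr_ae
      filter_upwards [Lp.coeFn_zero ℝ p (volume.restrict Ω)] with x hx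
      rw [hx, Pi.zero_apply, zero_mul]
    exact (h0 _).trans ((neg_eq_zero.2 (h0 _)).symm)
  add_mem' := by
    intro a b ha hb i φ h1 h2 h3
    have key : ∀ (j : Option (Fin N)) (ψ : EuclideanSpace ℝ (Fin N) → ℝ), Continuous ψ →
        HasCompactSupport ψ → ∫ x in Ω, ((a + b) j) x * ψ x
          = (∫ x in Ω, (a j) x * ψ x) + ∫ x in Ω, (b j) x * ψ x := by
      intro j ψ hψ hc
      rw [← integral_add (integrable_Lp_mul (a j) hψ hc) (integrable_Lp_mul (b j) hψ hc)]
      apply integral_congr_ae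
      filter_upwards [Lp.coeFn_add (a j) (b j)] with x hx
      rw [PiLp.add_apply, hx, Pi.add_apply, add_mul]
    rw [key none _ (continuous_partial h1 _) (h2.fderiv_apply ℝ _), key (some i) φ h1.continuous h2,
      ha i φ h1 h2 h3, hb i φ h1 h2 h3]
    ring
  smul_mem' := by
    intro c a ha i φ h1 h2 h3
    have key : ∀ (j : Option (Fin N)) (ψ : EuclideanSpace ℝ (Fin N) → ℝ),
        ∫ x in Ω, ((c • a) j) x * ψ x = c * ∫ x in Ω, (a j) x * ψ x := by
      intro j ψ
      rw [← integral_const_mul]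
      apply integral_congr_ae
      filter_upwards [Lp.coeFn_smul c (a j)] with x hx
      rw [PiLp.smul_apply, hx, Pi.smul_apply, smul_eq_mul, mul_assoc]
    rw [key, key, ha i φ h1 h2 h3]
    ring

/-- A function on `closure Ω` agrees almost everywhere on `Ω` with a Sobolev function. -/
def AgreesOn {N : ℕ} {p : ℝ≥0∞} [Fact (1 ≤ p)] {Ω : Set (EuclideanSpace ℝ (Fin N))}
    (f : closure Ω → ℝ) (w : Sobolev p Ω) : Prop :=
  ∀ᵐ x ∂(volume.restrict Ω), ∀ hx : x ∈ closure Ω, f ⟨x, hx⟩ = w.1 none x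

theorem AgreesOn.add {N : ℕ} {p : ℝ≥0∞} [Fact (1 ≤ p)] {Ω : Set (EuclideanSpace ℝ (Fin N))}
    {f g : closure Ω → ℝ} {v w : Sobolev p Ω} (hf : AgreesOn f v) (hg : AgreesOn g w) :
    AgreesOn (f + g) (v + w) := by
  filter_upwards [hf, hg, Lp.coeFn_add (v.1 none) (w.1 none)] with x h1 h2 h3 hx
  have : (v + w).1 none = v.1 none + w.1 none := rfl
  rw [this, h3, Pi.add_apply, Pi.add_apply, h1 hx, h2 hx]

theorem AgreesOn.smul {N : ℕ} {p : ℝ≥0∞} [Fact (1 ≤ p)] {Ω : Set (EuclideanSpace ℝ (Fin N))}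
    (c : ℝ) {f : closure Ω → ℝ} {v : Sobolev p Ω} (hf : AgreesOn f v) :
    AgreesOn (c • f) (c • v) := by
  filter_upwards [hf, Lp.coeFn_smul c (v.1 none)] with x h1 h3 hx
  have : (c • v).1 none = c • v.1 none := rfl
  rw [this, h3, Pi.smul_apply, Pi.smul_apply, h1 hx]

theorem agreesOn_zero {N : ℕ} {p : ℝ≥0∞} [Fact (1 ≤ p)] {Ω : Set (EuclideanSpace ℝ (Fin N))} :
    AgreesOn (0 : closure Ω → ℝ) (0 : Sobolev p Ω) := by
  filter_upwards [Lp.coeFn_zero ℝ p (volume.restrict Ω)] with x h3 hx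
  have : (0 : Sobolev p Ω).1 none = 0 := rfl
  rw [this, h3]
  rfl

/-- The function in `W^{1,p}(Ω)` determines its weak derivatives, so that a function on
`closure Ω` agrees almost everywhere on `Ω` with at most one element of `W^{1,p}(Ω)`. -/
theorem AgreesOn.unique {N : ℕ} {p : ℝ≥0∞} [Fact (1 ≤ p)]
    {Ω : Set (EuclideanSpace ℝ (Fin N))} (hΩ : IsOpen Ω) {f : closure Ω → ℝ} {v w : Sobolev p Ω}
    (hv : AgreesOn f v) (hw : AgreesOn f w) : v = w := by
  have h0 : v.1 none = w.1 none := by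
    apply Lp.ext
    filter_upwards [hv, hw, ae_restrict_mem hΩ.measurableSet] with x h1 h2 hx
    rw [← h1 (subset_closure hx), h2 (subset_closure hx)]
  apply Subtype.ext
  apply PiLp.ext
  rintro (_ | i)
  · exact h0
  · apply Lp.ext
    have hloc : ∀ g : Lp ℝ p (volume.restrict Ω), LocallyIntegrableOn g Ω volume := fun g =>
      locallyIntegrableOn_of_locallyIntegrable_restrict ((Lp.memLp g).locallyIntegrable Fact.out)
    have hd := hΩ.ae_eq_zero_of_integral_contDiff_smul_eq_zero (μ := volume)
      ((hloc (v.1 (some i))).sub (hloc (w.1 (some i)))) (by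
        intro φ h1 h2 h3
        have e1 := v.2 i φ h1 h2 h3
        have e2 := w.2 i φ h1 h2 h3
        rw [h0, e2, neg_inj] at e1
        have e3 := integral_sub (integrable_Lp_mul (v.1 (some i)) h1.continuous h2)
          (integrable_Lp_mul (w.1 (some i)) h1.continuous h2)
        rw [← e1, sub_self] at e3
        rw [← setIntegral_eq_integral_of_forall_compl_eq_zero (s := Ω), ← e3]
        · apply integral_congr_ae
          refine Eventually.of_forall fun x => ?_
          simp only [smul_eq_mul, Pi.sub_apply]
          ring
        · intro x hx
          rw [image_eq_zero_of_notMem_tsupport (fun h => hx (h3 h)), zero_smul])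
    rw [Filter.EventuallyEq, ae_restrict_iff' hΩ.measurableSet]
    filter_upwards [hd] with x hx hxΩ
    have := hx hxΩ
    rwa [Pi.sub_apply, sub_eq_zero] at this

/-- `W^{1,p}(Ω) ∩ C_c(closure Ω)`: the Sobolev functions that are restrictions to `Ω` of
continuous functions with compact support on `closure Ω`. -/
def ccSobolev {N : ℕ} (p : ℝ≥0∞) [Fact (1 ≤ p)] (Ω : Set (EuclideanSpace ℝ (Fin N))) :
    Submodule ℝ (Sobolev p Ω) where
  carrier := {w | ∃ v : CompactlySupportedContinuousMap (closure Ω) ℝ, AgreesOn v w}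
  zero_mem' := ⟨0, agreesOn_zero⟩
  add_mem' := by
    rintro a b ⟨v, hv⟩ ⟨w, hw⟩
    exact ⟨v + w, hv.add hw⟩
  smul_mem' := by
    rintro c a ⟨v, hv⟩
    exact ⟨c • v, hv.smul c⟩

/-- `W̃^{1,p}(Ω)`: the closure of `W^{1,p}(Ω) ∩ C_c(closure Ω)` in `W^{1,p}(Ω)`. -/
def TildeSobolev {N : ℕ} (p : ℝ≥0∞) [Fact (1 ≤ p)] (Ω : Set (EuclideanSpace ℝ (Fin N))) :
    Submodule ℝ (Sobolev p Ω) :=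
  (ccSobolev p Ω).topologicalClosure

/-- `𝒴_{p,Ω}(A)`: the functions in `W̃^{1,p}(Ω)` that are at least `1` almost everywhere on
`O ∩ Ω` for some relatively open `O ⊆ closure Ω` containing `A`. -/
def admissible {N : ℕ} (p : ℝ≥0∞) [Fact (1 ≤ p)] (Ω : Set (EuclideanSpace ℝ (Fin N)))
    (A : Set (closure Ω)) : Set (TildeSobolev p Ω) :=
  {u | ∃ O : Set (closure Ω), IsOpen O ∧ A ⊆ O ∧
    ∀ᵐ x ∂(volume.restrict Ω), x ∈ (Subtype.val '' O) → 1 ≤ u.1.1 none x}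

/-- The relative `p`-capacity of `A ⊆ closure Ω` (the infimum over the empty set is `∞`). -/
def relCap {N : ℕ} (p : ℝ≥0∞) [Fact (1 ≤ p)] (Ω : Set (EuclideanSpace ℝ (Fin N)))
    (A : Set (closure Ω)) : ℝ≥0∞ :=
  ⨅ u ∈ admissible p Ω A, ENNReal.ofReal (‖u‖ ^ p.toReal)

/-- `f` is quasi continuous on `closure Ω` with respect to the relative capacity. -/
def QuasiContinuous {N : ℕ} (p : ℝ≥0∞) [Fact (1 ≤ p)] (Ω : Set (EuclideanSpace ℝ (Fin N)))
    (f : closure Ω → ℝ) : Prop :=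
  ∀ ε : ℝ≥0∞, 0 < ε → ∃ V : Set (closure Ω), IsOpen V ∧ relCap p Ω V < ε ∧ ContinuousOn f Vᶜ

/-- The equivalence class `[f]`: all quasi continuous functions on `closure Ω` that coincide
with `f` outside a set of relative capacity zero. -/
def quasiClass {N : ℕ} (p : ℝ≥0∞) [Fact (1 ≤ p)] (Ω : Set (EuclideanSpace ℝ (Fin N)))
    (f : closure Ω → ℝ) : Set (closure Ω → ℝ) :=
  {g | QuasiContinuous p Ω g ∧ ∃ P : Set (closure Ω), relCap p Ω P = 0 ∧ ∀ x ∉ P, g x = f x}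

/-- The refined Sobolev space `𝒲^{1,p}(Ω)`: the set of the classes `[f]`, where `f` is a quasi
continuous version of some `u ∈ W̃^{1,p}(Ω)`. -/
def Refined {N : ℕ} (p : ℝ≥0∞) [Fact (1 ≤ p)] (Ω : Set (EuclideanSpace ℝ (Fin N))) : Type :=
  {c : Set (closure Ω → ℝ) // ∃ u : TildeSobolev p Ω, ∃ f : closure Ω → ℝ,
    QuasiContinuous p Ω f ∧ AgreesOn f u.1 ∧ c = quasiClass p Ω f}

/-- The element of `W̃^{1,p}(Ω)` underlying an element of `𝒲^{1,p}(Ω)`; by `Refined.agreesOn`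
below it is the restriction to `Ω` of every representative. The vector space structure and the
norm of `𝒲^{1,p}(Ω)` are those of `W̃^{1,p}(Ω)` under this identification. -/
def Refined.toTilde {N : ℕ} {p : ℝ≥0∞} [Fact (1 ≤ p)] {Ω : Set (EuclideanSpace ℝ (Fin N))}
    (c : Refined p Ω) : TildeSobolev p Ω :=
  c.2.choose

/-- The norm of `𝒲^{1,p}(Ω)`. -/
instance {N : ℕ} {p : ℝ≥0∞} [Fact (1 ≤ p)] {Ω : Set (EuclideanSpace ℝ (Fin N))} :
    Norm (Refined p Ω) :=
  ⟨fun c => ‖c.toTilde‖⟩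

theorem relCap_empty {N : ℕ} {p : ℝ≥0∞} [Fact (1 ≤ p)] (hp : p < ⊤)
    {Ω : Set (EuclideanSpace ℝ (Fin N))} : relCap p Ω ∅ = 0 := by
  have hp0 : p.toReal ≠ 0 := (ENNReal.toReal_pos
    (zero_lt_one.trans_le (Fact.out : (1 : ℝ≥0∞) ≤ p)).ne' hp.ne).ne'
  refine le_antisymm (iInf₂_le_of_le 0 ⟨∅, isOpen_empty, subset_rfl, by simp⟩ ?_) bot_le
  simp [Real.zero_rpow hp0]

/-- Sets of relative capacity zero are Lebesgue null in `Ω`. -/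
theorem ae_notMem_of_relCap_eq_zero {N : ℕ} {p : ℝ≥0∞} [Fact (1 ≤ p)] (hp : p < ⊤)
    {Ω : Set (EuclideanSpace ℝ (Fin N))} {P : Set (closure Ω)} (hP : relCap p Ω P = 0) :
    ∀ᵐ x ∂(volume.restrict Ω), x ∉ (Subtype.val '' P) := by
  have hp0 : p ≠ 0 := (zero_lt_one.trans_le (Fact.out : (1 : ℝ≥0∞) ≤ p)).ne'
  have hpr : 0 < p.toReal := ENNReal.toReal_pos hp0 hp.ne
  suffices h : volume.restrict Ω (Subtype.val '' P) ≤ relCap p Ω P by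
    rw [hP] at h
    have h' := le_antisymm h bot_le
    rw [ae_iff]
    simpa only [not_not, Set.ofPred_mem_eq] using h'
  refine le_iInf₂ fun u ⟨O, _, hPO, hu⟩ => ?_
  have h1 : volume.restrict Ω (Subtype.val '' P)
      ≤ volume.restrict Ω {x | (1 : ℝ≥0∞) ≤ ‖u.1.1 none x‖ₑ} := by
    apply measure_mono_ae
    filter_upwards [hu] with x hx hxP
    have h2 : 1 ≤ u.1.1 none x := hx (Set.image_mono hPO hxP)
    change (1 : ℝ≥0∞) ≤ ‖u.1.1 none x‖ₑ
    rw [Real.enorm_eq_ofReal (zero_le_one.trans h2)]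
    simpa using h2
  have h3 := mul_meas_ge_le_pow_eLpNorm' (volume.restrict Ω) hp0 hp.ne
    (Lp.aestronglyMeasurable (u.1.1 none)) 1
  rw [ENNReal.one_rpow, one_mul] at h3
  refine (h1.trans h3).trans ?_
  have h4 : ‖u.1.1 none‖ ≤ ‖u‖ := PiLp.norm_apply_le u.1.1 none
  rw [← ENNReal.ofReal_rpow_of_nonneg (norm_nonneg u) hpr.le]
  gcongr
  rw [← Lp.enorm_def, ← ofReal_norm]
  exact ENNReal.ofReal_le_ofReal h4

theorem Refined.agreesOn {N : ℕ} {p : ℝ≥0∞} [Fact (1 ≤ p)] (hp : p < ⊤)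
    {Ω : Set (EuclideanSpace ℝ (Fin N))} (c : Refined p Ω) {f : closure Ω → ℝ} (hf : f ∈ c.1) :
    AgreesOn f c.toTilde.1 := by
  obtain ⟨g, _, h2, h3⟩ := c.2.choose_spec
  rw [h3] at hf
  obtain ⟨_, P, hP, hPf⟩ := hf
  filter_upwards [h2, ae_notMem_of_relCap_eq_zero hp hP] with x h4 h5 hx
  rw [hPf _ (fun h => h5 ⟨_, h, rfl⟩)]
  exact h4 hx

theorem Refined.nonempty {N : ℕ} {p : ℝ≥0∞} [Fact (1 ≤ p)] (hp : p < ⊤)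
    {Ω : Set (EuclideanSpace ℝ (Fin N))} (c : Refined p Ω) : c.1.Nonempty := by
  obtain ⟨u, f, h1, _, h3⟩ := c.2
  rw [h3]
  exact ⟨f, h1, ∅, relCap_empty hp, fun _ _ => rfl⟩

/-- The topological dual `𝒲^{1,p}(Ω)'`, with the operator norm. A functional acts on
`𝒲^{1,p}(Ω)` through the isometric identification with `W̃^{1,p}(Ω)`. -/
abbrev RefinedDual {N : ℕ} (p : ℝ≥0∞) [Fact (1 ≤ p)] (Ω : Set (EuclideanSpace ℝ (Fin N))) :
    Type :=
  StrongDual ℝ (TildeSobolev p Ω)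

/-- `c` is a potential of the functional `Φ`: it minimizes `‖v‖ ^ p / p - Φ v` on
`𝒲^{1,p}(Ω)`. -/
def IsPotential {N : ℕ} (p : ℝ≥0∞) [Fact (1 ≤ p)] (Ω : Set (EuclideanSpace ℝ (Fin N)))
    (Φ : RefinedDual p Ω) (c : Refined p Ω) : Prop :=
  ∀ v : Refined p Ω, 1 / p.toReal * ‖c‖ ^ p.toReal - Φ c.toTilde
    ≤ 1 / p.toReal * ‖v‖ ^ p.toReal - Φ v.toTilde

/-- `c` is a capacitary extremal for `A`: its representatives are at least `1` quasi everywhere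
on `A`, and `‖c‖ ^ p` is the relative capacity of `A`. -/
def IsExtremal {N : ℕ} (p : ℝ≥0∞) [Fact (1 ≤ p)] (Ω : Set (EuclideanSpace ℝ (Fin N)))
    (A : Set (closure Ω)) (c : Refined p Ω) : Prop :=
  (∀ f ∈ c.1, ∃ P : Set (closure Ω), relCap p Ω P = 0 ∧ ∀ x ∈ A, x ∉ P → 1 ≤ f x) ∧
    ENNReal.ofReal (‖c‖ ^ p.toReal) = relCap p Ω A

/-- Radon measures: inner regular (with respect to compact sets) and locally finite. -/
def IsRadon {X : Type*} [TopologicalSpace X] [MeasurableSpace X] (μ : Measure X) : Prop :=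
  μ.InnerRegular ∧ IsLocallyFiniteMeasure μ

/-- A measure on `closure Ω` belongs to `𝒲^{1,p}(Ω)'`: the integrals of the functions in
`𝒲^{1,p}(Ω) ∩ C_c(closure Ω)` of norm at most `1` are bounded above. -/
def BelongsToDual {N : ℕ} (p : ℝ≥0∞) [Fact (1 ≤ p)] (Ω : Set (EuclideanSpace ℝ (Fin N)))
    (μ : Measure (closure Ω)) : Prop :=
  BddAbove {r : ℝ | ∃ (v : CompactlySupportedContinuousMap (closure Ω) ℝ) (w : Sobolev p Ω),
    AgreesOn v w ∧ ‖w‖ ≤ 1 ∧ r = ∫ x, v x ∂μ}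

/-- `Φ` extends `v ↦ ∫ v dμ` from `𝒲^{1,p}(Ω) ∩ C_c(closure Ω)`. -/
def IsExtension {N : ℕ} {p : ℝ≥0∞} [Fact (1 ≤ p)] {Ω : Set (EuclideanSpace ℝ (Fin N))}
    (μ : Measure (closure Ω)) (Φ : RefinedDual p Ω) : Prop :=
  ∀ (v : CompactlySupportedContinuousMap (closure Ω) ℝ) (w : TildeSobolev p Ω),
    AgreesOn v w.1 → Φ w = ∫ x, v x ∂μ

theorem AgreesOn.eq_of_continuous {N : ℕ} {p : ℝ≥0∞} [Fact (1 ≤ p)]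
    {Ω : Set (EuclideanSpace ℝ (Fin N))} (hΩ : IsOpen Ω) {f g : closure Ω → ℝ} {w : Sobolev p Ω}
    (hfc : Continuous f) (hgc : Continuous g) (hf : AgreesOn f w) (hg : AgreesOn g w) :
    f = g := by
  classical
  have hd : DenseRange (Set.inclusion (subset_closure (s := Ω))) :=
    (denseRange_inclusion_iff _).2 subset_rfl
  have hι : Continuous (Set.inclusion (subset_closure (s := Ω))) := continuous_inclusion _
  refine hd.equalizer hfc hgc (funext fun y => ?_)
  let ext (h : closure Ω → ℝ) (x : EuclideanSpace ℝ (Fin N)) : ℝ :=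
    if hx : x ∈ closure Ω then h ⟨x, hx⟩ else 0
  have hext : ∀ h : closure Ω → ℝ,
      Ω.domRestrict (ext h) = h ∘ Set.inclusion (subset_closure (s := Ω)) := by
    intro h
    funext z
    exact dif_pos (subset_closure z.2)
  have hcont : ∀ h : closure Ω → ℝ, Continuous h → ContinuousOn (ext h) Ω := by
    intro h hh
    rw [continuousOn_iff_continuous_domRestrict, hext]
    exact hh.comp hι
  have hae : ext f =ᵐ[volume.restrict Ω] ext g := by
    filter_upwards [hf, hg, ae_restrict_mem hΩ.measurableSet] with x h1 h2 hx
    have hx' := subset_closure hx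
    simp only [ext, dif_pos hx', h1 hx', h2 hx']
  have := Measure.eqOn_open_of_ae_eq hae hΩ (hcont f hfc) (hcont g hgc) y.2
  rw [← hext f, ← hext g]
  exact this

theorem existsUnique_extension_closure {X : Type*} [NormedAddCommGroup X] [NormedSpace ℝ X]
    (S : Submodule ℝ X) (L : S →ₗ[ℝ] ℝ) (M : ℝ) (hL1 : ∀ w : S, ‖w‖ ≤ 1 → L w ≤ M) :
    ∃! Φ : StrongDual ℝ S.topologicalClosure,
      ∀ w : S, Φ ⟨w.1, S.le_topologicalClosure w.2⟩ = L w := by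
  have hL2 : ∀ w : S, L w ≤ M * ‖w‖ := by
    intro w
    rcases eq_or_ne w 0 with rfl | hw
    · simp
    · have hpos : 0 < ‖w‖ := norm_pos_iff.2 hw
      have h := hL1 (‖w‖⁻¹ • w) (by rw [norm_smul, norm_inv, norm_norm, inv_mul_cancel₀ hpos.ne'])
      rw [map_smul, smul_eq_mul, inv_mul_le_iff₀ hpos] at h
      linarith
  have hL3 : ∀ w : S, ‖L w‖ ≤ M * ‖w‖ := by
    intro w
    rw [Real.norm_eq_abs, abs_le]
    have h := hL2 (-w)
    rw [map_neg, norm_neg] at h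
    exact ⟨by linarith, hL2 w⟩
  let e : S →ₗᵢ[ℝ] S.topologicalClosure :=
    { Submodule.inclusion S.le_topologicalClosure with norm_map' := fun _ => rfl }
  have he : DenseRange e :=
    (denseRange_inclusion_iff (s := (S : Set X)) S.le_topologicalClosure).2 subset_rfl
  have h := ContinuousLinearMap.extend_eq (L.mkContinuous M hL3) (e := e.toContinuousLinearMap) he
      e.isometry.isUniformInducing
  refine ⟨(L.mkContinuous M hL3).extend e.toContinuousLinearMap, h, ?_⟩
  intro Φ hΦ
  refine ContinuousLinearMap.ext fun w => ?_
  refine congrFun (he.equalizer Φ.continuous (ContinuousLinearMap.continuous _)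
    (funext fun z => ?_)) w
  exact (hΦ z).trans (h z).symm

/-- A Radon measure that belongs to `𝒲^{1,p}(Ω)'` has a unique continuous extension. -/
theorem existsUnique_isExtension {N : ℕ} {p : ℝ≥0∞} [Fact (1 ≤ p)]
    {Ω : Set (EuclideanSpace ℝ (Fin N))} (hΩ : IsOpen Ω) {μ : Measure (closure Ω)}
    (hμ : IsRadon μ) (hd : BelongsToDual p Ω μ) :
    ∃! Φ : RefinedDual p Ω, IsExtension μ Φ := by
  have := hμ.2
  have hint : ∀ v : CompactlySupportedContinuousMap (closure Ω) ℝ, Integrable v μ := fun v =>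
    v.continuous.integrable_of_hasCompactSupport v.hasCompactSupport
  choose r hr using fun w : ccSobolev p Ω => w.2
  have hr' : ∀ (w : ccSobolev p Ω) (v : CompactlySupportedContinuousMap (closure Ω) ℝ),
      AgreesOn v w.1 → (r w : closure Ω → ℝ) = v := fun w v hv =>
    (hr w).eq_of_continuous hΩ (r w).continuous v.continuous hv
  let L : ccSobolev p Ω →ₗ[ℝ] ℝ :=
    { toFun := fun w => ∫ x, r w x ∂μ
      map_add' := by
        intro a b
        have h := hr' (a + b) (r a + r b) ((hr a).add (hr b))
        rw [h, ← integral_add (hint _) (hint _)]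
        rfl
      map_smul' := by
        intro c a
        have h := hr' (c • a) (c • r a) ((hr a).smul c)
        rw [h, RingHom.id_apply, smul_eq_mul, ← integral_const_mul]
        rfl }
  obtain ⟨M, hM⟩ := hd
  obtain ⟨Φ, hΦ, hΦu⟩ := existsUnique_extension_closure (ccSobolev p Ω) L M fun w hw =>
    hM ⟨r w, w.1, hr w, hw, rfl⟩
  refine ⟨Φ, fun v w hv => ?_, fun Ψ hΨ => hΦu Ψ fun w => hΨ (r w) ⟨w.1, _⟩ (hr w)⟩
  refine (hΦ ⟨w.1, v, hv⟩).trans ?_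
  change ∫ x, r ⟨w.1, v, hv⟩ x ∂μ = _
  rw [hr' ⟨w.1, v, hv⟩ v hv]

open Classical in
/-- The continuous functional on `𝒲^{1,p}(Ω)` given by a Radon measure `μ` that belongs to
`𝒲^{1,p}(Ω)'`: the unique continuous extension of `v ↦ ∫ v dμ` (see `existsUnique_isExtension`);
it is `0` by convention if there is no continuous extension. -/
def toDual {N : ℕ} (p : ℝ≥0∞) [Fact (1 ≤ p)] (Ω : Set (EuclideanSpace ℝ (Fin N)))
    (μ : Measure (closure Ω)) : RefinedDual p Ω :=
  if h : ∃ Φ : RefinedDual p Ω, IsExtension μ Φ then h.choose else 0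

/-- The energy `E_p(μ, Ω) = ‖μ‖ ^ p'` with `1 / p + 1 / p' = 1`, where `‖μ‖` is the norm in
`𝒲^{1,p}(Ω)'`. -/
def energy {N : ℕ} (p : ℝ≥0∞) [Fact (1 ≤ p)] (Ω : Set (EuclideanSpace ℝ (Fin N)))
    (μ : Measure (closure Ω)) : ℝ :=
  ‖toDual p Ω μ‖ ^ (Real.conjExponent p.toReal)

/-- `μ` is a capacitary measure for `A`: a Radon measure on `closure Ω` belonging to
`𝒲^{1,p}(Ω)'` whose potential is the capacitary extremal for `A`. -/
def IsCapMeasure {N : ℕ} (p : ℝ≥0∞) [Fact (1 ≤ p)] (Ω : Set (EuclideanSpace ℝ (Fin N)))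
    (A : Set (closure Ω)) (μ : Measure (closure Ω)) : Prop :=
  IsRadon μ ∧ BelongsToDual p Ω μ ∧
    ∃ u : Refined p Ω, IsPotential p Ω (toDual p Ω μ) u ∧ IsExtremal p Ω A u

end RelCap

end

/-! The space `Tilde p Ω` is a closed subspace of a finite `ℓ^p` product of `L^p` spaces. For `1 < p
< ∞` the function `v ↦ ‖v‖ ^ p / p` is uniformly convex on bounded sets there, and it has a
derivative `J_u` at every `u`, namely `J_u(v) = ∑ j, ∫ |u_j|^(p-2) u_j v_j`. By convexity, `u` is a
potential of `Φ` exactly when `Φ = J_u`.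

Extremal. The competitors in the definition of the capacity form a convex set, so a norm-minimizing
sequence converges strongly, to some `z`. Two facts about quasi continuous versions turn `z` into an
extremal. A quasi continuous function that is at least `1` a.e. on an open set is at least `1` q.e.
there (`relCap_lt_one_eq_zero`), and this survives strong limits (`relCap_lt_of_tendsto_geOneOn`).
Conversely, a quasi continuous function that is at least `1` q.e. on `A` has `‖·‖ ^ p` at least the
capacity of `A` (`relCap_le_of_one_le`). Hence midpoints of extremals are again competitors, and
uniform convexity makes the extremal `u` unique (`extremal_unique`).

Measure. If `v ≥ 0` is continuous with compact support and lies in the space, then `u + t v` with `t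
≥ 0` is still at least `1` q.e. on `A`, so its norm is at least that of `u` and `J_u(v) ≥ 0`. The
extension theorem of M. Riesz carries this positive functional to all of `C_c`, and Riesz–Markov
yields a measure `μ` whose functional is `J_u` (`exists_measure_of_nonneg`).

Uniqueness and formulas. Any capacitary measure has a potential that is extremal, so its functional
is `J_u` for the same `u`; as a Radon measure is determined by its integrals of smooth functions,
the measure is unique. The identities are `J_u(u) = ‖u‖ ^ p` and `‖J_u‖ = ‖u‖ ^ (p - 1)`, together
with `(p - 1) p' = p`.

Subadditivity of capacity rests on nonnegative competitors, hence on stability of the space under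
absolute values (`exists_abs`). This comes from a chain rule for smooth contractions, proved by
mollification, and a limit argument in which uniform convexity does the work of weak compactness. -/

namespace RelCap

/-! ### Pointwise inequalities for `t ↦ |t| ^ q`. -/

section PowerInequalities

theorem rpow_abs_midpoint_lt {q : ℝ} (hq : 1 < q) {a b : ℝ} (hab : a ≠ b) :
    |(a + b) / 2| ^ q < (|a| ^ q + |b| ^ q) / 2 := by
  have hq0 : 0 < q := by linarith
  by_cases h : |a| = |b|
  · have hb : a = -b := (abs_eq_abs.1 h).resolve_left hab
    have hb0 : b ≠ 0 := by
      rintro rfl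
      exact hab (by simpa using hb)
    have hpos : 0 < |b| ^ q := Real.rpow_pos_of_pos (abs_pos.2 hb0) q
    rw [h, hb, neg_add_cancel, zero_div, abs_zero, Real.zero_rpow hq0.ne']
    linarith
  · have h1 := (strictConvexOn_rpow hq).2 (abs_nonneg a) (abs_nonneg b) h
      (by norm_num : (0 : ℝ) < 1 / 2) (by norm_num : (0 : ℝ) < 1 / 2) (by norm_num)
    simp only [smul_eq_mul] at h1
    have h2 : |(a + b) / 2| ≤ 1 / 2 * |a| + 1 / 2 * |b| := by
      rw [abs_div, abs_two]
      linarith [abs_add_le a b]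
    have h3 := Real.rpow_le_rpow (abs_nonneg _) h2 hq0.le
    linarith

theorem rpow_abs_midpoint_le {q : ℝ} (hq : 1 < q) (a b : ℝ) :
    |(a + b) / 2| ^ q ≤ (|a| ^ q + |b| ^ q) / 2 := by
  rcases eq_or_ne a b with rfl | h
  · rw [add_self_div_two, add_self_div_two]
  · exact (rpow_abs_midpoint_lt hq h).le

/-- A quantitative form of the strict convexity of `t ↦ |t| ^ q`. -/
theorem exists_rpow_abs_sub_le {q : ℝ} (hq : 1 < q) {ε : ℝ} (hε : 0 < ε) :
    ∃ C : ℝ, 0 ≤ C ∧ ∀ a b : ℝ, |a - b| ^ q ≤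
      ε * (|a| ^ q + |b| ^ q) + C * ((|a| ^ q + |b| ^ q) / 2 - |(a + b) / 2| ^ q) := by
  have hq0 : 0 < q := by linarith
  let G : ℝ × ℝ → ℝ := fun z => (|z.1| ^ q + |z.2| ^ q) / 2 - |(z.1 + z.2) / 2| ^ q
  have hG : Continuous G := by
    have h1 : Continuous fun z : ℝ × ℝ => |z.1| ^ q :=
      continuous_fst.abs.rpow_const fun _ => Or.inr hq0.le
    have h2 : Continuous fun z : ℝ × ℝ => |z.2| ^ q :=
      continuous_snd.abs.rpow_const fun _ => Or.inr hq0.le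
    have h3 : Continuous fun z : ℝ × ℝ => |(z.1 + z.2) / 2| ^ q :=
      ((continuous_fst.add continuous_snd).div_const 2).abs.rpow_const fun _ => Or.inr hq0.le
    exact ((h1.add h2).div_const 2).sub h3
  have hG0 : ∀ z, 0 ≤ G z := fun z => sub_nonneg.2 (rpow_abs_midpoint_le hq z.1 z.2)
  -- By homogeneity it suffices to treat the unit sphere. The `C` term is only needed on the compact
  -- set `Z`. Diagonal points do not lie in `Z`, so the convexity gap `G` has a positive minimum `m`
  -- there, and `|a - b| ^ q ≤ 2 ^ q` gives `C = 2 ^ q / m`.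
  let Z : Set (ℝ × ℝ) := Metric.sphere 0 1 ∩ {z | ε * (|z.1| ^ q + |z.2| ^ q) ≤ |z.1 - z.2| ^ q}
  have hZ : IsCompact Z := by
    refine (isCompact_sphere _ _).inter_right (isClosed_le ?_ ?_)
    · exact continuous_const.mul ((continuous_fst.abs.rpow_const fun _ => Or.inr hq0.le).add
        (continuous_snd.abs.rpow_const fun _ => Or.inr hq0.le))
    · exact (continuous_fst.sub continuous_snd).abs.rpow_const fun _ => Or.inr hq0.le
  have hone : ∀ z ∈ Metric.sphere (0 : ℝ × ℝ) 1, |z.1| ≤ 1 ∧ |z.2| ≤ 1 := by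
    intro z hz
    rw [mem_sphere_zero_iff_norm] at hz
    exact ⟨hz ▸ norm_fst_le z, hz ▸ norm_snd_le z⟩
  have hGpos : ∀ z ∈ Z, 0 < G z := by
    rintro ⟨a, b⟩ ⟨h1, h2⟩
    refine sub_pos.2 (rpow_abs_midpoint_lt hq fun hab => ?_)
    simp only at hab
    subst hab
    simp only [Set.mem_ofPred_eq, sub_self, abs_zero, Real.zero_rpow hq0.ne'] at h2
    have ha : a ≠ 0 := by
      rintro rfl
      rw [mem_sphere_zero_iff_norm] at h1
      simp at h1
    have := Real.rpow_pos_of_pos (abs_pos.2 ha) q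
    nlinarith
  obtain ⟨m, hm, hmG⟩ : ∃ m : ℝ, 0 < m ∧ ∀ z ∈ Z, m ≤ G z := by
    rcases Z.eq_empty_or_nonempty with h | h
    · exact ⟨1, one_pos, by simp [h]⟩
    · obtain ⟨z, hz, hzm⟩ := hZ.exists_isMinOn h hG.continuousOn
      exact ⟨G z, hGpos z hz, fun w hw => hzm hw⟩
  have hC : 0 ≤ (2 : ℝ) ^ q / m := by positivity
  refine ⟨2 ^ q / m, hC, ?_⟩
  have hsph : ∀ z ∈ Metric.sphere (0 : ℝ × ℝ) 1,
      |z.1 - z.2| ^ q ≤ ε * (|z.1| ^ q + |z.2| ^ q) + 2 ^ q / m * G z := by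
    intro z hz
    by_cases h : ε * (|z.1| ^ q + |z.2| ^ q) ≤ |z.1 - z.2| ^ q
    · have h1 : |z.1 - z.2| ^ q ≤ 2 ^ q := by
        refine Real.rpow_le_rpow (abs_nonneg _) ?_ hq0.le
        have := abs_sub z.1 z.2
        have := hone z hz
        linarith
      have h2 : (2 : ℝ) ^ q ≤ 2 ^ q / m * G z := by
        rw [div_mul_eq_mul_div, le_div_iff₀ hm]
        exact mul_le_mul_of_nonneg_left (hmG z ⟨hz, h⟩) (by positivity)
      have h3 : 0 ≤ ε * (|z.1| ^ q + |z.2| ^ q) := by positivity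
      linarith
    · have := mul_nonneg hC (hG0 z)
      linarith
  intro a b
  rcases eq_or_ne ((a, b) : ℝ × ℝ) 0 with h0 | h0
  · obtain ⟨rfl, rfl⟩ := Prod.mk_eq_zero.1 h0
    simp [Real.zero_rpow hq0.ne']
  · set r : ℝ := ‖((a, b) : ℝ × ℝ)‖ with hr
    have hrpos : 0 < r := norm_pos_iff.2 h0
    -- Both sides are homogeneous of degree `q`, so the estimate on the sphere scales back to `(a,
    -- b)`.
    have h := hsph (r⁻¹ • (a, b)) (by
      rw [mem_sphere_zero_iff_norm, norm_smul, norm_inv, norm_norm, inv_mul_cancel₀ hrpos.ne'])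
    have hs : ∀ t : ℝ, |r⁻¹ * t| ^ q = (r⁻¹) ^ q * |t| ^ q := by
      intro t
      rw [abs_mul, abs_of_pos (inv_pos.2 hrpos),
        Real.mul_rpow (inv_pos.2 hrpos).le (abs_nonneg t)]
    simp only [G, Prod.smul_mk, smul_eq_mul] at h
    rw [← mul_sub, ← mul_add, mul_div_assoc, hs, hs, hs, hs] at h
    have hk : 0 < (r⁻¹) ^ q := Real.rpow_pos_of_pos (inv_pos.2 hrpos) q
    refine le_of_mul_le_mul_left (h.trans_eq ?_) hk
    ring

/-- The derivative of `t ↦ |t| ^ q / q`. -/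
noncomputable def powDeriv (q a : ℝ) : ℝ := |a| ^ (q - 2) * a

theorem powDeriv_mul_self {q : ℝ} (hq : 1 < q) (a : ℝ) : powDeriv q a * a = |a| ^ q := by
  rcases eq_or_ne a 0 with rfl | ha
  · simp [powDeriv, Real.zero_rpow (by linarith : q ≠ 0)]
  · have h := abs_pos.2 ha
    rw [powDeriv, mul_assoc, ← abs_mul_abs_self a, ← pow_two, ← Real.rpow_natCast,
      ← Real.rpow_add h]
    norm_num

theorem abs_powDeriv {q : ℝ} (hq : 1 < q) (a : ℝ) : |powDeriv q a| = |a| ^ (q - 1) := by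
  rcases eq_or_ne a 0 with rfl | ha
  · simp [powDeriv, Real.zero_rpow (by linarith : q - 1 ≠ 0)]
  · have h := abs_pos.2 ha
    rw [powDeriv, abs_mul, abs_of_pos (Real.rpow_pos_of_pos h _)]
    nth_rw 2 [← Real.rpow_one |a|]
    rw [← Real.rpow_add h]
    ring_nf

theorem hasDerivAt_rpow_abs_div {q : ℝ} (hq : 1 < q) (a : ℝ) :
    HasDerivAt (fun t : ℝ => |t| ^ q / q) (powDeriv q a) a := by
  have h := (hasDerivAt_abs_rpow a hq).div_const q
  refine h.congr_deriv ?_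
  rw [powDeriv]
  field_simp

theorem continuous_powDeriv {q : ℝ} (hq : 1 < q) : Continuous (powDeriv q) := by
  rw [continuous_iff_continuousAt]
  intro a
  -- The origin is separate because `|t| ^ (q - 2)` is unbounded near `0` when `q < 2`; only the
  -- product with `t` tends to `0`.
  rcases eq_or_ne a 0 with rfl | ha
  · have h : Tendsto (fun t : ℝ => |t| ^ (q - 1)) (𝓝 0) (𝓝 0) := by
      have : Continuous fun t : ℝ => |t| ^ (q - 1) :=
        continuous_abs.rpow_const fun _ => Or.inr (by linarith)
      simpa [Real.zero_rpow (by linarith : q - 1 ≠ 0)] using this.tendsto 0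
    rw [ContinuousAt, show powDeriv q 0 = 0 by simp [powDeriv]]
    exact squeeze_zero_norm (fun t => (abs_powDeriv hq t).le) h
  · exact ContinuousAt.mul (continuous_abs.continuousAt.rpow_const
      (Or.inl (abs_ne_zero.2 ha))) continuousAt_id

theorem convexOn_rpow_abs_div {q : ℝ} (hq : 1 < q) :
    ConvexOn ℝ Set.univ (fun t : ℝ => |t| ^ q / q) := by
  have hq0 : 0 < q := by linarith
  have h : ConvexOn ℝ Set.univ (fun t : ℝ => |t| ^ q) := by
    refine ⟨convex_univ, fun a _ b _ s t hs ht hst => ?_⟩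
    have h1 := (convexOn_rpow hq.le).2 (abs_nonneg a) (abs_nonneg b) hs ht hst
    refine le_trans ?_ h1
    refine Real.rpow_le_rpow (abs_nonneg _) ?_ hq0.le
    simp only [smul_eq_mul]
    refine (abs_add_le _ _).trans ?_
    rw [abs_mul, abs_mul, abs_of_nonneg hs, abs_of_nonneg ht]
  have h2 := h.smul (inv_nonneg.2 hq0.le)
  refine h2.congr fun t _ => ?_
  simp [div_eq_inv_mul]

/-- A convex function lies above its tangents. Integrated, this makes the duality map a subgradient
of `‖·‖ ^ p / p`. -/
theorem rpow_abs_div_add_powDeriv_le {q : ℝ} (hq : 1 < q) (a b : ℝ) :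
    |a| ^ q / q + powDeriv q a * (b - a) ≤ |b| ^ q / q := by
  have hc := convexOn_rpow_abs_div hq
  have hd := hasDerivAt_rpow_abs_div hq a
  rcases lt_trichotomy a b with h | rfl | h
  · have := hc.le_slope_of_hasDerivAt (Set.mem_univ a) (Set.mem_univ b) h hd
    rw [slope_def_field, le_div_iff₀ (by linarith)] at this
    linarith
  · simp
  · have := hc.slope_le_of_hasDerivAt (Set.mem_univ b) (Set.mem_univ a) h hd
    rw [slope_def_field, div_le_iff₀ (by linarith)] at this
    linarith

/-- Replace the smaller of `|a|`, `|b|` by the larger one. This crude form of Young's inequality is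
enough for integrability, for continuity of the duality map and for domination. -/
theorem abs_powDeriv_mul_le {q : ℝ} (hq : 1 < q) (a b : ℝ) :
    |powDeriv q a * b| ≤ |a| ^ q + |b| ^ q := by
  rw [abs_mul, abs_powDeriv hq]
  have ha := abs_nonneg a
  have hb := abs_nonneg b
  have key : ∀ t : ℝ, 0 ≤ t → t ^ (q - 1) * t = t ^ q := by
    intro t ht
    rcases ht.eq_or_lt with rfl | h
    · simp [Real.zero_rpow (by linarith : q ≠ 0)]
    · nth_rw 2 [← Real.rpow_one t]
      rw [← Real.rpow_add h]
      ring_nf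
  have h0a := Real.rpow_nonneg ha q
  have h0b := Real.rpow_nonneg hb q
  rcases le_total |a| |b| with h | h
  · have h1 : |a| ^ (q - 1) * |b| ≤ |b| ^ (q - 1) * |b| := by
      gcongr
    rw [key _ hb] at h1
    linarith
  · have h1 : |a| ^ (q - 1) * |b| ≤ |a| ^ (q - 1) * |a| := by gcongr
    rw [key _ ha] at h1
    linarith

end PowerInequalities

end RelCap

/-! ### Uniform convexity and the duality map in finite products of `L^p`. -/

namespace RelCap

section LpProduct

variable {α ι : Type*} [MeasurableSpace α] {μ : Measure α} [Fintype ι] {p : ℝ≥0∞}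

theorem one_lt_toReal (hp1 : 1 < p) (hp : p < ⊤) : 1 < p.toReal := by
  simpa using (ENNReal.toReal_lt_toReal ENNReal.one_ne_top hp.ne).2 hp1

theorem integrable_rpow_abs (hp1 : 1 < p) (hp : p < ⊤) (f : Lp ℝ p μ) :
    Integrable (fun x => |f x| ^ p.toReal) μ :=
  (Lp.memLp f).integrable_norm_rpow (zero_lt_one.trans hp1).ne' hp.ne

theorem Lp_norm_rpow_eq (hp1 : 1 < p) (hp : p < ⊤) (f : Lp ℝ p μ) :
    ‖f‖ ^ p.toReal = ∫ x, |f x| ^ p.toReal ∂μ := by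
  have hq := one_lt_toReal hp1 hp
  have h0 : 0 ≤ ∫ x, ‖f x‖ ^ p.toReal ∂μ := integral_nonneg fun x => by positivity
  rw [Lp.norm_def, (Lp.memLp f).eLpNorm_eq_integral_rpow_norm (zero_lt_one.trans hp1).ne' hp.ne,
    ENNReal.toReal_ofReal (by positivity), Real.rpow_inv_rpow h0 (by linarith)]
  rfl

theorem integrable_powDeriv_mul (hp1 : 1 < p) (hp : p < ⊤) (f g : Lp ℝ p μ) :
    Integrable (fun x => powDeriv p.toReal (f x) * g x) μ := by
  have hq := one_lt_toReal hp1 hp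
  refine ((integrable_rpow_abs hp1 hp f).add (integrable_rpow_abs hp1 hp g)).mono' ?_
    (Eventually.of_forall fun x => abs_powDeriv_mul_le hq (f x) (g x))
  exact ((continuous_powDeriv hq).comp_aestronglyMeasurable (Lp.aestronglyMeasurable f)).mul
    (Lp.aestronglyMeasurable g)

variable [Fact (1 ≤ p)]

theorem norm_rpow_eq (hp1 : 1 < p) (hp : p < ⊤) (w : PiLp p fun _ : ι => Lp ℝ p μ) :
    ‖w‖ ^ p.toReal = ∑ j, ∫ x, |w j x| ^ p.toReal ∂μ := by
  have hq := one_lt_toReal hp1 hp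
  rw [PiLp.norm_eq_sum (by linarith), one_div,
    Real.rpow_inv_rpow (Finset.sum_nonneg fun _ _ => by positivity) (by linarith)]
  exact Finset.sum_congr rfl fun j _ => Lp_norm_rpow_eq hp1 hp _

/-- The `q`-th power of the norm of `X` is uniformly convex on bounded sets. -/
def UniformlyConvexPow (X : Type*) [NormedAddCommGroup X] [NormedSpace ℝ X] (q : ℝ) : Prop :=
  ∀ ε : ℝ, 0 < ε → ∃ C : ℝ, 0 ≤ C ∧ ∀ v w : X, ‖v - w‖ ^ q ≤
    ε * (‖v‖ ^ q + ‖w‖ ^ q) + C * ((‖v‖ ^ q + ‖w‖ ^ q) / 2 - ‖(1 / 2 : ℝ) • (v + w)‖ ^ q)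

/-- The scalar inequality has a constant independent of the two numbers, so it can be integrated and
summed over the components; Clarkson's inequalities are not needed. -/
theorem uniformlyConvexPow_piLp (hp1 : 1 < p) (hp : p < ⊤) :
    UniformlyConvexPow (PiLp p fun _ : ι => Lp ℝ p μ) p.toReal := by
  intro ε hε
  obtain ⟨C, hC, h⟩ := exists_rpow_abs_sub_le (one_lt_toReal hp1 hp) hε
  refine ⟨C, hC, fun v w => ?_⟩
  simp only [norm_rpow_eq hp1 hp]
  rw [← Finset.sum_add_distrib, Finset.mul_sum, Finset.sum_div, ← Finset.sum_sub_distrib,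
    Finset.mul_sum, ← Finset.sum_add_distrib]
  refine Finset.sum_le_sum fun j _ => ?_
  have hv := integrable_rpow_abs hp1 hp (v j)
  have hw := integrable_rpow_abs hp1 hp (w j)
  have hvw : Integrable (fun x => |v j x| ^ p.toReal + |w j x| ^ p.toReal) μ := hv.add hw
  have hm := integrable_rpow_abs hp1 hp (((1 / 2 : ℝ) • (v + w)) j)
  have hgap : Integrable (fun x => (|v j x| ^ p.toReal + |w j x| ^ p.toReal) / 2
      - |((1 / 2 : ℝ) • (v + w)) j x| ^ p.toReal) μ := (hvw.div_const 2).sub hm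
  rw [← integral_add hv hw, ← integral_const_mul, ← integral_div,
    ← integral_sub (hvw.div_const 2) hm, ← integral_const_mul,
    ← integral_add (hvw.const_mul ε) (hgap.const_mul C)]
  refine integral_mono_ae (integrable_rpow_abs hp1 hp _)
    ((hvw.const_mul ε).add (hgap.const_mul C)) ?_
  filter_upwards [Lp.coeFn_sub (v j) (w j), Lp.coeFn_add (v j) (w j),
    Lp.coeFn_smul (1 / 2 : ℝ) (v j + w j)] with x h1 h2 h3
  have h3' : (((1 / 2 : ℝ) • (v + w)) j) x = (v j x + w j x) / 2 := by
    change ((1 / 2 : ℝ) • (v j + w j) : Lp ℝ p μ) x = _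
    rw [h3, Pi.smul_apply, h2, Pi.add_apply, smul_eq_mul]
    ring
  have h1' : (v - w) j x = v j x - w j x := h1
  simpa only [h1', h3', Pi.add_apply, Pi.sub_apply] using h (v j x) (w j x)

/-- In a uniformly convex Banach space, a decreasing sequence of convex sets that all meet a fixed
ball admits a convergent selection whose limit has the least possible norm. -/
theorem exists_tendsto_of_antitone_convex {X : Type*} [NormedAddCommGroup X] [NormedSpace ℝ X]
    [CompleteSpace X] {q : ℝ} (hq : 1 < q) (hX : UniformlyConvexPow X q) {K : ℕ → Set X}
    (hK : Antitone K) (hconv : ∀ n, Convex ℝ (K n)) {M : ℝ} (hM : ∀ n, ∃ w ∈ K n, ‖w‖ ≤ M) :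
    ∃ (z : X) (s : ℕ → X), (∀ n, s n ∈ K n) ∧ Tendsto s atTop (𝓝 z) ∧
      ∀ R : ℝ, (∀ n, ∃ w ∈ K n, ‖w‖ ≤ R) → ‖z‖ ≤ R := by
  have hq0 : 0 < q := by linarith
  -- The distances `d n` from the origin to `K n` increase to a limit `D`. Points `s n` of `K n`
  -- with norm within `1 / (n + 1)` of `d n` turn out to be a Cauchy sequence.
  let d : ℕ → ℝ := fun n => sInf (norm '' K n)
  have hbdd : ∀ n, BddBelow (norm '' K n) := fun n =>
    ⟨0, by rintro _ ⟨w, _, rfl⟩; exact norm_nonneg w⟩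
  have hne : ∀ n, (norm '' K n).Nonempty := fun n => by
    obtain ⟨w, hw, _⟩ := hM n
    exact ⟨_, w, hw, rfl⟩
  have hd0 : ∀ n, 0 ≤ d n := fun n =>
    le_csInf (hne n) (by rintro _ ⟨w, _, rfl⟩; exact norm_nonneg w)
  have hdle : ∀ n, ∀ w ∈ K n, d n ≤ ‖w‖ := fun n w hw => csInf_le (hbdd n) ⟨w, hw, rfl⟩
  have hmono : Monotone d := fun m n hmn => csInf_le_csInf (hbdd m) (hne n)
    (Set.image_mono (hK hmn))
  have hdR : ∀ R : ℝ, (∀ n, ∃ w ∈ K n, ‖w‖ ≤ R) → ∀ n, d n ≤ R := fun R hR n => by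
    obtain ⟨w, hw, hwR⟩ := hR n
    exact (hdle n w hw).trans hwR
  have hdb : BddAbove (Set.range d) := ⟨M, by rintro _ ⟨n, rfl⟩; exact hdR M hM n⟩
  have hdlim := tendsto_atTop_ciSup hmono hdb
  set D : ℝ := ⨆ n, d n
  choose s hsK hs using fun n : ℕ => (by
    obtain ⟨_, ⟨w, hw, rfl⟩, hlt⟩ := exists_lt_of_csInf_lt (hne n)
      (lt_add_of_pos_right (d n) (Nat.one_div_pos_of_nat (α := ℝ) (n := n)))
    exact ⟨w, hw, hlt⟩ : ∃ w ∈ K n, ‖w‖ < d n + 1 / ((n : ℝ) + 1))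
  have hslim : Tendsto (fun n => ‖s n‖) atTop (𝓝 D) := by
    have h2 : Tendsto (fun n : ℕ => d n + 1 / ((n : ℝ) + 1)) atTop (𝓝 D) := by
      simpa using hdlim.add (tendsto_one_div_add_atTop_nhds_zero_nat (𝕜 := ℝ))
    exact tendsto_of_tendsto_of_tendsto_of_le_of_le hdlim h2 (fun n => hdle n _ (hsK n))
      fun n => (hs n).le
  have hsq : Tendsto (fun n => ‖s n‖ ^ q) atTop (𝓝 (D ^ q)) :=
    hslim.rpow_const (Or.inr hq0.le)
  have hdq : Tendsto (fun n => d n ^ q) atTop (𝓝 (D ^ q)) := hdlim.rpow_const (Or.inr hq0.le)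
  have hcauchy : CauchySeq s := by
    rw [Metric.cauchySeq_iff']
    intro η hη
    have hηq : 0 < η ^ q := Real.rpow_pos_of_pos hη q
    have hDq : 0 ≤ D ^ q := Real.rpow_nonneg (ge_of_tendsto' hdlim hd0) q
    -- `ε` keeps the first term of the convexity estimate below `η ^ q / 2`, since late norms
    -- satisfy `‖s m‖ ^ q ≤ D ^ q + 1`. `γ` does the same for the second: the convexity gap is at
    -- most `2 γ`.
    set ε : ℝ := η ^ q / (4 * (D ^ q + 1)) with hε
    have hεpos : 0 < ε := by positivity
    obtain ⟨C, hC, hvw⟩ := hX ε hεpos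
    set γ : ℝ := min (1 / 2) (η ^ q / (8 * (C + 1)))
    have hγ : 0 < γ := lt_min (by norm_num) (by positivity)
    obtain ⟨n, hn⟩ := eventually_atTop.1 ((hsq.eventually (gt_mem_nhds
      (lt_add_of_pos_right (D ^ q) hγ))).and (hdq.eventually (lt_mem_nhds
      (sub_lt_self (D ^ q) hγ))))
    refine ⟨n, fun m hm => ?_⟩
    have h1 := (hn m hm).1
    have h2 := (hn n le_rfl).1
    have h3 := (hn n le_rfl).2
    -- As `K m ⊆ K n`, both points lie in the convex set `K n`. The midpoint therefore has norm at
    -- least `d n`, which makes the gap small.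
    have hmid : (1 / 2 : ℝ) • (s m + s n) ∈ K n := by
      rw [smul_add]
      exact hconv n (hK hm (hsK m)) (hsK n) (by norm_num) (by norm_num) (by norm_num)
    have h4 : d n ^ q ≤ ‖(1 / 2 : ℝ) • (s m + s n)‖ ^ q :=
      Real.rpow_le_rpow (hd0 n) (hdle n _ hmid) hq0.le
    have h5 := hvw (s m) (s n)
    have hγ1 : γ ≤ 1 / 2 := min_le_left _ _
    have hγ2 : γ ≤ η ^ q / (8 * (C + 1)) := min_le_right _ _
    have h6 : ε * (‖s m‖ ^ q + ‖s n‖ ^ q) ≤ η ^ q / 2 := by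
      have : ε * (‖s m‖ ^ q + ‖s n‖ ^ q) ≤ ε * (2 * (D ^ q + 1)) :=
        mul_le_mul_of_nonneg_left (by linarith) hεpos.le
      refine this.trans_eq ?_
      rw [hε]
      field_simp
      norm_num
    have h7 : C * ((‖s m‖ ^ q + ‖s n‖ ^ q) / 2 - ‖(1 / 2 : ℝ) • (s m + s n)‖ ^ q)
        < η ^ q / 2 := by
      have h8 : C * ((‖s m‖ ^ q + ‖s n‖ ^ q) / 2 - ‖(1 / 2 : ℝ) • (s m + s n)‖ ^ q)
          ≤ C * (2 * γ) := mul_le_mul_of_nonneg_left (by linarith) hC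
      have h9 : C * (2 * γ) ≤ C * (2 * (η ^ q / (8 * (C + 1)))) := by gcongr
      have h10 : C * (2 * (η ^ q / (8 * (C + 1)))) < η ^ q / 2 := by
        rw [show C * (2 * (η ^ q / (8 * (C + 1)))) = (C * η ^ q) / (4 * (C + 1)) by
          field_simp; ring, div_lt_div_iff₀ (by positivity) (by norm_num)]
        nlinarith
      linarith
    rw [dist_eq_norm]
    exact (Real.rpow_lt_rpow_iff (norm_nonneg _) hη.le hq0).1 (by linarith)
  obtain ⟨z, hz⟩ := cauchySeq_tendsto_of_complete hcauchy
  refine ⟨z, s, hsK, hz, fun R hR => ?_⟩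
  rw [tendsto_nhds_unique hz.norm hslim]
  exact ciSup_le (hdR R hR)

theorem abs_sum_integral_powDeriv_le (hp1 : 1 < p) (hp : p < ⊤)
    (u v : PiLp p fun _ : ι => Lp ℝ p μ) :
    |∑ j, ∫ x, powDeriv p.toReal (u j x) * v j x ∂μ| ≤ ‖u‖ ^ p.toReal + ‖v‖ ^ p.toReal := by
  rw [norm_rpow_eq hp1 hp, norm_rpow_eq hp1 hp, ← Finset.sum_add_distrib]
  refine (Finset.abs_sum_le_sum_abs _ _).trans (Finset.sum_le_sum fun j _ => ?_)
  rw [← integral_add (integrable_rpow_abs hp1 hp _) (integrable_rpow_abs hp1 hp _)]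
  rw [← Real.norm_eq_abs]
  refine norm_integral_le_of_norm_le
    ((integrable_rpow_abs hp1 hp (u j)).add (integrable_rpow_abs hp1 hp (v j)))
    (Eventually.of_forall fun x => ?_)
  exact abs_powDeriv_mul_le (one_lt_toReal hp1 hp) (u j x) (v j x)

/-- The duality map: the derivative at `u` of `v ↦ ‖v‖ ^ p / p`. -/
theorem exists_dualityMap (hp1 : 1 < p) (hp : p < ⊤) (u : PiLp p fun _ : ι => Lp ℝ p μ) :
    ∃ J : StrongDual ℝ (PiLp p fun _ : ι => Lp ℝ p μ),
      ∀ v, J v = ∑ j, ∫ x, powDeriv p.toReal (u j x) * v j x ∂μ := by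
  have hq := one_lt_toReal hp1 hp
  let L : (PiLp p fun _ : ι => Lp ℝ p μ) →ₗ[ℝ] ℝ :=
    { toFun := fun v => ∑ j, ∫ x, powDeriv p.toReal (u j x) * v j x ∂μ
      map_add' := by
        intro v w
        rw [← Finset.sum_add_distrib]
        refine Finset.sum_congr rfl fun j _ => ?_
        rw [← integral_add (integrable_powDeriv_mul hp1 hp _ _)
          (integrable_powDeriv_mul hp1 hp _ _)]
        refine integral_congr_ae ?_
        filter_upwards [Lp.coeFn_add (v j) (w j)] with x hx
        rw [PiLp.add_apply, hx, Pi.add_apply, mul_add]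
      map_smul' := by
        intro c v
        rw [RingHom.id_apply, smul_eq_mul, Finset.mul_sum]
        refine Finset.sum_congr rfl fun j _ => ?_
        rw [← integral_const_mul]
        refine integral_congr_ae ?_
        filter_upwards [Lp.coeFn_smul c (v j)] with x hx
        rw [PiLp.smul_apply, hx, Pi.smul_apply, smul_eq_mul]
        ring }
  -- A bound on the unit ball suffices for continuity; the exact operator norm is computed later
  -- from minimality.
  have hb := LinearMap.bound_of_ball_bound one_pos (‖u‖ ^ p.toReal + 1) L (by
    intro z hz
    refine (abs_sum_integral_powDeriv_le hp1 hp u z).trans ?_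
    rw [mem_ball_zero_iff] at hz
    have := Real.rpow_le_one (norm_nonneg z) hz.le (by linarith : 0 ≤ p.toReal)
    linarith)
  exact ⟨L.mkContinuousOfExistsBound hb, fun v => rfl⟩

/-- The duality map at `u`. -/
noncomputable def dualityMap (hp1 : 1 < p) (hp : p < ⊤) (u : PiLp p fun _ : ι => Lp ℝ p μ) :
    StrongDual ℝ (PiLp p fun _ : ι => Lp ℝ p μ) :=
  (exists_dualityMap hp1 hp u).choose

theorem dualityMap_apply (hp1 : 1 < p) (hp : p < ⊤) (u v : PiLp p fun _ : ι => Lp ℝ p μ) :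
    dualityMap hp1 hp u v = ∑ j, ∫ x, powDeriv p.toReal (u j x) * v j x ∂μ :=
  (exists_dualityMap hp1 hp u).choose_spec v

theorem dualityMap_self (hp1 : 1 < p) (hp : p < ⊤) (u : PiLp p fun _ : ι => Lp ℝ p μ) :
    dualityMap hp1 hp u u = ‖u‖ ^ p.toReal := by
  rw [dualityMap_apply, norm_rpow_eq hp1 hp]
  simp only [powDeriv_mul_self (one_lt_toReal hp1 hp)]

/-- The tangent inequality, integrated and summed. It says that `u` is a minimizer for its own
duality map, which is how potentials are produced. -/
theorem norm_rpow_div_add_dualityMap_le (hp1 : 1 < p) (hp : p < ⊤)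
    (u v : PiLp p fun _ : ι => Lp ℝ p μ) :
    1 / p.toReal * ‖u‖ ^ p.toReal + dualityMap hp1 hp u (v - u)
      ≤ 1 / p.toReal * ‖v‖ ^ p.toReal := by
  rw [norm_rpow_eq hp1 hp, norm_rpow_eq hp1 hp, dualityMap_apply, Finset.mul_sum, Finset.mul_sum,
    ← Finset.sum_add_distrib]
  refine Finset.sum_le_sum fun j _ => ?_
  have hu := integrable_rpow_abs hp1 hp (u j)
  have hv := integrable_rpow_abs hp1 hp (v j)
  have hd := integrable_powDeriv_mul hp1 hp (u j) ((v - u) j)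
  rw [← integral_const_mul, ← integral_const_mul, ← integral_add (hu.const_mul _) hd]
  refine integral_mono_ae ((hu.const_mul _).add hd) (hv.const_mul _) ?_
  filter_upwards [Lp.coeFn_sub (v j) (u j)] with x hx
  have hx' : (v - u) j x = v j x - u j x := hx
  have := rpow_abs_div_add_powDeriv_le (one_lt_toReal hp1 hp) (u j x) (v j x)
  simp only [hx', one_div_mul_eq_div]
  exact this

/-- Differentiation under the integral sign: for `|t| < 1` the derivative is dominated by `(|u| +
|v|) ^ p + |v| ^ p`. -/
theorem hasDerivAt_norm_rpow_div (hp1 : 1 < p) (hp : p < ⊤)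
    (u v : PiLp p fun _ : ι => Lp ℝ p μ) :
    HasDerivAt (fun t : ℝ => 1 / p.toReal * ‖u + t • v‖ ^ p.toReal) (dualityMap hp1 hp u v) 0 := by
  have hq := one_lt_toReal hp1 hp
  have hfun : (fun t : ℝ => 1 / p.toReal * ‖u + t • v‖ ^ p.toReal)
      = fun t => ∑ j, ∫ x, |u j x + t * v j x| ^ p.toReal / p.toReal ∂μ := by
    funext t
    rw [norm_rpow_eq hp1 hp, Finset.mul_sum]
    refine Finset.sum_congr rfl fun j _ => ?_
    rw [← integral_const_mul]
    refine integral_congr_ae ?_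
    filter_upwards [Lp.coeFn_add (u j) (t • v j), Lp.coeFn_smul t (v j)] with x h1 h2
    have h3 : (u + t • v) j x = u j x + t * v j x := by
      change (u j + t • v j : Lp ℝ p μ) x = _
      rw [h1, Pi.add_apply, h2, Pi.smul_apply, smul_eq_mul]
    rw [h3, one_div_mul_eq_div]
  rw [hfun, dualityMap_apply]
  refine HasDerivAt.fun_sum fun j _ => ?_
  have hmeas : ∀ t : ℝ, AEStronglyMeasurable (fun x => u j x + t * v j x) μ := fun t =>
    (Lp.aestronglyMeasurable (u j)).add ((Lp.aestronglyMeasurable (v j)).const_mul t)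
  have hbound : Integrable (fun x => (|u j x| + |v j x|) ^ p.toReal + |v j x| ^ p.toReal) μ := by
    refine Integrable.add ?_ (integrable_rpow_abs hp1 hp _)
    have := (((Lp.memLp (u j)).norm).add ((Lp.memLp (v j)).norm)).integrable_norm_rpow
      (zero_lt_one.trans hp1).ne' hp.ne
    refine this.congr (Eventually.of_forall fun x => ?_)
    simp only [Pi.add_apply, Real.norm_eq_abs]
    rw [abs_of_nonneg (by positivity)]
  have h := hasDerivAt_integral_of_dominated_loc_of_deriv_le (μ := μ)
    (F := fun t x => |u j x + t * v j x| ^ p.toReal / p.toReal)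
    (F' := fun t x => powDeriv p.toReal (u j x + t * v j x) * v j x)
    (bound := fun x => (|u j x| + |v j x|) ^ p.toReal + |v j x| ^ p.toReal)
    (Metric.ball_mem_nhds (0 : ℝ) one_pos) (Eventually.of_forall fun t => ?_) ?_ ?_ ?_ hbound ?_
  · simpa using h.2
  · have hc : Continuous fun s : ℝ => |s| ^ p.toReal / p.toReal :=
      (continuous_abs.rpow_const fun _ => Or.inr (by linarith)).div_const _
    exact hc.comp_aestronglyMeasurable (hmeas t)
  · simpa using (integrable_rpow_abs hp1 hp (u j)).div_const p.toReal
  · exact ((continuous_powDeriv hq).comp_aestronglyMeasurable (hmeas 0)).mul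
      (Lp.aestronglyMeasurable _)
  · refine Eventually.of_forall fun x t ht => (abs_powDeriv_mul_le hq _ _).trans ?_
    rw [mem_ball_zero_iff, Real.norm_eq_abs] at ht
    have h1 : |u j x + t * v j x| ≤ |u j x| + |v j x| := by
      refine (abs_add_le _ _).trans ?_
      rw [abs_mul]
      have := mul_le_of_le_one_left (abs_nonneg (v j x)) ht.le
      linarith
    have := Real.rpow_le_rpow (abs_nonneg _) h1 (by linarith : 0 ≤ p.toReal)
    linarith
  · refine Eventually.of_forall fun x t _ => ?_
    have h1 := hasDerivAt_rpow_abs_div hq (u j x + t * v j x)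
    have h2 : HasDerivAt (fun t : ℝ => u j x + t * v j x) (v j x) t := by
      simpa using ((hasDerivAt_id t).mul_const (v j x)).const_add (u j x)
    exact h1.comp t h2

/-- The duality map at `u` is the only functional for which `u` minimizes
`v ↦ ‖v‖ ^ p / p - Ψ v`. -/
theorem eq_dualityMap_of_forall_le (hp1 : 1 < p) (hp : p < ⊤)
    {u v : PiLp p fun _ : ι => Lp ℝ p μ} {a b : ℝ}
    (h : ∀ t : ℝ, 1 / p.toReal * ‖u‖ ^ p.toReal - a
      ≤ 1 / p.toReal * ‖u + t • v‖ ^ p.toReal - (a + t * b)) :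
    b = dualityMap hp1 hp u v := by
  have h1 : HasDerivAt (fun t : ℝ => 1 / p.toReal * ‖u + t • v‖ ^ p.toReal - (a + t * b))
      (dualityMap hp1 hp u v - b) 0 := by
    refine (hasDerivAt_norm_rpow_div hp1 hp u v).sub ?_
    simpa using ((hasDerivAt_id (0 : ℝ)).mul_const b).const_add a
  have h2 : IsLocalMin (fun t : ℝ => 1 / p.toReal * ‖u + t • v‖ ^ p.toReal - (a + t * b)) 0 := by
    refine Eventually.of_forall fun t => ?_
    simpa using h t
  linarith [h2.hasDerivAt_eq_zero h1]

/-- The right derivative at `0` is a limit of nonnegative difference quotients. The one-sided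
hypothesis matters: an extremal may only be perturbed by nonnegative functions. -/
theorem dualityMap_nonneg_of_forall_le (hp1 : 1 < p) (hp : p < ⊤)
    {u v : PiLp p fun _ : ι => Lp ℝ p μ} (h : ∀ t : ℝ, 0 ≤ t → ‖u‖ ≤ ‖u + t • v‖) :
    0 ≤ dualityMap hp1 hp u v := by
  have hq := one_lt_toReal hp1 hp
  have h1 := (hasDerivAt_norm_rpow_div hp1 hp u v).hasDerivWithinAt (s := Set.Ioi 0)
  refine ge_of_tendsto ((hasDerivWithinAt_iff_tendsto_slope' (by simp)).1 h1) ?_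
  filter_upwards [self_mem_nhdsWithin] with t ht
  have ht' : (0 : ℝ) < t := ht
  rw [slope_def_field]
  refine div_nonneg ?_ (by simpa using ht'.le)
  have := Real.rpow_le_rpow (norm_nonneg u) (h t ht'.le) (by linarith : 0 ≤ p.toReal)
  have h3 : 0 ≤ 1 / p.toReal := by positivity
  simp only [zero_smul, add_zero]
  nlinarith [mul_le_mul_of_nonneg_left this h3]

end LpProduct

end RelCap

/-! ### A chain rule for weak derivatives, by mollification. -/

namespace RelCap

section ChainRule

open ContinuousLinearMap (lsmul)
open scoped Convolution

variable {N : ℕ}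

theorem abs_normed_convolution_le (φ : ContDiffBump (0 : EuclideanSpace ℝ (Fin N)))
    {f : EuclideanSpace ℝ (Fin N) → ℝ} {B : ℝ} (hf : ∀ x, |f x| ≤ B)
    (x : EuclideanSpace ℝ (Fin N)) :
    |(φ.normed volume ⋆[lsmul ℝ ℝ, volume] f) x| ≤ B := by
  have h := norm_integral_le_of_norm_le (μ := volume)
    (f := fun t => lsmul ℝ ℝ (φ.normed volume t) (f (x - t)))
    (φ.integrable_normed.mul_const B) (Eventually.of_forall fun t => by
      simp only [ContinuousLinearMap.lsmul_apply, smul_eq_mul, norm_mul, Real.norm_eq_abs,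
        abs_of_nonneg (φ.nonneg_normed t)]
      exact mul_le_mul_of_nonneg_left (hf _) (φ.nonneg_normed t))
  rwa [integral_mul_const, φ.integral_normed, one_mul] at h

/-- Convolution with a bump function is symmetric. -/
theorem integral_mul_normed_convolution (φ : ContDiffBump (0 : EuclideanSpace ℝ (Fin N)))
    {f k : EuclideanSpace ℝ (Fin N) → ℝ} (hf : Integrable f) (hk : Integrable k) :
    ∫ x, f x * (φ.normed volume ⋆[lsmul ℝ ℝ, volume] k) x
      = ∫ x, (φ.normed volume ⋆[lsmul ℝ ℝ, volume] f) x * k x := by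
  have hρ : Continuous (φ.normed (volume : Measure (EuclideanSpace ℝ (Fin N)))) :=
    φ.continuous_normed
  obtain ⟨C, hC⟩ := hρ.bounded_above_of_compact_support φ.hasCompactSupport_normed
  simp only [convolution_eq_swap, ContinuousLinearMap.lsmul_apply, smul_eq_mul,
    ← integral_const_mul, ← integral_mul_const]
  rw [integral_integral_swap]
  -- After Fubini the two sides differ only by the sign in the kernel, and the bump is even.
  · refine integral_congr_ae (Eventually.of_forall fun t => integral_congr_ae
      (Eventually.of_forall fun x => ?_))
    simp only
    rw [← φ.normed_neg (x - t), neg_sub]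
    ring
  · have h := (hf.mul_prod hk).bdd_mul (c := C)
      (f := fun z : EuclideanSpace ℝ (Fin N) × EuclideanSpace ℝ (Fin N) =>
        φ.normed volume (z.1 - z.2))
      (hρ.comp (continuous_fst.sub continuous_snd)).aestronglyMeasurable
      (Eventually.of_forall fun z => hC _)
    refine h.congr (Eventually.of_forall fun z => ?_)
    simp only [Function.uncurry]
    ring

theorem tsupport_normed_convolution_subset (φ : ContDiffBump (0 : EuclideanSpace ℝ (Fin N)))
    {f : EuclideanSpace ℝ (Fin N) → ℝ} {δ : ℝ} (hδ : φ.rOut ≤ δ) :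
    tsupport (φ.normed volume ⋆[lsmul ℝ ℝ, volume] f) ⊆ Metric.cthickening δ (tsupport f) := by
  refine closure_minimal ?_ Metric.isClosed_cthickening
  refine (support_convolution_subset (lsmul ℝ ℝ)).trans ?_
  rintro _ ⟨a, ha, b, hb, rfl⟩
  rw [φ.support_normed_eq, mem_ball_zero_iff] at ha
  refine Metric.mem_cthickening_of_dist_le _ b δ _ (subset_tsupport f hb) ?_
  rw [dist_eq_norm, add_sub_cancel_right]
  exact ha.le.trans hδ

theorem fderiv_normed_convolution_apply (φ : ContDiffBump (0 : EuclideanSpace ℝ (Fin N)))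
    {f : EuclideanSpace ℝ (Fin N) → ℝ} (hf : ContDiff ℝ ∞ f) (hc : HasCompactSupport f)
    (x v : EuclideanSpace ℝ (Fin N)) :
    fderiv ℝ (φ.normed volume ⋆[lsmul ℝ ℝ, volume] f) x v
      = (φ.normed volume ⋆[lsmul ℝ ℝ, volume] fun y => fderiv ℝ f y v) x := by
  have hρ : LocallyIntegrable (φ.normed volume) (volume : Measure (EuclideanSpace ℝ (Fin N))) :=
    φ.continuous_normed.locallyIntegrable
  rw [(hc.hasFDerivAt_convolution_right (lsmul ℝ ℝ) hρ (hf.of_le (by simp)) x).fderiv]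
  exact convolution_precompR_apply (lsmul ℝ ℝ) hρ (hc.fderiv ℝ)
    (hf.continuous_fderiv (by simp)) x v

theorem integral_mul_fderiv_eq_neg {f g : EuclideanSpace ℝ (Fin N) → ℝ}
    (hf : ContDiff ℝ ∞ f) (hg : ContDiff ℝ ∞ g) (hc : HasCompactSupport g)
    (v : EuclideanSpace ℝ (Fin N)) :
    ∫ x, f x * fderiv ℝ g x v = - ∫ x, fderiv ℝ f x v * g x := by
  refine integral_mul_fderiv_eq_neg_fderiv_mul_of_integrable ?_ ?_ ?_
    (fun x _ => (hf.differentiable (by simp)).differentiableAt)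
    (fun x _ => (hg.differentiable (by simp)).differentiableAt)
  · exact ((continuous_partial hf v).mul hg.continuous).integrable_of_hasCompactSupport hc.mul_left
  · exact (hf.continuous.mul (continuous_partial hg v)).integrable_of_hasCompactSupport
      (hc.fderiv_apply ℝ v).mul_left
  · exact (hf.continuous.mul hg.continuous).integrable_of_hasCompactSupport hc.mul_left

/-- The regularized chain rule, obtained by testing with the mollification of `H'(ρ ⋆ u) φ`. -/
theorem integral_comp_convolution_mul_fderiv {Ω : Set (EuclideanSpace ℝ (Fin N))} {i : Fin N}
    {u g φ : EuclideanSpace ℝ (Fin N) → ℝ} (hu : Integrable u) (hw : IsWeakPartial Ω i u g)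
    {H : ℝ → ℝ} (hH : ContDiff ℝ ∞ H) (hφ : ContDiff ℝ ∞ φ) (hc : HasCompactSupport φ) {δ : ℝ}
    (hδ : Metric.cthickening δ (tsupport φ) ⊆ Ω) (ρ : ContDiffBump (0 : EuclideanSpace ℝ (Fin N)))
    (hρ : ρ.rOut ≤ δ) :
    ∫ x, H ((ρ.normed volume ⋆[lsmul ℝ ℝ, volume] u) x)
        * fderiv ℝ φ x (EuclideanSpace.single i 1)
      = - ∫ x in Ω, g x * (ρ.normed volume ⋆[lsmul ℝ ℝ, volume] fun y =>
        deriv H ((ρ.normed volume ⋆[lsmul ℝ ℝ, volume] u) y) * φ y) x := by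
  set v : EuclideanSpace ℝ (Fin N) := EuclideanSpace.single i 1
  set uρ := (ρ.normed volume ⋆[lsmul ℝ ℝ, volume] u) with huρ
  have hρc : HasCompactSupport (ρ.normed (volume : Measure (EuclideanSpace ℝ (Fin N)))) :=
    ρ.hasCompactSupport_normed
  have huρs : ContDiff ℝ ∞ uρ :=
    hρc.contDiff_convolution_left (lsmul ℝ ℝ) ρ.contDiff_normed hu.locallyIntegrable
  have hH' : ContDiff ℝ ∞ (deriv H) := by
    have := hH.iterate_deriv 1
    simpa using this
  set h : EuclideanSpace ℝ (Fin N) → ℝ := fun y => deriv H (uρ y) * φ y with hh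
  have hhs : ContDiff ℝ ∞ h := (hH'.comp huρs).mul hφ
  have hhc : HasCompactSupport h := hc.mul_left
  have hts : tsupport h ⊆ tsupport φ := tsupport_mul_subset_right
  set ψ := (ρ.normed volume ⋆[lsmul ℝ ℝ, volume] h) with hψ
  have hψs : ContDiff ℝ ∞ ψ :=
    hρc.contDiff_convolution_left (lsmul ℝ ℝ) ρ.contDiff_normed
      hhs.continuous.locallyIntegrable
  have hψc : HasCompactSupport ψ := hρc.convolution (lsmul ℝ ℝ) hhc
  have hψΩ : tsupport ψ ⊆ Ω := ((tsupport_normed_convolution_subset ρ hρ).trans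
    (Metric.cthickening_subset_of_subset δ hts)).trans hδ
  -- The test function `ψ` is the mollification of `h = H'(uρ) φ`, supported in `Ω` because `rOut ≤
  -- δ`. Symmetry of the convolution moves the mollifier from `ψ` to `u`. What remains is
  -- integration by parts for smooth functions on the whole space, so the behaviour of `u` across
  -- the boundary of `Ω` plays no role.
  have e1 := hw ψ hψs hψc hψΩ
  rw [← e1, setIntegral_eq_integral_of_forall_compl_eq_zero (fun x hx => by
    rw [image_eq_zero_of_notMem_tsupport (f := fun y => fderiv ℝ ψ y v)
      (fun hx' => hx (hψΩ (tsupport_fderiv_apply_subset ℝ v hx'))), mul_zero])]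
  have e2 : ∫ x, u x * fderiv ℝ ψ x v = ∫ x, uρ x * fderiv ℝ h x v := by
    rw [huρ, ← integral_mul_normed_convolution ρ hu
      ((continuous_partial hhs v).integrable_of_hasCompactSupport (hhc.fderiv_apply ℝ v))]
    refine integral_congr_ae (Eventually.of_forall fun x => ?_)
    simp only
    rw [hψ, fderiv_normed_convolution_apply ρ hhs hhc]
  rw [e2, integral_mul_fderiv_eq_neg huρs hhs hhc]
  refine (integral_mul_fderiv_eq_neg (hH.comp huρs) hφ hc v).trans ?_
  congr 1
  refine integral_congr_ae (Eventually.of_forall fun x => ?_)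
  have hd : fderiv ℝ (H ∘ uρ) x v = deriv H (uρ x) * fderiv ℝ uρ x v := by
    have h1 := ((hH.differentiable (by simp)) (uρ x)).hasDerivAt
    have h2 := ((huρs.differentiable (by simp)) x).hasFDerivAt
    rw [(h1.comp_hasFDerivAt x h2).fderiv]
    rfl
  simp only [hh]
  rw [hd]
  ring

theorem exists_contDiffBump_seq {δ : ℝ} (hδ : 0 < δ) :
    ∃ ρ : ℕ → ContDiffBump (0 : EuclideanSpace ℝ (Fin N)), (∀ n, (ρ n).rOut ≤ δ) ∧
      Tendsto (fun n => (ρ n).rOut) atTop (𝓝 0) := by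
  refine ⟨fun n =>
    { rIn := δ / (n + 1) / 2
      rOut := δ / (n + 1)
      rIn_pos := by positivity
      rIn_lt_rOut := half_lt_self (by positivity) }, fun n =>
    div_le_self hδ.le (by linarith [Nat.cast_nonneg (α := ℝ) n]), ?_⟩
  have := (tendsto_one_div_add_atTop_nhds_zero_nat (𝕜 := ℝ)).const_mul δ
  simpa [div_eq_mul_inv] using this

theorem continuous_normed_convolution (φ : ContDiffBump (0 : EuclideanSpace ℝ (Fin N)))
    {f : EuclideanSpace ℝ (Fin N) → ℝ} (hf : LocallyIntegrable f) :
    Continuous (φ.normed volume ⋆[lsmul ℝ ℝ, volume] f) :=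
  (φ.hasCompactSupport_normed.contDiff_convolution_left (n := 0) (lsmul ℝ ℝ)
      φ.contDiff_normed hf).continuous

/-- Mollifications of `u` converge locally uniformly at points of continuity. -/
theorem tendsto_uncurry_normed_convolution {ρ : ℕ → ContDiffBump (0 : EuclideanSpace ℝ (Fin N))}
    (hρ : Tendsto (fun n => (ρ n).rOut) atTop (𝓝 0)) {u : EuclideanSpace ℝ (Fin N) → ℝ}
    (hu : Integrable u) {x : EuclideanSpace ℝ (Fin N)} (hx : ContinuousAt u x) :
    Tendsto (fun z : ℕ × EuclideanSpace ℝ (Fin N) =>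
      ((ρ z.1).normed volume ⋆[lsmul ℝ ℝ, volume] u) z.2) (atTop ×ˢ 𝓝 x) (𝓝 (u x)) :=
  ContDiffBump.convolution_tendsto_right (ι := ℕ × EuclideanSpace ℝ (Fin N))
    (φ := fun z => ρ z.1) (g := fun _ => u) (k := fun z => z.2) (hρ.comp tendsto_fst)
    (Eventually.of_forall fun _ => hu.aestronglyMeasurable) (hx.tendsto.comp tendsto_snd)
    tendsto_snd

theorem tendsto_integral_comp_convolution_mul {Ω : Set (EuclideanSpace ℝ (Fin N))}
    (hΩ : IsOpen Ω) {ρ : ℕ → ContDiffBump (0 : EuclideanSpace ℝ (Fin N))}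
    (hρ : Tendsto (fun n => (ρ n).rOut) atTop (𝓝 0)) {u k : EuclideanSpace ℝ (Fin N) → ℝ}
    (hu : Integrable u) (huc : ContinuousOn u Ω) {B : ℝ} (hB : ∀ x, |u x| ≤ B) {H : ℝ → ℝ}
    (hH : Continuous H) (hH0 : ∀ t, |H t| ≤ |t|) (hk : Continuous k) (hkc : HasCompactSupport k)
    (hkΩ : ∀ x ∉ Ω, k x = 0) :
    Tendsto (fun n => ∫ x, H (((ρ n).normed volume ⋆[lsmul ℝ ℝ, volume] u) x) * k x) atTop
      (𝓝 (∫ x, H (u x) * k x)) := by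
  refine tendsto_integral_of_dominated_convergence (fun x => B * ‖k x‖) (fun n =>
    ((hH.comp (continuous_normed_convolution (ρ n) hu.locallyIntegrable)).mul
      hk).aestronglyMeasurable)
    (((hk.integrable_of_hasCompactSupport hkc).norm).const_mul B)
    (fun n => Eventually.of_forall fun x => ?_) (Eventually.of_forall fun x => ?_)
  · rw [norm_mul]
    exact mul_le_mul_of_nonneg_right ((hH0 _).trans (abs_normed_convolution_le (ρ n) hB x))
      (norm_nonneg _)
  · by_cases hx : x ∈ Ω
    · have h1 := (tendsto_uncurry_normed_convolution hρ hu
        (huc.continuousAt (hΩ.mem_nhds hx))).comp (tendsto_id.prodMk tendsto_const_nhds)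
      exact ((hH.tendsto (u x)).comp h1).mul_const _
    · simp [hkΩ x hx]

/-- The mollifier occurs twice and both copies shrink together, so the inner one must converge
jointly in the index and the point; `tendsto_uncurry_normed_convolution` provides this at points of
continuity. All convolutions live in one compact thickening of the support of `φ`, where `g` is
integrable. -/
theorem tendsto_integral_mul_convolution_comp {Ω : Set (EuclideanSpace ℝ (Fin N))}
    (hΩ : IsOpen Ω) {ρ : ℕ → ContDiffBump (0 : EuclideanSpace ℝ (Fin N))}
    (hρ : Tendsto (fun n => (ρ n).rOut) atTop (𝓝 0)) {δ : ℝ} (hρδ : ∀ n, (ρ n).rOut ≤ δ)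
    {u g φ : EuclideanSpace ℝ (Fin N) → ℝ} (hu : Integrable u) (huc : ContinuousOn u Ω)
    (hg : LocallyIntegrable g (volume.restrict Ω)) {F : ℝ → ℝ} (hF : Continuous F)
    (hF1 : ∀ t, |F t| ≤ 1) (hφ : Continuous φ) (hc : HasCompactSupport φ) :
    Tendsto (fun n => ∫ x in Ω, g x * ((ρ n).normed volume ⋆[lsmul ℝ ℝ, volume] fun y =>
        F (((ρ n).normed volume ⋆[lsmul ℝ ℝ, volume] u) y) * φ y) x) atTop
      (𝓝 (∫ x in Ω, F (u x) * g x * φ x)) := by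
  obtain ⟨C, hC⟩ := hφ.bounded_above_of_compact_support hc
  have hhB : ∀ n y, |F (((ρ n).normed volume ⋆[lsmul ℝ ℝ, volume] u) y) * φ y| ≤ C := by
    intro n y
    rw [abs_mul]
    exact (mul_le_of_le_one_left (abs_nonneg _) (hF1 _)).trans (hC y)
  have hhcont : ∀ n, Continuous
      (fun y => F (((ρ n).normed volume ⋆[lsmul ℝ ℝ, volume] u) y) * φ y) := fun n =>
    (hF.comp (continuous_normed_convolution (ρ n) hu.locallyIntegrable)).mul hφ
  have hKc : IsCompact (Metric.cthickening δ (tsupport φ)) := hc.isCompact.cthickening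
  have hgK : Integrable ((Metric.cthickening δ (tsupport φ)).indicator g) (volume.restrict Ω) :=
    (hg.integrableOn_isCompact hKc).integrable_indicator hKc.measurableSet
  refine tendsto_integral_of_dominated_convergence
    (fun x => ‖(Metric.cthickening δ (tsupport φ)).indicator g x‖ * C) (fun n =>
    hg.aestronglyMeasurable.mul (continuous_normed_convolution (ρ n)
      (hhcont n).locallyIntegrable).aestronglyMeasurable)
    (hgK.norm.mul_const C) (fun n => Eventually.of_forall fun x => ?_) ?_
  · by_cases hx : x ∈ Metric.cthickening δ (tsupport φ)
    · rw [norm_mul, Set.indicator_of_mem hx]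
      exact mul_le_mul_of_nonneg_left (abs_normed_convolution_le (ρ n) (hhB n) x) (norm_nonneg _)
    · rw [image_eq_zero_of_notMem_tsupport fun hx' => hx
        (Metric.cthickening_subset_of_subset δ tsupport_mul_subset_right
          (tsupport_normed_convolution_subset (ρ n) (hρδ n) hx')), Set.indicator_of_notMem hx]
      simp
  · filter_upwards [ae_restrict_mem hΩ.measurableSet] with x hx
    rw [show F (u x) * g x * φ x = g x * (F (u x) * φ x) by ring]
    refine Tendsto.const_mul (g x) (ContDiffBump.convolution_tendsto_right hρ
      (Eventually.of_forall fun n => (hhcont n).aestronglyMeasurable) ?_ tendsto_const_nhds)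
    exact ((hF.tendsto (u x)).comp (tendsto_uncurry_normed_convolution hρ hu
      (huc.continuousAt (hΩ.mem_nhds hx)))).mul ((hφ.tendsto x).comp tendsto_snd)

/-- The chain rule for a bounded Sobolev function that is continuous on `Ω`. -/
theorem IsWeakPartial.comp {Ω : Set (EuclideanSpace ℝ (Fin N))} (hΩ : IsOpen Ω) {i : Fin N}
    {u g : EuclideanSpace ℝ (Fin N) → ℝ} (hu : Integrable u) (huc : ContinuousOn u Ω)
    {B : ℝ} (hB : ∀ x, |u x| ≤ B) (hg : LocallyIntegrable g (volume.restrict Ω))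
    (hw : IsWeakPartial Ω i u g) {H : ℝ → ℝ} (hH : ContDiff ℝ ∞ H) (hH0 : ∀ t, |H t| ≤ |t|)
    (hH1 : ∀ t, |deriv H t| ≤ 1) :
    IsWeakPartial Ω i (fun x => H (u x)) (fun x => deriv H (u x) * g x) := by
  intro φ hφ hc hφΩ
  obtain ⟨δ, hδ, hδΩ⟩ := hc.isCompact.exists_cthickening_subset_open hΩ hφΩ
  obtain ⟨ρ, hρδ, hρ0⟩ := exists_contDiffBump_seq (N := N) hδ
  have hzero : ∀ x ∉ Ω, fderiv ℝ φ x (EuclideanSpace.single i 1) = 0 := fun x hx =>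
    image_eq_zero_of_notMem_tsupport (f := fun y => fderiv ℝ φ y (EuclideanSpace.single i 1))
      (fun hx' => hx (hφΩ (tsupport_fderiv_apply_subset ℝ _ hx')))
  have hlim1 := tendsto_integral_comp_convolution_mul hΩ hρ0 hu huc hB hH.continuous hH0
    (continuous_partial hφ _) (hc.fderiv_apply ℝ _) hzero
  have hlim2 := (tendsto_integral_mul_convolution_comp hΩ hρ0 hρδ hu huc hg
    (hH.continuous_deriv (by simp)) hH1 hφ.continuous hc).neg
  have hlim3 := tendsto_nhds_unique hlim1 (hlim2.congr fun n =>
    (integral_comp_convolution_mul_fderiv hu hw hH hφ hc hδΩ (ρ n) (hρδ n)).symm)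
  rw [← hlim3]
  exact setIntegral_eq_integral_of_forall_compl_eq_zero fun x hx => by rw [hzero x hx, mul_zero]

end ChainRule

end RelCap

/-! ### `W̃^{1,p}(Ω)`: completeness, uniform convexity, contractions and the absolute value. -/

namespace RelCap

/-- In a uniformly convex Banach space, a bounded sequence whose images under a continuous linear
map converge yields a preimage of the limit, with control of the norm. -/
theorem UniformlyConvexPow.exists_of_tendsto_map {X Y : Type*} [NormedAddCommGroup X]
    [NormedSpace ℝ X] [CompleteSpace X] [NormedAddCommGroup Y] [NormedSpace ℝ Y] {q : ℝ}
    (hX : UniformlyConvexPow X q) (hq : 1 < q) (T : X →L[ℝ] Y) {w : ℕ → X} {h : Y}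
    (hw : Tendsto (fun n => T (w n)) atTop (𝓝 h)) {r : ℕ → ℝ} {R : ℝ}
    (hr : Tendsto r atTop (𝓝 R)) (hwr : ∀ n, ‖w n‖ ≤ r n) : ∃ z : X, T z = h ∧ ‖z‖ ≤ R := by
  -- The preimages of shrinking balls are decreasing and convex, and each meets every ball of radius
  -- larger than `R`. A convergent selection of small norm replaces a weak limit of the bounded
  -- sequence.
  let K : ℕ → Set X := fun n => T ⁻¹' Metric.closedBall h (1 / ((n : ℝ) + 1))
  have hK : Antitone K := fun m n hmn =>
    Set.preimage_mono (Metric.closedBall_subset_closedBall (Nat.one_div_le_one_div hmn))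
  have hconv : ∀ n, Convex ℝ (K n) := fun n =>
    (convex_closedBall h _).linear_preimage T.toLinearMap
  have hmem : ∀ R' > R, ∀ n, ∃ v ∈ K n, ‖v‖ ≤ R' := by
    intro R' hR' n
    obtain ⟨m, h1, h2⟩ := ((hr.eventually (gt_mem_nhds hR')).and
      (hw.eventually (Metric.closedBall_mem_nhds h
        (Nat.one_div_pos_of_nat (α := ℝ) (n := n))))).exists
    exact ⟨w m, h2, (hwr m).trans h1.le⟩
  obtain ⟨z, s, hs, hsz, hz⟩ := exists_tendsto_of_antitone_convex hq hX hK hconv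
    (hmem (R + 1) (by linarith))
  refine ⟨z, ?_, le_of_forall_gt_imp_ge_of_dense fun R' hR' => hz R' (hmem R' hR')⟩
  refine tendsto_nhds_unique ((T.continuous.tendsto z).comp hsz) ?_
  rw [tendsto_iff_dist_tendsto_zero]
  exact squeeze_zero (fun _ => dist_nonneg) (fun n => hs n)
    tendsto_one_div_add_atTop_nhds_zero_nat

section SobolevSpace

variable {N : ℕ} {p : ℝ≥0∞} [Fact (1 ≤ p)] {Ω : Set (EuclideanSpace ℝ (Fin N))}

theorem continuous_integral_Lp_mul {ψ : EuclideanSpace ℝ (Fin N) → ℝ} (hψ : Continuous ψ)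
    (hc : HasCompactSupport ψ) :
    Continuous fun f : Lp ℝ p (volume.restrict Ω) => ∫ x in Ω, f x * ψ x := by
  -- In extended nonnegative reals this formula also covers the endpoints: `p = 1` gives `∞` and `p
  -- = ∞` gives `1`.
  have hconj : p.HolderConjugate (1 - p⁻¹)⁻¹ := by
    refine ENNReal.holderConjugate_iff.2 ?_
    rw [inv_inv]
    exact add_tsub_cancel_of_le (ENNReal.inv_le_one.2 Fact.out)
  have hq : Fact (1 ≤ (1 - p⁻¹)⁻¹) := ⟨by simp⟩
  have hm : MemLp ψ (1 - p⁻¹)⁻¹ (volume.restrict Ω) := hψ.memLp_of_hasCompactSupport hc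
  have h := ((ContinuousLinearMap.mul ℝ ℝ).lpPairing (volume.restrict Ω) p
    (1 - p⁻¹)⁻¹).flip (hm.toLp ψ) |>.continuous
  refine h.congr fun f => ?_
  rw [ContinuousLinearMap.flip_apply, ContinuousLinearMap.lpPairing_eq_integral]
  refine integral_congr_ae ?_
  filter_upwards [hm.coeFn_toLp] with x hx
  rw [hx]
  rfl

/-- For a fixed test function, integration by parts is an equation between two continuous functions
of `w`, so the space is an intersection of closed sets. -/
theorem isClosed_sobolev : IsClosed (Sobolev p Ω : Set (PiLp p fun _ : Option (Fin N) =>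
    Lp ℝ p (volume.restrict Ω))) := by
  have h : (Sobolev p Ω : Set (PiLp p fun _ : Option (Fin N) => Lp ℝ p (volume.restrict Ω)))
      = ⋂ (i : Fin N) (φ : EuclideanSpace ℝ (Fin N) → ℝ) (_ : ContDiff ℝ ∞ φ)
        (_ : HasCompactSupport φ) (_ : tsupport φ ⊆ Ω),
        {w | ∫ x in Ω, w none x * fderiv ℝ φ x (EuclideanSpace.single i 1)
          = - ∫ x in Ω, w (some i) x * φ x} := by
    ext w
    simp only [Set.mem_iInter]
    rfl
  rw [h]
  refine isClosed_iInter fun i => isClosed_iInter fun φ => isClosed_iInter fun h1 =>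
    isClosed_iInter fun h2 => isClosed_iInter fun h3 => isClosed_eq ?_ ?_
  · exact (continuous_integral_Lp_mul (continuous_partial h1 _) (h2.fderiv_apply ℝ _)).comp
      (PiLp.continuous_apply p _ none)
  · exact ((continuous_integral_Lp_mul h1.continuous h2).comp
      (PiLp.continuous_apply p _ (some i))).neg

theorem isClosed_tildeSobolev : IsClosed (TildeSobolev p Ω : Set (Sobolev p Ω)) :=
  (ccSobolev p Ω).isClosed_topologicalClosure

instance : CompleteSpace (Sobolev p Ω) := isClosed_sobolev.completeSpace_coe

instance : CompleteSpace (TildeSobolev p Ω) := isClosed_tildeSobolev.completeSpace_coe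

/-- The space `W̃^{1,p}(Ω)` as a normed space in its own right. -/
def Tilde (p : ℝ≥0∞) [Fact (1 ≤ p)] (Ω : Set (EuclideanSpace ℝ (Fin N))) : Type :=
  TildeSobolev p Ω

noncomputable instance : NormedAddCommGroup (Tilde p Ω) :=
  inferInstanceAs (NormedAddCommGroup (TildeSobolev p Ω))

noncomputable instance : NormedSpace ℝ (Tilde p Ω) :=
  inferInstanceAs (NormedSpace ℝ (TildeSobolev p Ω))

instance : CompleteSpace (Tilde p Ω) :=
  inferInstanceAs (CompleteSpace (TildeSobolev p Ω))

/-- A Sobolev function together with its weak derivatives. -/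
noncomputable def components (p : ℝ≥0∞) [Fact (1 ≤ p)] (Ω : Set (EuclideanSpace ℝ (Fin N))) :
    Tilde p Ω →L[ℝ] PiLp p fun _ : Option (Fin N) => Lp ℝ p (volume.restrict Ω) :=
  (Sobolev p Ω).subtypeL.comp (TildeSobolev p Ω).subtypeL

theorem norm_components (u : Tilde p Ω) : ‖components p Ω u‖ = ‖u‖ := rfl

/-- The underlying function of an element of `W̃^{1,p}(Ω)`. -/
noncomputable def value (p : ℝ≥0∞) [Fact (1 ≤ p)] (Ω : Set (EuclideanSpace ℝ (Fin N))) :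
    Tilde p Ω →L[ℝ] Lp ℝ p (volume.restrict Ω) :=
  (PiLp.proj p (fun _ : Option (Fin N) => Lp ℝ p (volume.restrict Ω)) none).comp
    (components p Ω)

theorem uniformlyConvexPow_tilde (hp1 : 1 < p) (hp : p < ⊤) :
    UniformlyConvexPow (Tilde p Ω) p.toReal := by
  intro ε hε
  obtain ⟨C, hC, h⟩ := uniformlyConvexPow_piLp (ι := Option (Fin N)) (μ := volume.restrict Ω)
    hp1 hp ε hε
  refine ⟨C, hC, fun v w => ?_⟩
  have := h (components p Ω v) (components p Ω w)
  rwa [← map_sub, ← map_add, ← map_smul, norm_components, norm_components, norm_components,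
    norm_components] at this

/-- A function on `closure Ω` coincides almost everywhere on `Ω` with an element of
`W̃^{1,p}(Ω)`. -/
def Represents (f : closure Ω → ℝ) (u : Tilde p Ω) : Prop :=
  ∀ᵐ x ∂(volume.restrict Ω), ∀ hx : x ∈ closure Ω, f ⟨x, hx⟩ = value p Ω u x

theorem Represents.add {f g : closure Ω → ℝ} {u v : Tilde p Ω} (hf : Represents f u)
    (hg : Represents g v) : Represents (f + g) (u + v) :=
  AgreesOn.add (v := u.1) (w := v.1) hf hg

theorem Represents.smul (c : ℝ) {f : closure Ω → ℝ} {u : Tilde p Ω} (hf : Represents f u) :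
    Represents (c • f) (c • u) :=
  AgreesOn.smul c (v := u.1) hf

theorem Represents.sub {f g : closure Ω → ℝ} {u v : Tilde p Ω} (hf : Represents f u)
    (hg : Represents g v) : Represents (f - g) (u - v) := by
  have := hf.add (hg.smul (-1))
  rwa [neg_one_smul, neg_one_smul, ← sub_eq_add_neg, ← sub_eq_add_neg] at this

theorem Represents.unique (hΩ : IsOpen Ω) {f : closure Ω → ℝ} {u v : Tilde p Ω}
    (hu : Represents f u) (hv : Represents f v) : u = v :=
  Subtype.ext (AgreesOn.unique hΩ (v := u.1) (w := v.1) hu hv)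

theorem IsWeakPartial.congr_ae {i : Fin N} {u g u' g' : EuclideanSpace ℝ (Fin N) → ℝ}
    (h : IsWeakPartial Ω i u g) (hu : u =ᵐ[volume.restrict Ω] u')
    (hg : g =ᵐ[volume.restrict Ω] g') : IsWeakPartial Ω i u' g' := by
  intro φ h1 h2 h3
  have e1 : ∫ x in Ω, u x * fderiv ℝ φ x (EuclideanSpace.single i 1)
      = ∫ x in Ω, u' x * fderiv ℝ φ x (EuclideanSpace.single i 1) := by
    refine integral_congr_ae ?_
    filter_upwards [hu] with x hx
    rw [hx]
  have e2 : ∫ x in Ω, g x * φ x = ∫ x in Ω, g' x * φ x := by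
    refine integral_congr_ae ?_
    filter_upwards [hg] with x hx
    rw [hx]
  rw [← e1, ← e2]
  exact h φ h1 h2 h3

/-- A function in `L^p` with weak derivatives in `L^p` defines an element of `W^{1,p}(Ω)`. -/
theorem exists_sobolev {F : Option (Fin N) → EuclideanSpace ℝ (Fin N) → ℝ}
    (hm : ∀ j, MemLp (F j) p (volume.restrict Ω)) (hF : ∀ i, IsWeakPartial Ω i (F none)
      (F (some i))) :
    ∃ w : Sobolev p Ω, ∀ j, w.1 j =ᵐ[volume.restrict Ω] F j :=
  ⟨⟨WithLp.toLp p fun j => (hm j).toLp _, fun i => (hF i).congr_ae (hm none).coeFn_toLp.symm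
    (hm (some i)).coeFn_toLp.symm⟩, fun j => (hm j).coeFn_toLp⟩

/-- Smooth functions with compact support restrict to Sobolev functions. -/
theorem exists_sobolev_of_contDiff {φ : EuclideanSpace ℝ (Fin N) → ℝ} (hφ : ContDiff ℝ ∞ φ)
    (hc : HasCompactSupport φ) :
    ∃ w : Sobolev p Ω, AgreesOn (fun x : closure Ω => φ x) w := by
  have hm : ∀ j : Option (Fin N), MemLp (j.elim φ fun i => fun x =>
      fderiv ℝ φ x (EuclideanSpace.single i 1)) p (volume.restrict Ω) := by
    rintro (_ | i)
    · exact hφ.continuous.memLp_of_hasCompactSupport hc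
    · exact (continuous_partial hφ _).memLp_of_hasCompactSupport (hc.fderiv_apply ℝ _)
  have hF : ∀ i : Fin N, IsWeakPartial Ω i φ
      fun x => fderiv ℝ φ x (EuclideanSpace.single i 1) := by
    intro i η h1 h2 h3
    rw [setIntegral_eq_integral_of_forall_compl_eq_zero fun x hx => by
        rw [image_eq_zero_of_notMem_tsupport
          (f := fun y => fderiv ℝ η y (EuclideanSpace.single i 1))
          (fun hx' => hx (h3 (tsupport_fderiv_apply_subset ℝ _ hx'))), mul_zero],
      setIntegral_eq_integral_of_forall_compl_eq_zero fun x hx => by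
        rw [image_eq_zero_of_notMem_tsupport (fun hx' => hx (h3 hx')), mul_zero]]
    exact integral_mul_fderiv_eq_neg hφ h1 h2 _
  obtain ⟨w, hw⟩ := exists_sobolev hm hF
  refine ⟨w, ?_⟩
  filter_upwards [hw none] with x hx _
  exact hx.symm

/-- A continuous function with compact support that agrees with a Sobolev function represents an
element of `W̃^{1,p}(Ω)`. -/
theorem AgreesOn.exists_tilde {v : CompactlySupportedContinuousMap (closure Ω) ℝ}
    {w : Sobolev p Ω} (h : AgreesOn v w) :
    ∃ u : Tilde p Ω, Represents v u ∧ components p Ω u = w.1 :=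
  ⟨⟨w, (ccSobolev p Ω).le_topologicalClosure ⟨v, h⟩⟩, h, rfl⟩

/-- The restriction to `closure Ω` of a compactly supported continuous function. -/
noncomputable def restrictClosure (Ω : Set (EuclideanSpace ℝ (Fin N)))
    {φ : EuclideanSpace ℝ (Fin N) → ℝ}
    (hφ : Continuous φ) (hc : HasCompactSupport φ) :
    CompactlySupportedContinuousMap (closure Ω) ℝ where
  toFun := fun x => φ x
  continuous_toFun := hφ.comp continuous_subtype_val
  hasCompactSupport' := hc.comp_isClosedEmbedding isClosed_closure.isClosedEmbedding_subtypeVal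

theorem exists_represents_restrictClosure {φ : EuclideanSpace ℝ (Fin N) → ℝ}
    (hφ : ContDiff ℝ ∞ φ) (hc : HasCompactSupport φ) :
    ∃ u : Tilde p Ω, Represents (restrictClosure Ω hφ.continuous hc) u := by
  obtain ⟨w, hw⟩ := exists_sobolev_of_contDiff (p := p) (Ω := Ω) hφ hc
  obtain ⟨u, hu, _⟩ := AgreesOn.exists_tilde (v := restrictClosure Ω hφ.continuous hc) hw
  exact ⟨u, hu⟩

/-- A cutoff function for a compactly supported function on `closure Ω`. -/
theorem exists_cutoff (p : ℝ≥0∞) [Fact (1 ≤ p)]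
    (v : CompactlySupportedContinuousMap (closure Ω) ℝ) :
    ∃ (χ : CompactlySupportedContinuousMap (closure Ω) ℝ) (w : Tilde p Ω),
      Represents χ w ∧ (∀ x, 0 ≤ χ x) ∧ ∀ x, v x ≠ 0 → χ x = 1 := by
  have hK : IsCompact (Subtype.val '' tsupport v) :=
    v.hasCompactSupport.isCompact.image continuous_subtype_val
  obtain ⟨R, hR⟩ := hK.isBounded.subset_closedBall 0
  let ρ : ContDiffBump (0 : EuclideanSpace ℝ (Fin N)) :=
    { rIn := max R 1
      rOut := max R 1 + 1
      rIn_pos := lt_max_of_lt_right one_pos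
      rIn_lt_rOut := lt_add_one _ }
  obtain ⟨w, hw⟩ := exists_represents_restrictClosure (p := p) (Ω := Ω) ρ.contDiff
    ρ.hasCompactSupport
  refine ⟨_, w, hw, fun x => ρ.nonneg, fun x hx => ?_⟩
  refine ρ.one_of_mem_closedBall (Metric.closedBall_subset_closedBall (le_max_left R 1) (hR ?_))
  exact ⟨x, subset_tsupport _ hx, rfl⟩

theorem PiLp_norm_mono {ι : Type*} [Fintype ι] {β : ι → Type*} [∀ i, NormedAddCommGroup (β i)]
    (hp : p < ⊤) {a b : PiLp p β} (h : ∀ j, ‖a j‖ ≤ ‖b j‖) : ‖a‖ ≤ ‖b‖ := by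
  have hp0 : 0 < p.toReal := ENNReal.toReal_pos
    (zero_lt_one.trans_le (Fact.out : (1 : ℝ≥0∞) ≤ p)).ne' hp.ne
  rw [PiLp.norm_eq_sum hp0, PiLp.norm_eq_sum hp0]
  refine Real.rpow_le_rpow (Finset.sum_nonneg fun _ _ => by positivity)
    (Finset.sum_le_sum fun j _ => ?_) (by positivity)
  exact Real.rpow_le_rpow (norm_nonneg _) (h j) hp0.le

open Classical in
/-- The extension by zero to the whole space of the restriction to `Ω`. -/
noncomputable def zeroExt (v : closure Ω → ℝ) (x : EuclideanSpace ℝ (Fin N)) : ℝ :=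
  if hx : x ∈ Ω then v ⟨x, subset_closure hx⟩ else 0

theorem continuousOn_zeroExt {v : closure Ω → ℝ} (hv : Continuous v) :
    ContinuousOn (zeroExt v) Ω := by
  rw [continuousOn_iff_continuous_domRestrict]
  have h : Ω.domRestrict (zeroExt v) = v ∘ Set.inclusion (subset_closure (s := Ω)) := by
    funext z
    exact dif_pos z.2
  rw [h]
  exact hv.comp (continuous_inclusion _)

theorem AgreesOn.zeroExt_ae_eq (hΩ : IsOpen Ω) {v : closure Ω → ℝ} {w : Sobolev p Ω}
    (h : AgreesOn v w) : zeroExt v =ᵐ[volume.restrict Ω] w.1 none := by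
  filter_upwards [h, ae_restrict_mem hΩ.measurableSet] with x h1 hx
  rw [← h1 (subset_closure hx), zeroExt, dif_pos hx]

theorem integrable_zeroExt (hΩ : IsOpen Ω) (v : CompactlySupportedContinuousMap (closure Ω) ℝ) :
    Integrable (zeroExt v) := by
  obtain ⟨C, hC⟩ := v.continuous.bounded_above_of_compact_support v.hasCompactSupport
  have hK : IsCompact (Subtype.val '' tsupport v) :=
    v.hasCompactSupport.isCompact.image continuous_subtype_val
  have hmeas : AEStronglyMeasurable (zeroExt v) (volume : Measure (EuclideanSpace ℝ (Fin N))) := by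
    have h := ((continuousOn_zeroExt (v := v) v.continuous).aestronglyMeasurable
      (μ := volume) hΩ.measurableSet)
    rw [← aestronglyMeasurable_indicator_iff hΩ.measurableSet] at h
    refine h.congr (Eventually.of_forall fun x => ?_)
    by_cases hx : x ∈ Ω
    · rw [Set.indicator_of_mem hx]
    · rw [Set.indicator_of_notMem hx, zeroExt, dif_neg hx]
  refine Integrable.mono' (g := (Subtype.val '' tsupport v).indicator fun _ => C)
    ((integrable_indicator_iff hK.measurableSet).2 (integrableOn_const hK.measure_lt_top.ne))
    hmeas (Eventually.of_forall fun x => ?_)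
  by_cases hxK : x ∈ Subtype.val '' tsupport v
  · rw [Set.indicator_of_mem hxK]
    by_cases hx : x ∈ Ω
    · rw [zeroExt, dif_pos hx]
      exact hC _
    · rw [zeroExt, dif_neg hx, norm_zero]
      -- Any point of `closure Ω` serves here: it shows that the bound `C` is nonnegative.
      obtain ⟨y, _, _⟩ := hxK
      exact (norm_nonneg _).trans (hC y)
  · rw [Set.indicator_of_notMem hxK]
    by_cases hx : x ∈ Ω
    · rw [zeroExt, dif_pos hx, image_eq_zero_of_notMem_tsupport fun h => hxK ⟨_, h, rfl⟩,
        norm_zero]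
    · rw [zeroExt, dif_neg hx, norm_zero]

/-- Smooth contractions act on `W^{1,p}(Ω) ∩ C_c(closure Ω)`. -/
theorem Represents.exists_comp (hp : p < ⊤) (hΩ : IsOpen Ω)
    {v : CompactlySupportedContinuousMap (closure Ω) ℝ} {u : Tilde p Ω} (h : Represents v u)
    {H : ℝ → ℝ} (hH : ContDiff ℝ ∞ H) (hH0 : ∀ t, |H t| ≤ |t|) (hH1 : ∀ t, |deriv H t| ≤ 1) :
    ∃ u' : Tilde p Ω, Represents (fun x => H (v x)) u' ∧ ‖u'‖ ≤ ‖u‖ := by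
  obtain ⟨w, hw⟩ : ∃ w, w = components p Ω u := ⟨_, rfl⟩
  have hpart : ∀ i, IsWeakPartial Ω i (w none) (w (some i)) := by
    rw [hw]
    exact u.1.2
  have hae : zeroExt v =ᵐ[volume.restrict Ω] w none := by
    rw [hw]
    exact AgreesOn.zeroExt_ae_eq hΩ (w := u.1) h
  have hHc : Continuous (deriv H) := hH.continuous_deriv (by simp)
  -- Each component of the composed function is dominated pointwise by the same component of `w`.
  -- This gives both membership in `L^p` and the norm inequality.
  have hle : ∀ (j : Option (Fin N)) (x : EuclideanSpace ℝ (Fin N)),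
      ‖(j.elim (fun x => H (w none x)) fun i => fun x =>
        deriv H (w none x) * w (some i) x : EuclideanSpace ℝ (Fin N) → ℝ) x‖
        ≤ ‖w j x‖ := by
    rintro (_ | i) x
    · exact hH0 _
    · simp only [Option.elim_some, norm_mul]
      exact mul_le_of_le_one_left (norm_nonneg _) (hH1 _)
  have hm : ∀ j : Option (Fin N), MemLp (j.elim (fun x => H (w none x)) fun i => fun x =>
      deriv H (w none x) * w (some i) x) p (volume.restrict Ω) := by
    intro j
    refine (Lp.memLp (w j)).of_le ?_ (Eventually.of_forall (hle j))
    rcases j with _ | i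
    · exact hH.continuous.comp_aestronglyMeasurable (Lp.aestronglyMeasurable _)
    · exact (hHc.comp_aestronglyMeasurable (Lp.aestronglyMeasurable _)).mul
        (Lp.aestronglyMeasurable _)
  obtain ⟨C, hC⟩ := v.continuous.bounded_above_of_compact_support v.hasCompactSupport
  have hB : ∀ x, |zeroExt v x| ≤ max C 0 := by
    intro x
    by_cases hx : x ∈ Ω
    · rw [zeroExt, dif_pos hx]
      exact (hC _).trans (le_max_left _ _)
    · rw [zeroExt, dif_neg hx, abs_zero]
      exact le_max_right _ _
  have hF : ∀ i : Fin N, IsWeakPartial Ω i (fun x => H (w none x))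
      fun x => deriv H (w none x) * w (some i) x := by
    intro i
    have h1 : IsWeakPartial Ω i (zeroExt v) (w (some i)) :=
      (hpart i).congr_ae hae.symm (ae_eq_refl _)
    have h2 := h1.comp hΩ (integrable_zeroExt hΩ v) (continuousOn_zeroExt v.continuous) hB
      ((Lp.memLp (w (some i))).locallyIntegrable Fact.out) hH hH0 hH1
    refine h2.congr_ae ?_ ?_
    · filter_upwards [hae] with x hx
      rw [hx]
    · filter_upwards [hae] with x hx
      rw [hx]
  obtain ⟨w', hw'⟩ := exists_sobolev hm hF
  have hz : H 0 = 0 := by simpa using hH0 0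
  let Hv : CompactlySupportedContinuousMap (closure Ω) ℝ :=
    ⟨⟨fun x => H (v x), hH.continuous.comp v.continuous⟩, v.hasCompactSupport.comp_left hz⟩
  have hHv : AgreesOn Hv w' := by
    filter_upwards [hae, hw' none, ae_restrict_mem hΩ.measurableSet] with x h1 h2 hxΩ hx
    refine Eq.trans ?_ h2.symm
    rw [zeroExt, dif_pos hxΩ] at h1
    exact congrArg H h1
  obtain ⟨u', hu', hcomp⟩ := hHv.exists_tilde
  refine ⟨u', hu', ?_⟩
  rw [← norm_components, ← norm_components, hcomp, ← hw]
  refine PiLp_norm_mono hp fun j => Lp.norm_le_norm_of_ae_le ?_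
  filter_upwards [hw' j] with x hx
  exact (le_of_eq (congrArg norm hx)).trans (hle j x)

/-- A smooth approximation of `|t|`. Subtracting `ε` makes it vanish at `0`, so that composition
preserves compact supports and satisfies `|H t| ≤ |t|`. -/
theorem contDiff_smoothAbs {ε : ℝ} (hε : 0 < ε) :
    ContDiff ℝ ∞ fun t : ℝ => √(t ^ 2 + ε ^ 2) - ε :=
  (((contDiff_id.pow 2).add contDiff_const).sqrt fun t => by positivity).sub contDiff_const

theorem smoothAbs_bounds {ε : ℝ} (hε : 0 < ε) (t : ℝ) :
    0 ≤ √(t ^ 2 + ε ^ 2) - ε ∧ √(t ^ 2 + ε ^ 2) - ε ≤ |t| ∧ |t| - ε ≤ √(t ^ 2 + ε ^ 2) - ε := by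
  have h1 : ε ≤ √(t ^ 2 + ε ^ 2) := Real.le_sqrt_of_sq_le (by nlinarith [sq_nonneg t])
  have h2 : |t| ≤ √(t ^ 2 + ε ^ 2) := Real.le_sqrt_of_sq_le (by nlinarith [sq_abs t])
  have h3 : √(t ^ 2 + ε ^ 2) ≤ |t| + ε :=
    Real.sqrt_le_iff.2 ⟨by positivity, by nlinarith [sq_abs t, abs_nonneg t]⟩
  exact ⟨by linarith, by linarith, by linarith⟩

theorem abs_deriv_smoothAbs_le {ε : ℝ} (hε : 0 < ε) (t : ℝ) :
    |deriv (fun t : ℝ => √(t ^ 2 + ε ^ 2) - ε) t| ≤ 1 := by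
  have hpos : 0 < t ^ 2 + ε ^ 2 := by positivity
  have h : HasDerivAt (fun t : ℝ => √(t ^ 2 + ε ^ 2) - ε) (2 * t / (2 * √(t ^ 2 + ε ^ 2))) t := by
    have := (((hasDerivAt_pow 2 t).add_const (ε ^ 2)).sqrt hpos.ne').sub_const ε
    simpa using this
  have hs : 0 < √(t ^ 2 + ε ^ 2) := Real.sqrt_pos.2 hpos
  rw [h.deriv, abs_div, abs_mul, abs_mul, abs_two, abs_of_pos hs, div_le_one (by positivity)]
  have : |t| ≤ √(t ^ 2 + ε ^ 2) := Real.le_sqrt_of_sq_le (by nlinarith [sq_abs t])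
  linarith

/-- The smoothed absolute values of `v` have norms at most `‖u‖`. They differ from `|v|` by at most
`ε` where `v ≠ 0` and vanish elsewhere, so `ε` times a cutoff bounds the error and they converge in
`L^p`. Uniform convexity turns this into an element of the space, without a formula for the weak
derivatives of `|v|`. -/
theorem Represents.exists_abs (hp1 : 1 < p) (hp : p < ⊤) (hΩ : IsOpen Ω)
    {v : CompactlySupportedContinuousMap (closure Ω) ℝ} {u : Tilde p Ω} (h : Represents v u) :
    ∃ z : Tilde p Ω, value p Ω z = |value p Ω u| ∧ ‖z‖ ≤ ‖u‖ := by
  obtain ⟨χ, w, hχw, hχ0, hχ1⟩ := exists_cutoff p v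
  have hε : ∀ n : ℕ, (0 : ℝ) < 1 / ((n : ℝ) + 1) := fun n => Nat.one_div_pos_of_nat
  choose s hs hsu using fun n : ℕ => h.exists_comp hp hΩ (contDiff_smoothAbs (hε n))
    (fun t => by
      obtain ⟨h1, h2, _⟩ := smoothAbs_bounds (hε n) t
      rwa [abs_of_nonneg h1]) (abs_deriv_smoothAbs_le (hε n))
  refine (uniformlyConvexPow_tilde hp1 hp).exists_of_tendsto_map (one_lt_toReal hp1 hp)
    (value p Ω) (w := s) (r := fun _ => ‖u‖) ?_ tendsto_const_nhds hsu
  rw [tendsto_iff_norm_sub_tendsto_zero]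
  have hb : ∀ n, ‖value p Ω (s n) - |value p Ω u|‖ ≤ 1 / ((n : ℝ) + 1) * ‖value p Ω w‖ := by
    intro n
    refine Lp.norm_le_mul_norm_of_ae_le_mul ?_
    filter_upwards [hs n, h, hχw, Lp.coeFn_sub (value p Ω (s n)) |value p Ω u|,
      Lp.coeFn_abs (value p Ω u), ae_restrict_mem hΩ.measurableSet] with x h1 h2 h3 h4 h5 hx
    have hx' := subset_closure hx
    obtain ⟨b1, b2, b3⟩ := smoothAbs_bounds (hε n) (v ⟨x, hx'⟩)
    rw [h4, Pi.sub_apply, h5, ← h1 hx', ← h2 hx', ← h3 hx']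
    by_cases hv : v ⟨x, hx'⟩ = 0
    · rw [hv, abs_zero] at b2 b3 ⊢
      rw [hv] at b1
      rw [le_antisymm b2 b1, sub_zero, norm_zero]
      exact mul_nonneg (hε n).le (norm_nonneg _)
    · rw [hχ1 _ hv, norm_one, mul_one, Real.norm_eq_abs, abs_le]
      exact ⟨by linarith, by linarith [hε n]⟩
  refine squeeze_zero (fun _ => norm_nonneg _) hb ?_
  have := (tendsto_one_div_add_atTop_nhds_zero_nat (𝕜 := ℝ)).mul_const ‖value p Ω w‖
  rwa [zero_mul] at this

/-- Every element of `W̃^{1,p}(Ω)` is the limit of functions in `W^{1,p}(Ω) ∩ C_c(closure Ω)`. -/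
theorem exists_represents_norm_sub_lt (u : Tilde p Ω) {ε : ℝ} (hε : 0 < ε) :
    ∃ (v : CompactlySupportedContinuousMap (closure Ω) ℝ) (w : Tilde p Ω),
      Represents v w ∧ ‖w - u‖ < ε := by
  have hu : u.1 ∈ closure (ccSobolev p Ω : Set (Sobolev p Ω)) := u.2
  obtain ⟨w, ⟨v, hv⟩, hwu⟩ := Metric.mem_closure_iff.1 hu ε hε
  refine ⟨v, ⟨w, (ccSobolev p Ω).le_topologicalClosure ⟨v, hv⟩⟩, hv, ?_⟩
  rw [dist_comm, dist_eq_norm] at hwu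
  exact hwu

/-- `W̃^{1,p}(Ω)` is stable under the absolute value, which does not increase the norm. -/
theorem exists_abs (hp1 : 1 < p) (hp : p < ⊤) (hΩ : IsOpen Ω) (u : Tilde p Ω) :
    ∃ z : Tilde p Ω, (∀ᵐ x ∂(volume.restrict Ω), value p Ω z x = |value p Ω u x|) ∧
      ‖z‖ ≤ ‖u‖ := by
  choose v w hvw hwu using fun n : ℕ => exists_represents_norm_sub_lt u
    (Nat.one_div_pos_of_nat (α := ℝ) (n := n))
  choose s hs hsw using fun n : ℕ => (hvw n).exists_abs hp1 hp hΩ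
  have hlim : Tendsto w atTop (𝓝 u) := by
    rw [tendsto_iff_norm_sub_tendsto_zero]
    exact squeeze_zero (fun _ => norm_nonneg _) (fun n => (hwu n).le)
      tendsto_one_div_add_atTop_nhds_zero_nat
  -- The absolute value is nonexpansive on `L^p`, so `|w n|` converges to `|u|` there, while the
  -- norms are bounded by `‖w n‖ → ‖u‖`.
  obtain ⟨z, hz, hzu⟩ := (uniformlyConvexPow_tilde hp1 hp).exists_of_tendsto_map
    (one_lt_toReal hp1 hp) (value p Ω) (w := s) (h := |value p Ω u|) (r := fun n => ‖w n‖) (by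
      simp only [hs]
      rw [tendsto_iff_norm_sub_tendsto_zero]
      refine squeeze_zero (fun _ => norm_nonneg _) (fun n => norm_abs_sub_abs _ _) ?_
      exact tendsto_iff_norm_sub_tendsto_zero.1
        (((value p Ω).continuous.tendsto u).comp hlim)) hlim.norm hsw
  refine ⟨z, ?_, hzu⟩
  filter_upwards [Lp.coeFn_abs (value p Ω u)] with x hx
  rw [hz, hx]

end SobolevSpace

end RelCap

/-! ### Relative capacity and quasi continuity. -/

namespace RelCap

section Capacity

variable {N : ℕ} {p : ℝ≥0∞} [Fact (1 ≤ p)] {Ω : Set (EuclideanSpace ℝ (Fin N))}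

theorem value_add_ae (u v : Tilde p Ω) :
    ∀ᵐ x ∂(volume.restrict Ω), value p Ω (u + v) x = value p Ω u x + value p Ω v x := by
  rw [map_add]
  exact Lp.coeFn_add _ _

theorem value_smul_ae (c : ℝ) (u : Tilde p Ω) :
    ∀ᵐ x ∂(volume.restrict Ω), value p Ω (c • u) x = c * value p Ω u x := by
  rw [map_smul]
  exact Lp.coeFn_smul _ _

/-- `u` is at least `1` almost everywhere on the trace in `Ω` of the set `O`. -/
def GeOneOn (u : Tilde p Ω) (O : Set (closure Ω)) : Prop :=
  ∀ᵐ x ∂(volume.restrict Ω), x ∈ Subtype.val '' O → 1 ≤ value p Ω u x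

theorem relCap_le_of_geOneOn {A O : Set (closure Ω)} (hO : IsOpen O) (hAO : A ⊆ O)
    {u : Tilde p Ω} (hu : GeOneOn u O) : relCap p Ω A ≤ ENNReal.ofReal (‖u‖ ^ p.toReal) := by
  have hmem : (show TildeSobolev p Ω from u) ∈ admissible p Ω A := ⟨O, hO, hAO, hu⟩
  exact iInf₂_le (f := fun (u : TildeSobolev p Ω) (_ : u ∈ admissible p Ω A) =>
    ENNReal.ofReal (‖u‖ ^ p.toReal)) _ hmem

theorem le_relCap {A : Set (closure Ω)} {c : ℝ≥0∞} (h : ∀ (u : Tilde p Ω) (O : Set (closure Ω)),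
    IsOpen O → A ⊆ O → GeOneOn u O → c ≤ ENNReal.ofReal (‖u‖ ^ p.toReal)) : c ≤ relCap p Ω A :=
  le_iInf₂ fun u hu => by
    obtain ⟨O, h1, h2, h3⟩ := hu
    exact h u O h1 h2 h3

theorem exists_geOneOn_of_relCap_lt {A : Set (closure Ω)} {c : ℝ≥0∞} (h : relCap p Ω A < c) :
    ∃ (u : Tilde p Ω) (O : Set (closure Ω)), IsOpen O ∧ A ⊆ O ∧ GeOneOn u O ∧
      ENNReal.ofReal (‖u‖ ^ p.toReal) < c := by
  by_contra! hc
  exact h.not_ge (le_relCap hc)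

/-- `A` has a nonnegative competitor for the capacity of norm at most `r`. -/
def Covers (p : ℝ≥0∞) [Fact (1 ≤ p)] (A : Set (closure Ω)) (r : ℝ) : Prop :=
  ∃ (u : Tilde p Ω) (O : Set (closure Ω)), IsOpen O ∧ A ⊆ O ∧
    (∀ᵐ x ∂(volume.restrict Ω), 0 ≤ value p Ω u x) ∧ GeOneOn u O ∧ ‖u‖ ≤ r

theorem Covers.mono {A B : Set (closure Ω)} {r s : ℝ} (h : Covers p B r) (hAB : A ⊆ B)
    (hrs : r ≤ s) : Covers p A s := by
  obtain ⟨u, O, h1, h2, h3, h4, h5⟩ := h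
  exact ⟨u, O, h1, hAB.trans h2, h3, h4, h5.trans hrs⟩

theorem Covers.relCap_le {A : Set (closure Ω)} {r : ℝ} (h : Covers p A r) :
    relCap p Ω A ≤ ENNReal.ofReal (r ^ p.toReal) := by
  obtain ⟨u, O, h1, h2, _, h4, h5⟩ := h
  exact (relCap_le_of_geOneOn h1 h2 h4).trans (ENNReal.ofReal_le_ofReal
    (Real.rpow_le_rpow (norm_nonneg _) h5 ENNReal.toReal_nonneg))

theorem exists_nonneg_of_geOneOn (hp1 : 1 < p) (hp : p < ⊤) (hΩ : IsOpen Ω) {u : Tilde p Ω}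
    {O : Set (closure Ω)} (hu : GeOneOn u O) : ∃ z : Tilde p Ω,
    (∀ᵐ x ∂(volume.restrict Ω), 0 ≤ value p Ω z x) ∧ GeOneOn z O ∧ ‖z‖ ≤ ‖u‖ := by
  obtain ⟨z, hz, hzu⟩ := exists_abs hp1 hp hΩ u
  refine ⟨z, ?_, ?_, hzu⟩
  · filter_upwards [hz] with x hx
    rw [hx]
    exact abs_nonneg _
  · filter_upwards [hz, hu] with x h1 h2 h3
    rw [h1]
    exact (h2 h3).trans (le_abs_self _)

theorem covers_of_relCap_lt (hp1 : 1 < p) (hp : p < ⊤) (hΩ : IsOpen Ω) {A : Set (closure Ω)}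
    {r : ℝ} (hr : 0 ≤ r) (h : relCap p Ω A < ENNReal.ofReal (r ^ p.toReal)) : Covers p A r := by
  have hq := one_lt_toReal hp1 hp
  obtain ⟨u, O, hO, hAO, hu, hlt⟩ := exists_geOneOn_of_relCap_lt h
  obtain ⟨z, hz0, hz1, hzu⟩ := exists_nonneg_of_geOneOn hp1 hp hΩ hu
  refine ⟨z, O, hO, hAO, hz0, hz1, hzu.trans ?_⟩
  have h1 := (ENNReal.ofReal_lt_ofReal_iff_of_nonneg (by positivity)).1 hlt
  exact ((Real.rpow_lt_rpow_iff (norm_nonneg u) hr (by linarith)).1 h1).le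

theorem tendsto_ofReal_rpow_nhdsGT_zero {q : ℝ} (hq : 0 < q) :
    Tendsto (fun t : ℝ => ENNReal.ofReal (t ^ q)) (𝓝[>] 0) (𝓝 0) := by
  have h1 : Tendsto (fun t : ℝ => t ^ q) (𝓝[>] 0) (𝓝 0) := by
    have := (Real.continuousAt_rpow_const 0 q (Or.inr hq.le)).tendsto
    rw [Real.zero_rpow hq.ne'] at this
    exact this.mono_left nhdsWithin_le_nhds
  simpa using ENNReal.tendsto_ofReal h1

/-- Working with `Covers` replaces capacities by norms, for which the triangle inequality gives
subadditivity directly. -/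
theorem relCap_eq_zero_iff (hp1 : 1 < p) (hp : p < ⊤) (hΩ : IsOpen Ω) {A : Set (closure Ω)} :
    relCap p Ω A = 0 ↔ ∀ ε : ℝ, 0 < ε → Covers p A ε := by
  have hq := one_lt_toReal hp1 hp
  constructor
  · intro h ε hε
    refine covers_of_relCap_lt hp1 hp hΩ hε.le ?_
    rw [h]
    exact ENNReal.ofReal_pos.2 (Real.rpow_pos_of_pos hε _)
  · intro h
    have hlim := tendsto_ofReal_rpow_nhdsGT_zero (zero_lt_one.trans hq)
    refine le_antisymm (ge_of_tendsto hlim ?_) bot_le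
    filter_upwards [self_mem_nhdsWithin] with ε hε
    exact (h ε hε).relCap_le

/-- The sum of the competitors converges absolutely in norm and, all of them being nonnegative,
dominates each one. Thus the `p`-th root of the capacity is countably subadditive. -/
theorem Covers.iUnion {A : ℕ → Set (closure Ω)} {r : ℕ → ℝ} (h : ∀ n, Covers p (A n) (r n))
    (hr : Summable r) : Covers p (⋃ n, A n) (∑' n, r n) := by
  choose u O hO hAO hu0 hu1 hur using h
  have hsn : Summable fun n => ‖u n‖ := hr.of_nonneg_of_le (fun _ => norm_nonneg _) hur
  have hs : Summable u := hsn.of_norm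
  have hsv : HasSum (fun n => value p Ω (u n)) (value p Ω (∑' n, u n)) :=
    (value p Ω).hasSum hs.hasSum
  have h0 : ∀ n, 0 ≤ value p Ω (u n) := fun n => (Lp.coeFn_nonneg _).1 (hu0 n)
  have hle : ∀ n, value p Ω (u n) ≤ value p Ω (∑' n, u n) := fun n =>
    le_hasSum hsv n fun m _ => h0 m
  refine ⟨∑' n, u n, ⋃ n, O n, isOpen_iUnion hO, Set.iUnion_mono hAO, ?_, ?_, ?_⟩
  · exact (Lp.coeFn_nonneg _).2 ((h0 0).trans (hle 0))
  · have h2 : ∀ᵐ x ∂(volume.restrict Ω), ∀ n, value p Ω (u n) x ≤ value p Ω (∑' n, u n) x :=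
      ae_all_iff.2 fun n => (Lp.coeFn_le _ _).2 (hle n)
    filter_upwards [h2, ae_all_iff.2 hu1] with x h3 h4 hx
    obtain ⟨y, hy, rfl⟩ := hx
    obtain ⟨n, hn⟩ := Set.mem_iUnion.1 hy
    exact (h4 n ⟨y, hn, rfl⟩).trans (h3 n)
  · exact (norm_tsum_le_tsum_norm hsn).trans (hsn.tsum_le_tsum hur hr)

theorem Covers.union {A B : Set (closure Ω)} {r s : ℝ} (hA : Covers p A r) (hB : Covers p B s) :
    Covers p (A ∪ B) (r + s) := by
  obtain ⟨u, O, h1, h2, h3, h4, h5⟩ := hA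
  obtain ⟨v, O', h1', h2', h3', h4', h5'⟩ := hB
  refine ⟨u + v, O ∪ O', h1.union h1', Set.union_subset_union h2 h2', ?_, ?_,
    (norm_add_le _ _).trans (add_le_add h5 h5')⟩
  · filter_upwards [h3, h3', value_add_ae u v] with x a1 a2 a3
    rw [a3]
    exact add_nonneg a1 a2
  · filter_upwards [h3, h3', h4, h4', value_add_ae u v] with x a1 a2 a3 a4 a5 hx
    rw [a5]
    rw [Set.image_union] at hx
    rcases hx with hx | hx
    · linarith [a3 hx]
    · linarith [a4 hx]

theorem relCap_iUnion_eq_zero (hp1 : 1 < p) (hp : p < ⊤) (hΩ : IsOpen Ω)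
    {A : ℕ → Set (closure Ω)} (h : ∀ n, relCap p Ω (A n) = 0) : relCap p Ω (⋃ n, A n) = 0 := by
  rw [relCap_eq_zero_iff hp1 hp hΩ]
  intro ε hε
  have hs : HasSum (fun n : ℕ => ε / 2 / 2 ^ n) ε := hasSum_geometric_two' ε
  have := Covers.iUnion (fun n => (relCap_eq_zero_iff hp1 hp hΩ).1 (h n) (ε / 2 / 2 ^ n)
    (by positivity)) hs.summable
  rwa [hs.tsum_eq] at this

theorem relCap_union_eq_zero (hp1 : 1 < p) (hp : p < ⊤) (hΩ : IsOpen Ω) {A B : Set (closure Ω)}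
    (hA : relCap p Ω A = 0) (hB : relCap p Ω B = 0) : relCap p Ω (A ∪ B) = 0 := by
  rw [relCap_eq_zero_iff hp1 hp hΩ] at hA hB ⊢
  intro ε hε
  have := (hA (ε / 2) (half_pos hε)).union (hB (ε / 2) (half_pos hε))
  rwa [add_halves] at this

theorem quasiContinuous_iff (hp1 : 1 < p) (hp : p < ⊤) (hΩ : IsOpen Ω) {f : closure Ω → ℝ} :
    QuasiContinuous p Ω f ↔ ∀ ε : ℝ, 0 < ε →
      ∃ V : Set (closure Ω), IsOpen V ∧ Covers p V ε ∧ ContinuousOn f Vᶜ := by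
  have hq := one_lt_toReal hp1 hp
  constructor
  · intro h ε hε
    obtain ⟨V, h1, h2, h3⟩ := h (ENNReal.ofReal (ε ^ p.toReal))
      (ENNReal.ofReal_pos.2 (Real.rpow_pos_of_pos hε _))
    exact ⟨V, h1, covers_of_relCap_lt hp1 hp hΩ hε.le h2, h3⟩
  · intro h ε hε
    have hlim := tendsto_ofReal_rpow_nhdsGT_zero (zero_lt_one.trans hq)
    obtain ⟨t, ht, ht0⟩ := ((hlim.eventually (gt_mem_nhds hε)).and self_mem_nhdsWithin).exists
    obtain ⟨V, h1, h2, h3⟩ := h t ht0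
    exact ⟨V, h1, h2.relCap_le.trans_lt ht, h3⟩

theorem quasiContinuous_of_continuous (hp : p < ⊤) {f : closure Ω → ℝ} (hf : Continuous f) :
    QuasiContinuous p Ω f :=
  fun ε hε => ⟨∅, isOpen_empty, by rwa [relCap_empty hp], hf.continuousOn⟩

theorem QuasiContinuous.add (hp1 : 1 < p) (hp : p < ⊤) (hΩ : IsOpen Ω) {f g : closure Ω → ℝ}
    (hf : QuasiContinuous p Ω f) (hg : QuasiContinuous p Ω g) : QuasiContinuous p Ω (f + g) := by
  rw [quasiContinuous_iff hp1 hp hΩ] at hf hg ⊢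
  intro ε hε
  obtain ⟨V, h1, h2, h3⟩ := hf (ε / 2) (half_pos hε)
  obtain ⟨W, h4, h5, h6⟩ := hg (ε / 2) (half_pos hε)
  refine ⟨V ∪ W, h1.union h4, add_halves ε ▸ h2.union h5, ?_⟩
  rw [Set.compl_union]
  exact (h3.mono Set.inter_subset_left).add (h6.mono Set.inter_subset_right)

theorem QuasiContinuous.smul (c : ℝ) {f : closure Ω → ℝ} (hf : QuasiContinuous p Ω f) :
    QuasiContinuous p Ω (c • f) := by
  intro ε hε
  obtain ⟨V, h1, h2, h3⟩ := hf ε hε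
  exact ⟨V, h1, h2, h3.const_smul c⟩

theorem QuasiContinuous.sub (hp1 : 1 < p) (hp : p < ⊤) (hΩ : IsOpen Ω) {f g : closure Ω → ℝ}
    (hf : QuasiContinuous p Ω f) (hg : QuasiContinuous p Ω g) : QuasiContinuous p Ω (f - g) := by
  have := hf.add hp1 hp hΩ (hg.smul (-1))
  rwa [neg_one_smul, ← sub_eq_add_neg] at this

/-- Outside an open set `V` of small capacity, `{1 < (1 + δ) f}` is relatively open. Together with
`V` and an open neighbourhood of `P` it covers `A`, and `(1 + δ) |u|` plus competitors for `V` and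
`P` is admissible. The factor `1 + δ` turns `1 ≤ f` into an open condition. -/
theorem covers_of_one_le_quasiContinuous (hp1 : 1 < p) (hp : p < ⊤) (hΩ : IsOpen Ω)
    {f : closure Ω → ℝ} {u : Tilde p Ω} (hf : QuasiContinuous p Ω f) (hfu : Represents f u)
    {A P : Set (closure Ω)} (hP : relCap p Ω P = 0) (hA : ∀ x ∈ A, x ∉ P → 1 ≤ f x) {δ : ℝ}
    (hδ : 0 < δ) : Covers p A ((1 + δ) * ‖u‖ + δ + δ) := by
  obtain ⟨V, hVo, ⟨w, OV, -, hVO, hw0, hw1, hwδ⟩, hfV⟩ :=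
    (quasiContinuous_iff hp1 hp hΩ).1 hf δ hδ
  obtain ⟨w', OP, hOPo, hPO, hw0', hw1', hwδ'⟩ := (relCap_eq_zero_iff hp1 hp hΩ).1 hP δ hδ
  obtain ⟨z, hz, hzu⟩ := exists_abs hp1 hp hΩ u
  obtain ⟨W, hWo, hW⟩ := continuousOn_iff'.1 hfV {t | 1 < (1 + δ) * t}
    (isOpen_lt continuous_const (continuous_const.mul continuous_id))
  have hWmem : ∀ x, x ∉ V → (1 < (1 + δ) * f x ↔ x ∈ W) := by
    intro x hx
    have h1 : x ∈ f ⁻¹' {t | 1 < (1 + δ) * t} ∩ Vᶜ ↔ x ∈ W ∩ Vᶜ := by rw [hW]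
    simpa [hx] using h1
  refine ⟨(1 + δ) • z + w + w', V ∪ W ∪ OP, (hVo.union hWo).union hOPo, ?_, ?_, ?_, ?_⟩
  · intro x hx
    by_cases hxP : x ∈ P
    · exact Or.inr (hPO hxP)
    · by_cases hxV : x ∈ V
      · exact Or.inl (Or.inl hxV)
      · refine Or.inl (Or.inr ((hWmem x hxV).1 ?_))
        nlinarith [hA x hx hxP]
  · filter_upwards [value_add_ae ((1 + δ) • z + w) w', value_add_ae ((1 + δ) • z) w,
      value_smul_ae (1 + δ) z, hz, hw0, hw0'] with x a1 a2 a3 a4 a5 a6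
    rw [a1, a2, a3, a4]
    positivity
  · filter_upwards [value_add_ae ((1 + δ) • z + w) w', value_add_ae ((1 + δ) • z) w,
      value_smul_ae (1 + δ) z, hz, hw0, hw0', hw1, hw1', hfu] with x a1 a2 a3 a4 a5 a6 a7 a8 a9 hx
    rw [a1, a2, a3, a4]
    have hz0 : 0 ≤ (1 + δ) * |value p Ω u x| := by positivity
    obtain ⟨y, hy, rfl⟩ := hx
    by_cases hyV : y ∈ V
    · linarith [a7 ⟨y, hVO hyV, rfl⟩]
    · rcases hy with (hy | hy) | hy
      · exact absurd hy hyV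
      · have h1 := (hWmem y hyV).2 hy
        have h2 : f y = value p Ω u y := a9 y.2
        rw [h2] at h1
        have h3 : (1 + δ) * value p Ω u y ≤ (1 + δ) * |value p Ω u y| :=
          mul_le_mul_of_nonneg_left (le_abs_self _) (by linarith)
        linarith
      · linarith [a8 ⟨y, hy, rfl⟩]
  · refine (norm_add_le _ _).trans (add_le_add ((norm_add_le _ _).trans (add_le_add ?_ hwδ)) hwδ')
    rw [norm_smul, Real.norm_eq_abs, abs_of_pos (by linarith)]
    exact mul_le_mul_of_nonneg_left hzu (by linarith)

/-- Quasi continuous functions that are at least `1` quasi everywhere on `A` are competitors for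
the capacity of `A`. -/
theorem relCap_le_of_one_le (hp1 : 1 < p) (hp : p < ⊤) (hΩ : IsOpen Ω)
    {f : closure Ω → ℝ} {u : Tilde p Ω} (hf : QuasiContinuous p Ω f) (hfu : Represents f u)
    {A P : Set (closure Ω)} (hP : relCap p Ω P = 0) (hA : ∀ x ∈ A, x ∉ P → 1 ≤ f x) :
    relCap p Ω A ≤ ENNReal.ofReal (‖u‖ ^ p.toReal) := by
  have hq := one_lt_toReal hp1 hp
  have hlim : Tendsto (fun δ : ℝ => ENNReal.ofReal (((1 + δ) * ‖u‖ + δ + δ) ^ p.toReal)) (𝓝[>] 0)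
      (𝓝 (ENNReal.ofReal (‖u‖ ^ p.toReal))) := by
    have hc : Continuous fun δ : ℝ => ENNReal.ofReal (((1 + δ) * ‖u‖ + δ + δ) ^ p.toReal) := by
      refine ENNReal.continuous_ofReal.comp (Continuous.rpow_const ?_ fun _ => Or.inr (by linarith))
      fun_prop
    have := (hc.tendsto 0).mono_left (nhdsWithin_le_nhds (s := Set.Ioi 0))
    simpa using this
  refine ge_of_tendsto hlim ?_
  filter_upwards [self_mem_nhdsWithin] with δ hδ
  exact (covers_of_one_le_quasiContinuous hp1 hp hΩ hf hfu hP hA hδ).relCap_le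

/-- A capacitary Chebyshev inequality: `f / c` is a competitor. The strict inequality leaves the
room needed to pass from the infimum to an actual competitor. -/
theorem covers_of_le_quasiContinuous (hp1 : 1 < p) (hp : p < ⊤) (hΩ : IsOpen Ω)
    {f : closure Ω → ℝ} {u : Tilde p Ω} (hf : QuasiContinuous p Ω f) (hfu : Represents f u)
    {c r : ℝ} (hc : 0 < c) (hr : ‖u‖ < c * r) : Covers p {x | c ≤ f x} r := by
  have hq := one_lt_toReal hp1 hp
  have hr0 : 0 < r := pos_of_mul_pos_right ((norm_nonneg u).trans_lt hr) hc.le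
  refine covers_of_relCap_lt hp1 hp hΩ hr0.le ((relCap_le_of_one_le hp1 hp hΩ (hf.smul c⁻¹)
    (hfu.smul c⁻¹) (relCap_empty hp) ?_).trans_lt ?_)
  · intro x hx _
    rw [Pi.smul_apply, smul_eq_mul, le_inv_mul_iff₀ hc, mul_one]
    exact hx
  · refine (ENNReal.ofReal_lt_ofReal_iff (Real.rpow_pos_of_pos hr0 _)).2 ?_
    refine Real.rpow_lt_rpow (norm_nonneg _) ?_ (by linarith)
    rw [norm_smul, norm_inv, Real.norm_eq_abs, abs_of_pos hc, inv_mul_lt_iff₀ hc]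
    exact hr

/-- A quasi continuous function that is at least `1` almost everywhere on a relatively open set is
at least `1` quasi everywhere on it. -/
theorem relCap_lt_one_eq_zero (hp1 : 1 < p) (hp : p < ⊤) (hΩ : IsOpen Ω)
    {f : closure Ω → ℝ} {u : Tilde p Ω} (hf : QuasiContinuous p Ω f) (hfu : Represents f u)
    {O : Set (closure Ω)} (hO : IsOpen O) (hu : GeOneOn u O) :
    relCap p Ω {x | x ∈ O ∧ f x < 1} = 0 := by
  rw [relCap_eq_zero_iff hp1 hp hΩ]
  intro ε hε
  obtain ⟨V, hVo, ⟨w, OV, -, hVO, hw0, hw1, hwε⟩, hfV⟩ :=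
    (quasiContinuous_iff hp1 hp hΩ).1 hf ε hε
  obtain ⟨W, hWo, hW⟩ := continuousOn_iff'.1 hfV (Set.Iio 1) isOpen_Iio
  have hWmem : ∀ x, x ∉ V → (f x < 1 ↔ x ∈ W) := by
    intro x hx
    have h1 : x ∈ f ⁻¹' Set.Iio 1 ∩ Vᶜ ↔ x ∈ W ∩ Vᶜ := by rw [hW]
    simpa [hx] using h1
  -- The competitor `w` for `V` also works on the larger open set `O ∩ (V ∪ W)`. Off `V`, points of
  -- `O ∩ W` satisfy `f < 1`, while `f = u ≥ 1` a.e. on the trace of `O` in `Ω`; hence the added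
  -- part is Lebesgue null in `Ω`.
  refine ⟨w, O ∩ (V ∪ W), hO.inter (hVo.union hWo), ?_, hw0, ?_, hwε⟩
  · rintro x ⟨hxO, hx⟩
    by_cases hxV : x ∈ V
    · exact ⟨hxO, Or.inl hxV⟩
    · exact ⟨hxO, Or.inr ((hWmem x hxV).1 hx)⟩
  · filter_upwards [hw1, hu, hfu] with x a1 a2 a3 hx
    obtain ⟨y, ⟨hyO, hy⟩, rfl⟩ := hx
    by_cases hyV : y ∈ V
    · exact a1 ⟨y, hVO hyV, rfl⟩
    · have h1 := (hWmem y hyV).2 (hy.resolve_left hyV)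
      have h2 : f y = value p Ω u y := a3 y.2
      have h3 := a2 ⟨y, hyO, rfl⟩
      linarith

end Capacity

end RelCap

/-! ### Quasi continuous versions and the capacitary extremal. -/

namespace RelCap

section Extremal

variable {N : ℕ} {p : ℝ≥0∞} [Fact (1 ≤ p)] {Ω : Set (EuclideanSpace ℝ (Fin N))}

/-- Chebyshev's inequality for continuous functions. The superlevel set is itself open, so no quasi
continuous version has to exist yet. -/
theorem covers_lt_abs (hp1 : 1 < p) (hp : p < ⊤) (hΩ : IsOpen Ω) {g : closure Ω → ℝ}
    (hg : Continuous g) {u : Tilde p Ω} (hgu : Represents g u) {c : ℝ} (hc : 0 < c) :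
    Covers p {x | c < |g x|} (c⁻¹ * ‖u‖) := by
  obtain ⟨z, hz, hzu⟩ := exists_abs hp1 hp hΩ u
  refine ⟨c⁻¹ • z, _, isOpen_lt continuous_const hg.abs, subset_rfl, ?_, ?_, ?_⟩
  · filter_upwards [value_smul_ae c⁻¹ z, hz] with x h1 h2
    rw [h1, h2]
    positivity
  · filter_upwards [value_smul_ae c⁻¹ z, hz, hgu] with x h1 h2 h3 hx
    obtain ⟨y, hy, rfl⟩ := hx
    have h4 : g y = value p Ω u y := h3 y.2
    rw [h1, h2, ← h4, le_inv_mul_iff₀ hc, mul_one]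
    exact le_of_lt hy
  · rw [norm_smul, norm_inv, Real.norm_eq_abs, abs_of_pos hc]
    exact mul_le_mul_of_nonneg_left hzu (inv_pos.2 hc).le

/-- A sequence of continuous functions that converges fast in `W̃^{1,p}(Ω)` converges outside
open sets of small capacity, uniformly and at a geometric rate. -/
theorem exists_covers_geometric (hp1 : 1 < p) (hp : p < ⊤) (hΩ : IsOpen Ω)
    {v : ℕ → closure Ω → ℝ} (hv : ∀ n, Continuous (v n)) {w : ℕ → Tilde p Ω}
    (hvw : ∀ n, Represents (v n) (w n)) (hw : ∀ n, ‖w (n + 1) - w n‖ ≤ 2 * (1 / 4) ^ n) (k : ℕ) :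
    ∃ U : Set (closure Ω), IsOpen U ∧ Covers p U (4 * (1 / 2) ^ k) ∧
      ∀ x ∉ U, ∀ n, dist (v (k + n) x) (v (k + (n + 1)) x) ≤ (1 / 2) ^ k * (1 / 2) ^ n := by
  have hpos : ∀ n : ℕ, (0 : ℝ) < (1 / 2) ^ n := fun n => by positivity
  refine ⟨⋃ n, {x | (1 / 2) ^ (k + n) < |(v (k + n + 1) - v (k + n)) x|},
    isOpen_iUnion fun n => isOpen_lt continuous_const ((hv _).sub (hv _)).abs, ?_, ?_⟩
  -- Steps of norm `2 · 4^-(k+n)` against the threshold `2^-(k+n)` cost `2 · 2^-(k+n)`, which sums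
  -- to `4 · 2^-k`.
  · have hs : HasSum (fun n : ℕ => 2 * (1 / 2 : ℝ) ^ k * (1 / 2) ^ n) (4 * (1 / 2) ^ k) := by
      have := hasSum_geometric_two.mul_left (2 * (1 / 2 : ℝ) ^ k)
      rwa [show 2 * (1 / 2 : ℝ) ^ k * 2 = 4 * (1 / 2) ^ k by ring] at this
    rw [← hs.tsum_eq]
    refine Covers.iUnion (fun n => (covers_lt_abs hp1 hp hΩ ((hv _).sub (hv _))
      ((hvw (k + n + 1)).sub (hvw (k + n))) (hpos (k + n))).mono subset_rfl ?_) hs.summable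
    rw [inv_mul_le_iff₀ (hpos _)]
    refine (hw (k + n)).trans_eq ?_
    rw [show (1 / 4 : ℝ) = 1 / 2 * (1 / 2) by norm_num, mul_pow, pow_add]
    ring
  · intro x hx n
    have h1 : ¬ (1 / 2 : ℝ) ^ (k + n) < |(v (k + n + 1) - v (k + n)) x| := fun h =>
      hx (Set.mem_iUnion.2 ⟨n, h⟩)
    rw [dist_comm, Real.dist_eq, ← pow_add]
    exact not_lt.1 h1

/-- Every element of `W̃^{1,p}(Ω)` has a quasi continuous version. -/
theorem exists_quasiContinuous (hp1 : 1 < p) (hp : p < ⊤) (hΩ : IsOpen Ω) (u : Tilde p Ω) :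
    ∃ f : closure Ω → ℝ, QuasiContinuous p Ω f ∧ Represents f u := by
  classical
  choose v w hvw hwu using fun n : ℕ => exists_represents_norm_sub_lt u
    (show (0 : ℝ) < (1 / 4) ^ n by positivity)
  have hw : ∀ n, ‖w (n + 1) - w n‖ ≤ 2 * (1 / 4) ^ n := by
    intro n
    have h1 : w (n + 1) - w n = (w (n + 1) - u) - (w n - u) := by abel
    have h2 : (1 / 4 : ℝ) ^ (n + 1) ≤ (1 / 4) ^ n :=
      pow_le_pow_of_le_one (by norm_num) (by norm_num) (Nat.le_succ n)
    rw [h1]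
    linarith [norm_sub_le (w (n + 1) - u) (w n - u), hwu n, hwu (n + 1)]
  choose U hUo hUc hU using exists_covers_geometric hp1 hp hΩ (v := fun n => v n)
    (fun n => (v n).continuous) hvw hw
  -- The default value is used only where the sequence diverges, hence inside `⋂ k, U k`, a set of
  -- capacity zero.
  let f : closure Ω → ℝ := fun x =>
    if h : ∃ l, Tendsto (fun n => v n x) atTop (𝓝 l) then h.choose else 0
  have hf : ∀ k, ∀ x ∉ U k, Tendsto (fun n => v n x) atTop (𝓝 (f x)) := by
    intro k x hx
    have h1 := cauchySeq_tendsto_of_complete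
      (cauchySeq_of_le_geometric (1 / 2) ((1 / 2) ^ k) (by norm_num) (hU k x hx))
    obtain ⟨l, hl⟩ := h1
    have h2 : ∃ l, Tendsto (fun n => v n x) atTop (𝓝 l) := by
      refine ⟨l, (tendsto_add_atTop_iff_nat k).1 ?_⟩
      simpa only [add_comm] using hl
    simp only [f, dif_pos h2]
    exact h2.choose_spec
  have hpow : Tendsto (fun n : ℕ => (1 / 2 : ℝ) ^ n) atTop (𝓝 0) :=
    tendsto_pow_atTop_nhds_zero_of_lt_one (by norm_num) (by norm_num)
  have hpow4 : Tendsto (fun n : ℕ => 4 * (1 / 2 : ℝ) ^ n) atTop (𝓝 0) := by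
    simpa using hpow.const_mul 4
  have hcont : ∀ k, ContinuousOn f (U k)ᶜ := by
    intro k
    have hunif : TendstoUniformlyOn (fun n x => v (k + n) x) f atTop (U k)ᶜ := by
      rw [Metric.tendstoUniformlyOn_iff]
      intro ε hε
      have h1 : Tendsto (fun n : ℕ => (1 / 2) ^ k * (1 / 2 : ℝ) ^ n / (1 - 1 / 2)) atTop
          (𝓝 0) := by
        simpa using (hpow.const_mul ((1 / 2 : ℝ) ^ k)).div_const (1 - 1 / 2)
      filter_upwards [h1.eventually (gt_mem_nhds hε)] with n hn x hx
      rw [dist_comm]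
      refine (dist_le_of_le_geometric_of_tendsto (1 / 2) ((1 / 2) ^ k) (by norm_num)
        (hU k x hx) ?_ n).trans_lt hn
      simpa only [add_comm] using (tendsto_add_atTop_iff_nat k).2 (hf k x hx)
    exact hunif.continuousOn (Frequently.of_forall fun n => (v (k + n)).continuous.continuousOn)
  have hnull : relCap p Ω (⋂ k, U k) = 0 := by
    rw [relCap_eq_zero_iff hp1 hp hΩ]
    intro ε hε
    obtain ⟨k, hk⟩ := (hpow4.eventually (gt_mem_nhds hε)).exists
    exact (hUc k).mono (Set.iInter_subset U k) hk.le
  refine ⟨f, ?_, ?_⟩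
  · rw [quasiContinuous_iff hp1 hp hΩ]
    intro ε hε
    obtain ⟨k, hk⟩ := (hpow4.eventually (gt_mem_nhds hε)).exists
    exact ⟨U k, hUo k, (hUc k).mono subset_rfl hk.le, hcont k⟩
  · have hlim : Tendsto w atTop (𝓝 u) := by
      rw [tendsto_iff_norm_sub_tendsto_zero]
      exact squeeze_zero (fun _ => norm_nonneg _) (fun n => (hwu n).le)
        (tendsto_pow_atTop_nhds_zero_of_lt_one (by norm_num) (by norm_num))
    -- A subsequence converges a.e. to `u`; off the null set the whole sequence converges to `f`, so
    -- the two limits agree.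
    have hmeas := tendstoInMeasure_of_tendsto_Lp (((value p Ω).continuous.tendsto u).comp hlim)
    obtain ⟨ns, hns, hae⟩ := hmeas.exists_seq_tendsto_ae
    filter_upwards [hae, ae_all_iff.2 hvw, ae_notMem_of_relCap_eq_zero hp hnull]
      with x h1 h2 h3 hx
    have h4 : (⟨x, hx⟩ : closure Ω) ∉ ⋂ k, U k := fun h => h3 ⟨_, h, rfl⟩
    rw [Set.mem_iInter, not_forall] at h4
    obtain ⟨k, hk⟩ := h4
    refine tendsto_nhds_unique ((hf k _ hk).comp hns.tendsto_atTop) (h1.congr fun n => ?_)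
    exact (h2 (ns n) hx).symm

theorem convex_geOneOn (A : Set (closure Ω)) :
    Convex ℝ {u : Tilde p Ω | ∃ O, IsOpen O ∧ A ⊆ O ∧ GeOneOn u O} := by
  rintro u ⟨O, h1, h2, h3⟩ v ⟨O', h1', h2', h3'⟩ a b ha hb hab
  refine ⟨O ∩ O', h1.inter h1', Set.subset_inter h2 h2', ?_⟩
  filter_upwards [h3, h3', value_add_ae (a • u) (b • v), value_smul_ae a u, value_smul_ae b v]
    with x a1 a2 a3 a4 a5 hx
  obtain ⟨y, ⟨hy, hy'⟩, rfl⟩ := hx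
  rw [a3, a4, a5]
  nlinarith [a1 ⟨y, hy, rfl⟩, a2 ⟨y, hy', rfl⟩]

/-- Let `g` be a quasi continuous version of `s n`. Where `f < 1 - c` on `A`, either `g < 1`, which
is exceptional, or `g - f ≥ c`, which has small capacity by the Chebyshev inequality. -/
theorem relCap_lt_of_tendsto_geOneOn (hp1 : 1 < p) (hp : p < ⊤) (hΩ : IsOpen Ω)
    {A : Set (closure Ω)} {s : ℕ → Tilde p Ω} {z : Tilde p Ω} (hs : Tendsto s atTop (𝓝 z))
    (hsA : ∀ n, ∃ O, IsOpen O ∧ A ⊆ O ∧ GeOneOn (s n) O) {f : closure Ω → ℝ}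
    (hf : QuasiContinuous p Ω f) (hfz : Represents f z) {c : ℝ} (hc : 0 < c) :
    relCap p Ω {x | x ∈ A ∧ f x < 1 - c} = 0 := by
  rw [relCap_eq_zero_iff hp1 hp hΩ]
  intro ε hε
  have hd := tendsto_iff_norm_sub_tendsto_zero.1 hs
  obtain ⟨n, hn⟩ := (hd.eventually (gt_mem_nhds (show 0 < c * (ε / 2) by positivity))).exists
  obtain ⟨O, hO, hAO, hge⟩ := hsA n
  obtain ⟨g, hg, hgs⟩ := exists_quasiContinuous hp1 hp hΩ (s n)
  have h1 := (relCap_eq_zero_iff hp1 hp hΩ).1 (relCap_lt_one_eq_zero hp1 hp hΩ hg hgs hO hge)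
    (ε / 2) (half_pos hε)
  have h2 := covers_of_le_quasiContinuous hp1 hp hΩ (hg.sub hp1 hp hΩ hf) (hgs.sub hfz) hc hn
  refine (h1.union h2).mono ?_ (add_halves ε).le
  rintro x ⟨hxA, hx⟩
  by_cases hgx : g x < 1
  · exact Or.inl ⟨hAO hxA, hgx⟩
  · refine Or.inr ?_
    change c ≤ g x - f x
    linarith

/-- Existence of a capacitary extremal. -/
theorem exists_extremal (hp1 : 1 < p) (hp : p < ⊤) (hΩ : IsOpen Ω) {A : Set (closure Ω)}
    (hA : relCap p Ω A < ⊤) :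
    ∃ (z : Tilde p Ω) (f : closure Ω → ℝ), QuasiContinuous p Ω f ∧ Represents f z ∧
      (∃ P, relCap p Ω P = 0 ∧ ∀ x ∈ A, x ∉ P → 1 ≤ f x) ∧
      ENNReal.ofReal (‖z‖ ^ p.toReal) = relCap p Ω A := by
  obtain ⟨u₀, O₀, hO₀, hAO₀, hu₀, -⟩ := exists_geOneOn_of_relCap_lt hA
  -- With a constant sequence of sets, the selection is a norm-minimizing sequence of competitors.
  -- Its limit `z` need not be a competitor itself; the q.e. criterion shows that its norm is not
  -- too small.
  obtain ⟨z, s, hsA, hsz, hz⟩ := exists_tendsto_of_antitone_convex (one_lt_toReal hp1 hp)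
    (uniformlyConvexPow_tilde hp1 hp)
    (K := fun _ => {u : Tilde p Ω | ∃ O, IsOpen O ∧ A ⊆ O ∧ GeOneOn u O}) antitone_const
    (fun _ => convex_geOneOn A) (M := ‖u₀‖) fun _ => ⟨u₀, ⟨O₀, hO₀, hAO₀, hu₀⟩, le_rfl⟩
  obtain ⟨f, hf, hfz⟩ := exists_quasiContinuous hp1 hp hΩ z
  have hP : relCap p Ω (⋃ k : ℕ, {x | x ∈ A ∧ f x < 1 - 1 / ((k : ℝ) + 1)}) = 0 :=
    relCap_iUnion_eq_zero hp1 hp hΩ fun k =>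
      relCap_lt_of_tendsto_geOneOn hp1 hp hΩ hsz hsA hf hfz Nat.one_div_pos_of_nat
  have hPA : ∀ x ∈ A, x ∉ (⋃ k : ℕ, {x | x ∈ A ∧ f x < 1 - 1 / ((k : ℝ) + 1)}) → 1 ≤ f x := by
    intro x hxA hx
    by_contra! hlt
    obtain ⟨k, hk⟩ := exists_nat_one_div_lt (sub_pos.2 hlt)
    exact hx (Set.mem_iUnion.2 ⟨k, hxA, by linarith⟩)
  refine ⟨z, f, hf, hfz, ⟨_, hP, hPA⟩, le_antisymm (le_relCap fun u O hO hAO hu => ?_)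
    (relCap_le_of_one_le hp1 hp hΩ hf hfz hP hPA)⟩
  exact ENNReal.ofReal_le_ofReal (Real.rpow_le_rpow (norm_nonneg _)
    (hz ‖u‖ fun _ => ⟨u, ⟨O, hO, hAO, hu⟩, le_rfl⟩) ENNReal.toReal_nonneg)

/-- Uniqueness of the capacitary extremal. -/
theorem extremal_unique (hp1 : 1 < p) (hp : p < ⊤) (hΩ : IsOpen Ω) {A P Q : Set (closure Ω)}
    {u v : Tilde p Ω} {f g : closure Ω → ℝ} (hf : QuasiContinuous p Ω f) (hfu : Represents f u)
    (hg : QuasiContinuous p Ω g) (hgv : Represents g v) (hP : relCap p Ω P = 0)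
    (hPA : ∀ x ∈ A, x ∉ P → 1 ≤ f x) (hQ : relCap p Ω Q = 0) (hQA : ∀ x ∈ A, x ∉ Q → 1 ≤ g x)
    (hu : ENNReal.ofReal (‖u‖ ^ p.toReal) = relCap p Ω A)
    (hv : ENNReal.ofReal (‖v‖ ^ p.toReal) = relCap p Ω A) : u = v := by
  have hq := one_lt_toReal hp1 hp
  -- The midpoint is at least `1` q.e. on `A`, so its norm cannot drop below the common value. The
  -- convexity gap is thus nonpositive, and `‖u - v‖ ^ p` is at most an arbitrarily small multiple
  -- of a constant.
  have hmid := relCap_le_of_one_le hp1 hp hΩ ((hf.add hp1 hp hΩ hg).smul (1 / 2))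
    ((hfu.add hgv).smul (1 / 2)) (A := A) (relCap_union_eq_zero hp1 hp hΩ hP hQ) (by
      intro x hxA hx
      rw [Set.mem_union, not_or] at hx
      have h1 := hPA x hxA hx.1
      have h2 := hQA x hxA hx.2
      simp only [Pi.smul_apply, Pi.add_apply, smul_eq_mul]
      linarith)
  have huv : ‖u‖ ^ p.toReal = ‖v‖ ^ p.toReal := by
    rw [← hv] at hu
    exact (ENNReal.ofReal_eq_ofReal_iff (by positivity) (by positivity)).1 hu
  rw [← hu] at hmid
  have hmid' := (ENNReal.ofReal_le_ofReal_iff (by positivity)).1 hmid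
  have hle : ∀ ε : ℝ, 0 < ε → ‖u - v‖ ^ p.toReal ≤ ε * (‖u‖ ^ p.toReal + ‖v‖ ^ p.toReal) := by
    intro ε hε
    obtain ⟨C, hC, h⟩ := uniformlyConvexPow_tilde hp1 hp ε hε
    have h1 := h u v
    have h2 : C * ((‖u‖ ^ p.toReal + ‖v‖ ^ p.toReal) / 2 - ‖(1 / 2 : ℝ) • (u + v)‖ ^ p.toReal)
        ≤ 0 := mul_nonpos_of_nonneg_of_nonpos hC (by linarith)
    linarith
  have hlim : Tendsto (fun ε : ℝ => ε * (‖u‖ ^ p.toReal + ‖v‖ ^ p.toReal)) (𝓝[>] 0) (𝓝 0) := by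
    have hc : Continuous fun ε : ℝ => ε * (‖u‖ ^ p.toReal + ‖v‖ ^ p.toReal) := by fun_prop
    have := (hc.tendsto 0).mono_left (nhdsWithin_le_nhds (s := Set.Ioi 0))
    simpa using this
  have h0 : ‖u - v‖ ^ p.toReal ≤ 0 := by
    refine ge_of_tendsto hlim ?_
    filter_upwards [self_mem_nhdsWithin] with ε hε
    exact hle ε hε
  have h1 : ‖u - v‖ = 0 :=
    (Real.rpow_eq_zero (norm_nonneg _) (by linarith)).1 (le_antisymm h0 (by positivity))
  exact sub_eq_zero.1 (norm_eq_zero.1 h1)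

end Extremal

end RelCap

/-! ### Representation of positive functionals by Radon measures, and uniqueness. -/

namespace RelCap

open CompactlySupported

variable {N : ℕ} {p : ℝ≥0∞} [Fact (1 ≤ p)] {Ω : Set (EuclideanSpace ℝ (Fin N))}

/-- The restrictions to `Ω` of the functions in `C_c(closure Ω)` that are Sobolev functions. -/
def compactlySupportedSobolev (p : ℝ≥0∞) [Fact (1 ≤ p)] (Ω : Set (EuclideanSpace ℝ (Fin N))) :
    Submodule ℝ C_c(closure Ω, ℝ) where
  carrier := {v | ∃ w : Tilde p Ω, Represents v w}
  zero_mem' := ⟨0, agreesOn_zero⟩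
  add_mem' := fun ⟨w, hw⟩ ⟨w', hw'⟩ => ⟨w + w', hw.add hw'⟩
  smul_mem' := fun c _ ⟨w, hw⟩ => ⟨c • w, hw.smul c⟩

/-- A positive functional on `W̃^{1,p}(Ω)` is represented by a regular measure. -/
theorem exists_measure_of_nonneg (hΩ : IsOpen Ω) (J : StrongDual ℝ (Tilde p Ω))
    (hJ : ∀ (v : C_c(closure Ω, ℝ)) (w : Tilde p Ω), Represents v w → (∀ x, 0 ≤ v x) → 0 ≤ J w) :
    ∃ μ : Measure (closure Ω), μ.Regular ∧
      ∀ (v : C_c(closure Ω, ℝ)) (w : Tilde p Ω), Represents v w → J w = ∫ x, v x ∂μ := by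
  have : LocallyCompactSpace (closure Ω) := isClosed_closure.locallyCompactSpace
  have : PosSMulMono ℝ C_c(closure Ω, ℝ) :=
    ⟨fun c hc a b hab x => mul_le_mul_of_nonneg_left (hab x) hc⟩
  -- The choice is harmless: a function represents at most one element of the space, which also
  -- makes `L` linear.
  choose r hr using fun v : compactlySupportedSobolev p Ω => v.2
  let L : compactlySupportedSobolev p Ω →ₗ[ℝ] ℝ :=
    { toFun := fun v => J (r v)
      map_add' := fun a b => by
        rw [(hr (a + b)).unique hΩ ((hr a).add (hr b)), map_add]
      map_smul' := fun c a => by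
        rw [(hr (c • a)).unique hΩ ((hr a).smul c), map_smul, RingHom.id_apply] }
  -- M. Riesz extension avoids any density argument. It requires that each `v` in `C_c` become
  -- nonnegative after adding an element of the subspace; a bound for `|v|` times a smooth cutoff
  -- equal to `1` where `v ≠ 0` does this.
  obtain ⟨g, hg, hg0⟩ := riesz_extension (PointedCone.positive ℝ C_c(closure Ω, ℝ))
    (⟨compactlySupportedSobolev p Ω, L⟩ : C_c(closure Ω, ℝ) →ₗ.[ℝ] ℝ)
    (fun x hx => hJ x.1 _ (hr x) fun y => hx y) (fun v => by
      obtain ⟨χ, w, hw, h0, h1⟩ := exists_cutoff p v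
      obtain ⟨C, hC⟩ := v.continuous.bounded_above_of_compact_support v.hasCompactSupport
      refine ⟨⟨C • χ, C • w, hw.smul C⟩, fun x => ?_⟩
      change 0 ≤ C * χ x + v x
      by_cases hx : v x = 0
      · rw [hx, add_zero]
        exact mul_nonneg ((norm_nonneg _).trans (hC x)) (h0 x)
      · rw [h1 x hx, mul_one]
        have : -C ≤ v x := (abs_le.1 (hC x)).1
        linarith)
  refine ⟨RealRMK.rieszMeasure (PositiveLinearMap.mk₀ g fun x hx => hg0 x hx), inferInstance,
    fun v w hvw => ?_⟩
  rw [RealRMK.integral_rieszMeasure]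
  refine Eq.trans ?_ (hg ⟨v, w, hvw⟩).symm
  exact congrArg J (hvw.unique hΩ (hr ⟨v, w, hvw⟩))

/-- A smooth bump function between a compact and an open subset of `closure Ω`. -/
theorem exists_contDiff_one_of_isCompact_subset_isOpen {K V : Set (closure Ω)} (hK : IsCompact K)
    (hV : IsOpen V) (hKV : K ⊆ V) :
    ∃ φ : EuclideanSpace ℝ (Fin N) → ℝ, ContDiff ℝ ∞ φ ∧ HasCompactSupport φ ∧
      (∀ x, 0 ≤ φ x ∧ φ x ≤ 1) ∧ (∀ x ∈ K, φ x = 1) ∧ ∀ x : closure Ω, x ∉ V → φ x = 0 := by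
  obtain ⟨V', hV', rfl⟩ := isOpen_induced_iff.1 hV
  have hK' : IsCompact (Subtype.val '' K) := hK.image continuous_subtype_val
  obtain ⟨R, hR⟩ := hK'.isBounded.subset_ball 0
  have hd : Disjoint (V' ∩ Metric.ball 0 R)ᶜ (Subtype.val '' K) := by
    rw [Set.disjoint_compl_left_iff_subset]
    exact Set.subset_inter (Set.image_subset_iff.2 hKV) hR
  obtain ⟨φ, h0, h1, h2⟩ := exists_contMDiffMap_zero_one_of_isClosed (n := ⊤)
    (modelWithCornersSelf ℝ (EuclideanSpace ℝ (Fin N)))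
    (hV'.inter Metric.isOpen_ball).isClosed_compl hK'.isClosed hd
  refine ⟨φ, φ.contMDiff.contDiff, ?_, h2, fun x hx => h1 ⟨x, hx, rfl⟩, fun x hx =>
    h0 fun h => hx h.1⟩
  refine HasCompactSupport.intro (isCompact_closedBall 0 R) fun x hx => h0 fun h => hx ?_
  exact Metric.ball_subset_closedBall h.2

/-- A smooth function squeezed between the indicators of `K` and of an open `V ⊇ K` compares `μ K`
with `ν V`; outer regularity of `ν` brings `ν V` down to `ν K`. -/
theorem measure_le_of_integral_restrictClosure_le {μ ν : Measure (closure Ω)} [ν.OuterRegular]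
    [IsFiniteMeasureOnCompacts ν] [IsFiniteMeasureOnCompacts μ]
    (h : ∀ (φ : EuclideanSpace ℝ (Fin N) → ℝ) (hφ : ContDiff ℝ ∞ φ) (hc : HasCompactSupport φ),
      ∫ x, restrictClosure Ω hφ.continuous hc x ∂μ
        ≤ ∫ x, restrictClosure Ω hφ.continuous hc x ∂ν)
    {K : Set (closure Ω)} (hK : IsCompact K) : μ K ≤ ν K := by
  refine ENNReal.le_of_forall_pos_le_add fun ε hε hν ↦ ?_
  obtain ⟨V, hKV, hV, hVK⟩ : ∃ V ⊇ K, IsOpen V ∧ ν V ≤ ν K + ε :=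
    K.exists_isOpen_le_add ν (ENNReal.coe_pos.2 hε).ne'
  refine le_trans ?_ hVK
  have hVtop : ν V < ⊤ := hVK.trans_lt (ENNReal.add_lt_top.2 ⟨hν, ENNReal.coe_lt_top⟩)
  obtain ⟨φ, hφ, hc, h01, h1, h0⟩ := exists_contDiff_one_of_isCompact_subset_isOpen hK hV hKV
  have hint : ∀ (σ : Measure (closure Ω)) [IsFiniteMeasureOnCompacts σ],
      Integrable (restrictClosure Ω hφ.continuous hc) σ := fun σ _ =>
    (restrictClosure Ω hφ.continuous hc).continuous.integrable_of_hasCompactSupport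
      (restrictClosure Ω hφ.continuous hc).hasCompactSupport
  have h2 : μ.real K ≤ ν.real V := by
    calc μ.real K = ∫ x, K.indicator 1 x ∂μ := (integral_indicator_one hK.measurableSet).symm
      _ ≤ ∫ x, restrictClosure Ω hφ.continuous hc x ∂μ := by
        refine integral_mono ((integrable_indicator_iff hK.measurableSet).2
          (integrableOn_const hK.measure_lt_top.ne)) (hint μ) fun x => ?_
        by_cases hx : x ∈ K
        · rw [Set.indicator_of_mem hx]
          exact (h1 x hx).ge
        · rw [Set.indicator_of_notMem hx]
          exact (h01 x).1
      _ ≤ ∫ x, restrictClosure Ω hφ.continuous hc x ∂ν := h φ hφ hc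
      _ ≤ ∫ x, V.indicator 1 x ∂ν := by
        refine integral_mono (hint ν) ((integrable_indicator_iff hV.measurableSet).2
          (integrableOn_const hVtop.ne)) fun x => ?_
        by_cases hx : x ∈ V
        · rw [Set.indicator_of_mem hx]
          exact (h01 x).2
        · rw [Set.indicator_of_notMem hx]
          exact (h0 x hx).le
      _ = ν.real V := integral_indicator_one hV.measurableSet
  exact (ENNReal.toReal_le_toReal hK.measure_lt_top.ne hVtop.ne).1 h2

/-- A Radon measure on `closure Ω` is determined by the integrals of smooth functions. -/
theorem IsRadon.ext {μ ν : Measure (closure Ω)} (hμ : IsRadon μ) (hν : IsRadon ν)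
    (h : ∀ (φ : EuclideanSpace ℝ (Fin N) → ℝ) (hφ : ContDiff ℝ ∞ φ) (hc : HasCompactSupport φ),
      ∫ x, restrictClosure Ω hφ.continuous hc x ∂μ
        = ∫ x, restrictClosure Ω hφ.continuous hc x ∂ν) : μ = ν := by
  have : LocallyCompactSpace (closure Ω) := isClosed_closure.locallyCompactSpace
  have := hμ.1
  have := hμ.2
  have := hν.1
  have := hν.2
  have hK : ∀ K : Set (closure Ω), IsCompact K → μ K = ν K := fun K hK =>
    le_antisymm
      (measure_le_of_integral_restrictClosure_le (fun φ hφ hc => (h φ hφ hc).le) hK)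
      (measure_le_of_integral_restrictClosure_le (fun φ hφ hc => (h φ hφ hc).ge) hK)
  refine Measure.ext fun s hs => ?_
  rw [hs.measure_eq_iSup_isCompact, hs.measure_eq_iSup_isCompact]
  exact iSup_congr fun K => iSup_congr fun _ => iSup_congr fun hKc => hK K hKc

theorem isRadon_of_regular (μ : Measure (closure Ω)) [μ.Regular] : IsRadon μ := by
  have : LocallyCompactSpace (closure Ω) := isClosed_closure.locallyCompactSpace
  exact ⟨inferInstance, inferInstance⟩

end RelCap

/-! ### Potentials, the capacitary measure and its energy. -/

namespace RelCap

open CompactlySupported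

variable {N : ℕ} {p : ℝ≥0∞} [Fact (1 ≤ p)] {Ω : Set (EuclideanSpace ℝ (Fin N))}

/-- The element of `W̃^{1,p}(Ω)` given by an element of the refined Sobolev space. -/
noncomputable def Refined.tilde (c : Refined p Ω) : Tilde p Ω := c.toTilde

theorem Refined.norm_tilde (c : Refined p Ω) : ‖c.tilde‖ = ‖c‖ := rfl

/-- A functional on the refined Sobolev space as a functional on `W̃^{1,p}(Ω)`. -/
def RefinedDual.tilde (Φ : RefinedDual p Ω) : StrongDual ℝ (Tilde p Ω) := Φ

theorem RefinedDual.norm_tilde (Φ : RefinedDual p Ω) : ‖RefinedDual.tilde Φ‖ = ‖Φ‖ := rfl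

theorem Refined.quasiContinuous (c : Refined p Ω) {f : closure Ω → ℝ} (hf : f ∈ c.1) :
    QuasiContinuous p Ω f := by
  obtain ⟨c, u, g, h1, h2, rfl⟩ := c
  exact hf.1

theorem Refined.represents (hp : p < ⊤) (c : Refined p Ω) {f : closure Ω → ℝ} (hf : f ∈ c.1) :
    Represents f c.tilde :=
  c.agreesOn hp hf

/-- The class of a quasi continuous function that represents an element of `W̃^{1,p}(Ω)`. -/
def Refined.mk {f : closure Ω → ℝ} {u : Tilde p Ω} (hf : QuasiContinuous p Ω f)
    (hfu : Represents f u) : Refined p Ω :=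
  ⟨quasiClass p Ω f, u, f, hf, hfu, rfl⟩

theorem Refined.tilde_mk (hp : p < ⊤) (hΩ : IsOpen Ω) {f : closure Ω → ℝ} {u : Tilde p Ω}
    (hf : QuasiContinuous p Ω f) (hfu : Represents f u) : (Refined.mk hf hfu).tilde = u :=
  Represents.unique hΩ ((Refined.mk hf hfu).represents hp
    ⟨hf, ∅, relCap_empty hp, fun _ _ => rfl⟩) hfu

theorem Refined.exists_tilde_eq (hp1 : 1 < p) (hp : p < ⊤) (hΩ : IsOpen Ω) (u : Tilde p Ω) :
    ∃ c : Refined p Ω, c.tilde = u := by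
  obtain ⟨f, hf, hfu⟩ := exists_quasiContinuous hp1 hp hΩ u
  exact ⟨Refined.mk hf hfu, Refined.tilde_mk hp hΩ hf hfu⟩

/-- Every element of `Tilde p Ω` has a quasi continuous version, so minimizing over classes is
minimizing over the whole Banach space. -/
theorem isPotential_iff (hp1 : 1 < p) (hp : p < ⊤) (hΩ : IsOpen Ω) {Φ : RefinedDual p Ω}
    {c : Refined p Ω} : IsPotential p Ω Φ c ↔ ∀ v : Tilde p Ω,
      1 / p.toReal * ‖c.tilde‖ ^ p.toReal - RefinedDual.tilde Φ c.tilde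
        ≤ 1 / p.toReal * ‖v‖ ^ p.toReal - RefinedDual.tilde Φ v := by
  refine ⟨fun h v => ?_, fun h v => h v.tilde⟩
  obtain ⟨d, rfl⟩ := Refined.exists_tilde_eq hp1 hp hΩ v
  exact h d

/-- The derivative of `v ↦ ‖v‖ ^ p / p` on `W̃^{1,p}(Ω)`. -/
noncomputable def tildeDuality (hp1 : 1 < p) (hp : p < ⊤) (u : Tilde p Ω) :
    StrongDual ℝ (Tilde p Ω) :=
  (dualityMap hp1 hp (components p Ω u)).comp (components p Ω)

theorem tildeDuality_self (hp1 : 1 < p) (hp : p < ⊤) (u : Tilde p Ω) :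
    tildeDuality hp1 hp u u = ‖u‖ ^ p.toReal :=
  dualityMap_self hp1 hp (components p Ω u)

theorem norm_rpow_div_sub_tildeDuality_le (hp1 : 1 < p) (hp : p < ⊤) (u v : Tilde p Ω) :
    1 / p.toReal * ‖u‖ ^ p.toReal - tildeDuality hp1 hp u u
      ≤ 1 / p.toReal * ‖v‖ ^ p.toReal - tildeDuality hp1 hp u v := by
  have h := norm_rpow_div_add_dualityMap_le hp1 hp (components p Ω u) (components p Ω v)
  rw [map_sub, norm_components, norm_components] at h
  change _ + (tildeDuality hp1 hp u v - tildeDuality hp1 hp u u) ≤ _ at h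
  linarith

theorem eq_tildeDuality_of_forall_le (hp1 : 1 < p) (hp : p < ⊤) {Ψ : StrongDual ℝ (Tilde p Ω)}
    {u : Tilde p Ω} (h : ∀ v : Tilde p Ω, 1 / p.toReal * ‖u‖ ^ p.toReal - Ψ u
      ≤ 1 / p.toReal * ‖v‖ ^ p.toReal - Ψ v) : Ψ = tildeDuality hp1 hp u := by
  refine ContinuousLinearMap.ext fun v => ?_
  refine eq_dualityMap_of_forall_le hp1 hp (u := components p Ω u) (v := components p Ω v)
    (a := Ψ u) (b := Ψ v) fun t => ?_
  have := h (u + t • v)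
  rw [map_add, map_smul, smul_eq_mul] at this
  rwa [← map_smul, ← map_add, norm_components, norm_components]

theorem IsPotential.tilde_eq (hp1 : 1 < p) (hp : p < ⊤) (hΩ : IsOpen Ω) {Φ : RefinedDual p Ω}
    {c : Refined p Ω} (h : IsPotential p Ω Φ c) :
    RefinedDual.tilde Φ = tildeDuality hp1 hp c.tilde :=
  eq_tildeDuality_of_forall_le hp1 hp ((isPotential_iff hp1 hp hΩ).1 h)

/-- Minimality of `u`, tested on multiples of `v` with norm `‖u‖`, gives the upper bound; evaluation
at `u` gives the lower one. For `u = 0` the scaling degenerates, but `0` minimizes for the zero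
functional. -/
theorem norm_tildeDuality (hp1 : 1 < p) (hp : p < ⊤) (u : Tilde p Ω) :
    ‖tildeDuality hp1 hp u‖ = ‖u‖ ^ (p.toReal - 1) := by
  have hq := one_lt_toReal hp1 hp
  have hq0 : p.toReal ≠ 0 := by linarith
  have hq1 : p.toReal - 1 ≠ 0 := by linarith
  rcases eq_or_ne u 0 with rfl | hu
  · rw [← eq_tildeDuality_of_forall_le hp1 hp (Ψ := 0) (u := (0 : Tilde p Ω)) fun v => ?_,
      norm_zero, norm_zero, Real.zero_rpow hq1]
    have : 0 ≤ 1 / p.toReal * ‖v‖ ^ p.toReal := by positivity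
    rwa [norm_zero, Real.zero_rpow hq0, mul_zero, zero_apply,
      zero_apply, sub_zero, sub_zero]
  have hpos : 0 < ‖u‖ := norm_pos_iff.2 hu
  have hmul : ‖u‖ ^ (p.toReal - 1) * ‖u‖ = ‖u‖ ^ p.toReal := by
    rw [← Real.rpow_add_one hpos.ne', sub_add_cancel]
  have hle : ∀ v : Tilde p Ω, tildeDuality hp1 hp u v ≤ ‖u‖ ^ (p.toReal - 1) * ‖v‖ := by
    intro v
    rcases eq_or_ne v 0 with rfl | hv
    · simp
    have hv' : 0 < ‖v‖ := norm_pos_iff.2 hv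
    have h := norm_rpow_div_sub_tildeDuality_le hp1 hp u ((‖u‖ / ‖v‖) • v)
    rw [norm_smul, Real.norm_of_nonneg (by positivity), div_mul_cancel₀ _ hv'.ne', map_smul,
      smul_eq_mul, tildeDuality_self, ← hmul] at h
    have h2 : ‖u‖ / ‖v‖ * tildeDuality hp1 hp u v ≤ ‖u‖ ^ (p.toReal - 1) * ‖u‖ := by linarith
    rw [div_mul_eq_mul_div, div_le_iff₀ hv'] at h2
    refine le_of_mul_le_mul_left ?_ hpos
    linarith
  refine le_antisymm (ContinuousLinearMap.opNorm_le_bound _ (by positivity) fun v => ?_) ?_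
  · rw [Real.norm_eq_abs, abs_le]
    have h := hle (-v)
    rw [map_neg, norm_neg] at h
    exact ⟨by linarith, hle v⟩
  · have h := (tildeDuality hp1 hp u).le_opNorm u
    rw [tildeDuality_self, Real.norm_of_nonneg (by positivity), ← hmul] at h
    exact le_of_mul_le_mul_right h hpos

/-- An extremal is given by a quasi continuous function. -/
theorem IsExtremal.exists_mem (hp : p < ⊤) {A : Set (closure Ω)} {c : Refined p Ω}
    (h : IsExtremal p Ω A c) : ∃ f : closure Ω → ℝ, QuasiContinuous p Ω f ∧
      Represents f c.tilde ∧ (∃ P, relCap p Ω P = 0 ∧ ∀ x ∈ A, x ∉ P → 1 ≤ f x) ∧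
      ENNReal.ofReal (‖c.tilde‖ ^ p.toReal) = relCap p Ω A := by
  obtain ⟨f, hf⟩ := c.nonempty hp
  exact ⟨f, c.quasiContinuous hf, c.represents hp hf, h.1 f hf, h.2⟩

theorem IsExtremal.tilde_eq (hp1 : 1 < p) (hp : p < ⊤) (hΩ : IsOpen Ω) {A : Set (closure Ω)}
    {c d : Refined p Ω} (hc : IsExtremal p Ω A c) (hd : IsExtremal p Ω A d) :
    c.tilde = d.tilde := by
  obtain ⟨f, hf, hfc, ⟨P, hP, hPA⟩, hc'⟩ := hc.exists_mem hp
  obtain ⟨g, hg, hgd, ⟨Q, hQ, hQA⟩, hd'⟩ := hd.exists_mem hp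
  exact extremal_unique hp1 hp hΩ hf hfc hg hgd hP hPA hQ hQA hc' hd'

theorem exists_isExtremal (hp1 : 1 < p) (hp : p < ⊤) (hΩ : IsOpen Ω) {A : Set (closure Ω)}
    (hA : relCap p Ω A < ⊤) : ∃ c : Refined p Ω, IsExtremal p Ω A c := by
  obtain ⟨z, f, hf, hfz, ⟨P, hP, hPA⟩, hz⟩ := exists_extremal hp1 hp hΩ hA
  refine ⟨Refined.mk hf hfz, ?_, ?_⟩
  · rintro g ⟨_, Q, hQ, hQf⟩
    refine ⟨P ∪ Q, relCap_union_eq_zero hp1 hp hΩ hP hQ, fun x hxA hx => ?_⟩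
    rw [Set.mem_union, not_or] at hx
    rw [hQf x hx.2]
    exact hPA x hxA hx.1
  · rw [← Refined.norm_tilde, Refined.tilde_mk hp hΩ, hz]

/-- The derivative of the norm at an extremal is a positive functional. -/
theorem IsExtremal.tildeDuality_nonneg (hp1 : 1 < p) (hp : p < ⊤) (hΩ : IsOpen Ω)
    {A : Set (closure Ω)} {c : Refined p Ω} (hc : IsExtremal p Ω A c) {v : C_c(closure Ω, ℝ)}
    {w : Tilde p Ω} (hv : Represents v w) (h0 : ∀ x, 0 ≤ v x) :
    0 ≤ tildeDuality hp1 hp c.tilde w := by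
  have hq := one_lt_toReal hp1 hp
  obtain ⟨f, hf, hfc, ⟨P, hP, hPA⟩, hc'⟩ := hc.exists_mem hp
  refine dualityMap_nonneg_of_forall_le hp1 hp fun t ht => ?_
  have hadd : components p Ω c.tilde + t • components p Ω w = components p Ω (c.tilde + t • w) := by
    rw [map_add, map_smul]
  change ‖components p Ω c.tilde‖ ≤ ‖components p Ω c.tilde + t • components p Ω w‖
  rw [hadd, norm_components, norm_components]
  -- Adding `t v ≥ 0` keeps the function at least `1` q.e. on `A`, so the norm cannot fall below
  -- that of the extremal.
  have h := relCap_le_of_one_le hp1 hp hΩ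
    (hf.add hp1 hp hΩ ((quasiContinuous_of_continuous hp v.continuous).smul t))
    (hfc.add (hv.smul t)) hP (A := A) fun x hxA hx =>
      (hPA x hxA hx).trans (le_add_of_nonneg_right (mul_nonneg ht (h0 x)))
  rw [← hc', ENNReal.ofReal_le_ofReal_iff (by positivity)] at h
  exact (Real.rpow_le_rpow_iff (norm_nonneg _) (norm_nonneg _) (by linarith)).1 h

theorem isExtension_iff {μ : Measure (closure Ω)} {Φ : RefinedDual p Ω} :
    IsExtension μ Φ ↔ ∀ (v : C_c(closure Ω, ℝ)) (w : Tilde p Ω), Represents v w →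
      RefinedDual.tilde Φ w = ∫ x, v x ∂μ :=
  Iff.rfl

theorem belongsToDual_of_forall_eq {μ : Measure (closure Ω)} {Ψ : StrongDual ℝ (Tilde p Ω)}
    (h : ∀ (v : C_c(closure Ω, ℝ)) (w : Tilde p Ω), Represents v w → Ψ w = ∫ x, v x ∂μ) :
    BelongsToDual p Ω μ := by
  refine ⟨‖Ψ‖, ?_⟩
  rintro r ⟨v, w, hvw, hw, rfl⟩
  obtain ⟨u, hu, huw⟩ := hvw.exists_tilde
  rw [← h v u hu]
  have h1 : ‖u‖ ≤ 1 := by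
    rw [← norm_components, huw]
    exact hw
  exact (le_abs_self _).trans (Ψ.unit_le_opNorm u h1)

theorem isExtension_toDual (hΩ : IsOpen Ω) {μ : Measure (closure Ω)} (hμ : IsRadon μ)
    (hd : BelongsToDual p Ω μ) : IsExtension μ (toDual p Ω μ) := by
  have h := (existsUnique_isExtension hΩ hμ hd).exists
  rw [toDual, dif_pos h]
  exact h.choose_spec

theorem toDual_eq (hΩ : IsOpen Ω) {μ : Measure (closure Ω)} (hμ : IsRadon μ)
    (hd : BelongsToDual p Ω μ) {Φ : RefinedDual p Ω} (hΦ : IsExtension μ Φ) :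
    toDual p Ω μ = Φ :=
  (existsUnique_isExtension hΩ hμ hd).unique (isExtension_toDual hΩ hμ hd) hΦ

/-- The measure represents the derivative of `‖·‖ ^ p / p` at the extremal; the tangent inequality
then says that the extremal is a potential of it. -/
theorem exists_isCapMeasure (hp1 : 1 < p) (hp : p < ⊤) (hΩ : IsOpen Ω) {A : Set (closure Ω)}
    (hA : relCap p Ω A < ⊤) : ∃ μ : Measure (closure Ω), IsCapMeasure p Ω A μ := by
  obtain ⟨c, hc⟩ := exists_isExtremal hp1 hp hΩ hA
  obtain ⟨μ, hμ, h⟩ := exists_measure_of_nonneg hΩ (tildeDuality hp1 hp c.tilde)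
    fun v w hvw h0 => hc.tildeDuality_nonneg hp1 hp hΩ hvw h0
  have hR := isRadon_of_regular μ
  have hd := belongsToDual_of_forall_eq h
  refine ⟨μ, hR, hd, c, ?_, hc⟩
  rw [toDual_eq hΩ hR hd (Φ := tildeDuality hp1 hp c.tilde) h]
  refine (isPotential_iff hp1 hp hΩ).2 ?_
  exact norm_rpow_div_sub_tildeDuality_le hp1 hp c.tilde

/-- A potential determines its functional by the Euler–Lagrange equation, and all extremals coincide
in the space. The functional thus depends on `A` alone, which underlies both uniqueness and the
formulas. -/
theorem IsCapMeasure.tilde_toDual_eq (hp1 : 1 < p) (hp : p < ⊤) (hΩ : IsOpen Ω)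
    {A : Set (closure Ω)} {μ : Measure (closure Ω)} (hμ : IsCapMeasure p Ω A μ) {u : Refined p Ω}
    (hu : IsExtremal p Ω A u) :
    RefinedDual.tilde (toDual p Ω μ) = tildeDuality hp1 hp u.tilde := by
  obtain ⟨_, _, c, hc, hcA⟩ := hμ
  rw [hc.tilde_eq hp1 hp hΩ, hcA.tilde_eq hp1 hp hΩ hu]

theorem IsCapMeasure.unique (hp1 : 1 < p) (hp : p < ⊤) (hΩ : IsOpen Ω) {A : Set (closure Ω)}
    {μ ν : Measure (closure Ω)} (hμ : IsCapMeasure p Ω A μ) (hν : IsCapMeasure p Ω A ν) :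
    μ = ν := by
  obtain ⟨u, _, hu⟩ := hμ.2.2
  have h := (hμ.tilde_toDual_eq hp1 hp hΩ hu).trans (hν.tilde_toDual_eq hp1 hp hΩ hu).symm
  refine hμ.1.ext hν.1 fun φ hφ hc => ?_
  obtain ⟨w, hw⟩ := exists_represents_restrictClosure (p := p) (Ω := Ω) hφ hc
  rw [← isExtension_iff.1 (isExtension_toDual hΩ hμ.1 hμ.2.1) _ w hw,
    ← isExtension_iff.1 (isExtension_toDual hΩ hν.1 hν.2.1) _ w hw, h]

theorem IsCapMeasure.toDual_apply (hp1 : 1 < p) (hp : p < ⊤) (hΩ : IsOpen Ω) {A : Set (closure Ω)}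
    {μ : Measure (closure Ω)} (hμ : IsCapMeasure p Ω A μ) {u : Refined p Ω}
    (hu : IsExtremal p Ω A u) : toDual p Ω μ u.toTilde = ‖u‖ ^ p.toReal :=
  (DFunLike.congr_fun (hμ.tilde_toDual_eq hp1 hp hΩ hu) u.tilde).trans
    (tildeDuality_self hp1 hp u.tilde)

/-- The dual norm is `‖u‖ ^ (p - 1)`, and `(p - 1) p' = p`. -/
theorem IsCapMeasure.energy_eq (hp1 : 1 < p) (hp : p < ⊤) (hΩ : IsOpen Ω) {A : Set (closure Ω)}
    {μ : Measure (closure Ω)} (hμ : IsCapMeasure p Ω A μ) {u : Refined p Ω}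
    (hu : IsExtremal p Ω A u) : energy p Ω μ = ‖u‖ ^ p.toReal := by
  have hq := one_lt_toReal hp1 hp
  rw [energy, ← RefinedDual.norm_tilde, hμ.tilde_toDual_eq hp1 hp hΩ hu, norm_tildeDuality,
    ← Real.rpow_mul (norm_nonneg u.tilde), Real.conjExponent, mul_div_cancel₀ _ (by linarith),
    Refined.norm_tilde]

end RelCap

theorem mainTheorem7 {N : ℕ} (p : ENNReal) [Fact (1 ≤ p)] (hp1 : 1 < p) (hp : p < ⊤)
    (Ω : Set (EuclideanSpace ℝ (Fin N))) (hΩ : IsOpen Ω) (hne : Ω.Nonempty)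
    (A : Set (closure Ω)) (hA : RelCap.relCap p Ω A < ⊤) :
    (∃! μ : MeasureTheory.Measure (closure Ω), RelCap.IsCapMeasure p Ω A μ) ∧
    ∀ μ : MeasureTheory.Measure (closure Ω), RelCap.IsCapMeasure p Ω A μ →
      ∀ u : RelCap.Refined p Ω, RelCap.IsExtremal p Ω A u →
        RelCap.relCap p Ω A = ENNReal.ofReal (‖u‖ ^ p.toReal) ∧
        ‖u‖ ^ p.toReal = RelCap.toDual p Ω μ u.toTilde ∧
        RelCap.toDual p Ω μ u.toTilde = RelCap.energy p Ω μ := by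
  obtain ⟨μ, hμ⟩ := RelCap.exists_isCapMeasure hp1 hp hΩ hA
  refine ⟨⟨μ, hμ, fun ν hν => hν.unique hp1 hp hΩ hμ⟩, fun ν hν u hu => ⟨hu.2.symm, ?_, ?_⟩⟩
  · exact (hν.toDual_apply hp1 hp hΩ hu).symm
  · exact (hν.toDual_apply hp1 hp hΩ hu).trans (hν.energy_eq hp1 hp hΩ hu).symm
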